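/- Let $a,A,b,B\in\mathbb{C}\setminus\{0\}$, $P(x)=a e^{-2ix}+A e^{2ix}$, $Q(x)=b e^{-2ix}+B e^{2ix}$, and consider the Dirac operator $$Ly=i\begin{pmatrix}1&0\\0&-1\end{pmatrix}\frac{dy}{dx}+\begin{pmatrix}0&P\\Q&0\end{pmatrix}y,\qquad y=\begin{pmatrix}y_1\\y_2\end{pmatrix},$$ as an unbounded operator in $L^2([0,\pi],\mathbb{C}^2)$, whose domain consists of the absolutely continuous $y$ with $y'\in L^2$ that satisfy the periodic boundary condition $y(\pi)=y(0)$ or the antiperiodic boundary condition $y(\pi)=-y(0)$. For $n\in\mathbb{Z}$ with $|n|$ large enough, $L$ with the periodic (if $n$ is even) or antiperiodic (if $n$ is odd) boundary condition has in the disc $|z-n|<\tfrac12$ exactly two eigenvalues $\lambda_n^-,\lambda_n^+$, counted with algebraic multiplicity, numbered so that $\operatorname{Re}\lambda_n^-<\operatorname{Re}\lambda_n^+$, or $\operatorname{Re}\lambda_n^-=\operatorname{Re}\lambda_n^+$ and $\operatorname{Im}\lambda_n^-\le\operatorname{Im}\lambda_n^+$. As $|n|\to\infty$ they satisfy $$\lambda_n^\pm=n+\frac{Ab+aB}{2n}+\frac{aB-Ab}{2n^2}+O\left(\frac1{|n|^3}\right).$$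 Put $\gamma_n=\lambda_n^+-\lambda_n^-$. If $n$ is even and $|n|$ is large enough, then $\gamma_n=0$. For odd $n=\pm(2m+1)$, $m\in\mathbb{N}$, as $m\to\infty$, $$\gamma_{2m+1}=\pm2\,\frac{\sqrt{(Ab)^m(aB)^{m+1}}}{4^{2m}(m!)^2}\left[1+O\left(\frac{\log^2m}{m^2}\right)\right],$$ $$\gamma_{-(2m+1)}=\pm2\,\frac{\sqrt{(Ab)^{m+1}(aB)^m}}{4^{2m}(m!)^2}\left[1+O\left(\frac{\log^2m}{m^2}\right)\right],$$ where $\pm\sqrt{\cdot}$ means one of the two complex square roots, which one may depend on $m$. The constants in the $O$-terms and the thresholds may depend on $a,A,b,B$. -/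

import Mathlib

open MeasureTheory

/-! ### Algebraic multiplicity of eigenvalues of an unbounded operator -/

/-- `generalizedEigenspace T z k` is `ker (T - z)^k` for an unbounded operator `T`:
`f` lies in `ker (T - z)^(k+1)` iff `f ∈ dom T` and `T f - z f ∈ ker (T - z)^k`. -/
def generalizedEigenspace {E : Type*} [AddCommGroup E] [Module ℂ E]
    (T : E →ₗ.[ℂ] E) (z : ℂ) : ℕ → Submodule ℂ E
  | 0 => ⊥
  | k + 1 => ((generalizedEigenspace T z k).comap
      (T.toFun - z • T.domain.subtype)).map T.domain.subtype

/-- The algebraic multiplicity of `z` as an eigenvalue of `T`: the dimension of the root space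
`⋃ₖ ker (T - z)^k` (the spaces increase with `k`, so that the supremum is the union).
It is `0` iff `z` is not an eigenvalue. -/
noncomputable def algebraicMultiplicity {E : Type*} [AddCommGroup E] [Module ℂ E]
    (T : E →ₗ.[ℂ] E) (z : ℂ) : Cardinal :=
  Module.rank ℂ ↥(⨆ k : ℕ, generalizedEigenspace T z k)

theorem mem_generalizedEigenspace_succ {E : Type*} [AddCommGroup E] [Module ℂ E]
    (T : E →ₗ.[ℂ] E) (z : ℂ) (k : ℕ) (f : E) :
    f ∈ generalizedEigenspace T z (k + 1) ↔
      ∃ h : f ∈ T.domain, T ⟨f, h⟩ - z • f ∈ generalizedEigenspace T z k := by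
  simp only [generalizedEigenspace, Submodule.mem_map, Submodule.mem_comap]
  constructor
  · rintro ⟨⟨g, hg⟩, h1, rfl⟩
    exact ⟨hg, h1⟩
  · rintro ⟨h, h1⟩
    exact ⟨⟨f, h⟩, h1, rfl⟩

/-! ### The Dirac operator on `[0, π]` -/

/-- Lebesgue measure on `[0, π]`. -/
noncomputable def intervalMeasure : Measure ℝ := volume.restrict (Set.Icc 0 Real.pi)

/-- The Hilbert space `L²([0, π], ℂ²) = L²([0, π]) ⊕ L²([0, π])`. -/
abbrev DiracSpace : Type := WithLp 2 (Lp ℂ 2 intervalMeasure × Lp ℂ 2 intervalMeasure)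

/-- `y` is absolutely continuous on `[0, π]` with derivative `d ∈ L²([0, π])`. -/
def HasL2Deriv (y d : ℝ → ℂ) : Prop :=
  MemLp d 2 intervalMeasure ∧
    ∀ x ∈ Set.Icc (0 : ℝ) Real.pi, y x = y 0 + ∫ t in (0 : ℝ)..x, d t

theorem HasL2Deriv.intervalIntegrable {y d : ℝ → ℂ} (h : HasL2Deriv y d) :
    IntervalIntegrable d volume 0 Real.pi := by
  have hf : IsFiniteMeasure intervalMeasure := by unfold intervalMeasure; infer_instance
  have h1 : Integrable d intervalMeasure := h.1.integrable (by norm_num)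
  rw [intervalIntegrable_iff_integrableOn_Icc_of_le Real.pi_pos.le]
  exact h1

theorem HasL2Deriv.intervalIntegrable' {y d : ℝ → ℂ} (h : HasL2Deriv y d) {x : ℝ}
    (hx : x ∈ Set.Icc (0 : ℝ) Real.pi) : IntervalIntegrable d volume 0 x := by
  refine h.intervalIntegrable.mono_set ?_
  rw [Set.uIcc_of_le hx.1, Set.uIcc_of_le Real.pi_pos.le]
  exact Set.Icc_subset_Icc_right hx.2

theorem HasL2Deriv.add {y d y' d' : ℝ → ℂ} (h : HasL2Deriv y d) (h' : HasL2Deriv y' d') :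
    HasL2Deriv (y + y') (d + d') := by
  refine ⟨h.1.add h'.1, fun x hx => ?_⟩
  simp only [Pi.add_apply]
  rw [intervalIntegral.integral_add (h.intervalIntegrable' hx) (h'.intervalIntegrable' hx),
    h.2 x hx, h'.2 x hx]
  ring

theorem HasL2Deriv.smul {y d : ℝ → ℂ} (c : ℂ) (h : HasL2Deriv y d) :
    HasL2Deriv (c • y) (c • d) := by
  refine ⟨h.1.const_smul c, fun x hx => ?_⟩
  simp only [Pi.smul_apply, smul_eq_mul]
  rw [intervalIntegral.integral_const_mul, h.2 x hx]
  ring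

theorem HasL2Deriv.zero : HasL2Deriv 0 0 :=
  ⟨MemLp.zero, fun x _ => by simp⟩

theorem HasL2Deriv.eq_zero {y d : ℝ → ℂ} (h : HasL2Deriv y d) (h0 : y =ᵐ[intervalMeasure] 0) :
    d =ᵐ[intervalMeasure] 0 := by
  have hI := h.intervalIntegrable
  have hc : ContinuousOn y (Set.Icc 0 Real.pi) := by
    have h1 := intervalIntegral.continuousOn_primitive_interval' hI (Set.left_mem_uIcc)
    rw [Set.uIcc_of_le Real.pi_pos.le] at h1
    exact (continuousOn_const.add h1).congr h.2
  have hz : Set.EqOn y 0 (Set.Icc 0 Real.pi) :=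
    Measure.eqOn_Icc_of_ae_eq volume Real.pi_pos.ne h0 hc continuousOn_const
  have hd := hI.ae_hasDerivAt_integral
  have hne : ∀ᵐ x : ℝ, x ≠ 0 ∧ x ≠ Real.pi := by
    simp only [ne_eq, Filter.eventually_and]
    exact ⟨Measure.ae_ne volume 0, Measure.ae_ne volume Real.pi⟩
  have hm : ∀ᵐ x : ℝ ∂intervalMeasure, x ∈ Set.Icc (0 : ℝ) Real.pi :=
    ae_restrict_mem measurableSet_Icc
  filter_upwards [ae_restrict_of_ae hd, ae_restrict_of_ae hne, hm] with x hx hx0 hxm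
  have hxu : x ∈ Set.uIcc 0 Real.pi := by rwa [Set.uIcc_of_le Real.pi_pos.le]
  have h1 := hx hxu 0 Set.left_mem_uIcc
  have hnb : Set.Icc (0 : ℝ) Real.pi ∈ nhds x :=
    Icc_mem_nhds (lt_of_le_of_ne hxm.1 (Ne.symm hx0.1)) (lt_of_le_of_ne hxm.2 hx0.2)
  have h2 : HasDerivAt (fun _ : ℝ => - y 0) (d x) x := by
    refine h1.congr_of_eventuallyEq ?_
    filter_upwards [hnb] with t ht
    have h3 := h.2 t ht
    have h4 := hz ht
    simp only [Pi.zero_apply] at h4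
    rw [h4] at h3
    linear_combination h3
  exact h2.unique (hasDerivAt_const x _)

/-- The graph of the Dirac operator
`L y = i diag(1, -1) y' + [[0, P], [Q, 0]] y` in `L²([0, π], ℂ²)` with boundary condition
`y(π) = t y(0)`: the pairs `(f, L f)` where `f` has an absolutely continuous representative
`y = (y₁, y₂)` with derivative in `L²` that satisfies the boundary condition. -/
def diracGraph (P Q : ℝ → ℂ) (t : ℂ) : Submodule ℂ (DiracSpace × DiracSpace) where
  carrier := {w | ∃ y₁ y₂ d₁ d₂ : ℝ → ℂ, HasL2Deriv y₁ d₁ ∧ HasL2Deriv y₂ d₂ ∧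
    y₁ Real.pi = t * y₁ 0 ∧ y₂ Real.pi = t * y₂ 0 ∧
    w.1.fst =ᵐ[intervalMeasure] y₁ ∧ w.1.snd =ᵐ[intervalMeasure] y₂ ∧
    w.2.fst =ᵐ[intervalMeasure] (fun x => Complex.I * d₁ x + P x * y₂ x) ∧
    w.2.snd =ᵐ[intervalMeasure] (fun x => -Complex.I * d₂ x + Q x * y₁ x)}
  add_mem' := by
    rintro v w ⟨y₁, y₂, d₁, d₂, h1, h2, h3, h4, h5, h6, h7, h8⟩
      ⟨z₁, z₂, e₁, e₂, k1, k2, k3, k4, k5, k6, k7, k8⟩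
    refine ⟨y₁ + z₁, y₂ + z₂, d₁ + e₁, d₂ + e₂, h1.add k1, h2.add k2, ?_, ?_, ?_, ?_, ?_, ?_⟩
    · simp only [Pi.add_apply, h3, k3]; ring
    · simp only [Pi.add_apply, h4, k4]; ring
    · exact (Lp.coeFn_add v.1.fst w.1.fst).trans (h5.add k5)
    · exact (Lp.coeFn_add v.1.snd w.1.snd).trans (h6.add k6)
    · refine (Lp.coeFn_add v.2.fst w.2.fst).trans ((h7.add k7).trans (Filter.Eventually.of_forall
        fun x => ?_))
      simp only [Pi.add_apply]; ring
    · refine (Lp.coeFn_add v.2.snd w.2.snd).trans ((h8.add k8).trans (Filter.Eventually.of_forall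
        fun x => ?_))
      simp only [Pi.add_apply]; ring
  zero_mem' := by
    refine ⟨0, 0, 0, 0, HasL2Deriv.zero, HasL2Deriv.zero, by simp, by simp, ?_, ?_, ?_, ?_⟩
    · exact Lp.coeFn_zero ℂ 2 intervalMeasure
    · exact Lp.coeFn_zero ℂ 2 intervalMeasure
    · refine (Lp.coeFn_zero ℂ 2 intervalMeasure).trans (Filter.Eventually.of_forall fun x => ?_)
      simp
    · refine (Lp.coeFn_zero ℂ 2 intervalMeasure).trans (Filter.Eventually.of_forall fun x => ?_)
      simp
  smul_mem' := by
    rintro c v ⟨y₁, y₂, d₁, d₂, h1, h2, h3, h4, h5, h6, h7, h8⟩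
    refine ⟨c • y₁, c • y₂, c • d₁, c • d₂, h1.smul c, h2.smul c, ?_, ?_, ?_, ?_, ?_, ?_⟩
    · simp only [Pi.smul_apply, smul_eq_mul, h3]; ring
    · simp only [Pi.smul_apply, smul_eq_mul, h4]; ring
    · exact (Lp.coeFn_smul c v.1.fst).trans (h5.const_smul c)
    · exact (Lp.coeFn_smul c v.1.snd).trans (h6.const_smul c)
    · refine (Lp.coeFn_smul c v.2.fst).trans ((h7.const_smul c).trans
        (Filter.Eventually.of_forall fun x => ?_))
      simp only [Pi.smul_apply, smul_eq_mul]; ring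
    · refine (Lp.coeFn_smul c v.2.snd).trans ((h8.const_smul c).trans
        (Filter.Eventually.of_forall fun x => ?_))
      simp only [Pi.smul_apply, smul_eq_mul]; ring

/-- `diracGraph` is single-valued, so it really is the graph of an operator. -/
theorem diracGraph_single_valued (P Q : ℝ → ℂ) (t : ℂ) :
    ∀ w : DiracSpace × DiracSpace, w ∈ diracGraph P Q t → w.1 = 0 → w.2 = 0 := by
  rintro w ⟨y₁, y₂, d₁, d₂, h1, h2, -, -, h5, h6, h7, h8⟩ hw
  have hf : w.1.fst = 0 := by rw [hw]; rfl
  have hs : w.1.snd = 0 := by rw [hw]; rfl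
  rw [hf] at h5
  rw [hs] at h6
  have z1 : y₁ =ᵐ[intervalMeasure] 0 := h5.symm.trans (Lp.coeFn_zero ℂ 2 intervalMeasure)
  have z2 : y₂ =ᵐ[intervalMeasure] 0 := h6.symm.trans (Lp.coeFn_zero ℂ 2 intervalMeasure)
  have e1 := h1.eq_zero z1
  have e2 := h2.eq_zero z2
  have g1 : w.2.fst = 0 := by
    rw [Lp.eq_zero_iff_ae_eq_zero]
    filter_upwards [h7, z2, e1] with x a1 a2 a3
    simp [a1, a2, a3]
  have g2 : w.2.snd = 0 := by
    rw [Lp.eq_zero_iff_ae_eq_zero]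
    filter_upwards [h8, z1, e2] with x a1 a2 a3
    simp [a1, a2, a3]
  exact (WithLp.ofLp_injective 2) (Prod.ext g1 g2)

/-- The Dirac operator with potential `[[0, P], [Q, 0]]` and boundary condition
`y(π) = t y(0)`, as an unbounded operator in `L²([0, π], ℂ²)`. -/
noncomputable def diracOperator (P Q : ℝ → ℂ) (t : ℂ) : DiracSpace →ₗ.[ℂ] DiracSpace :=
  (diracGraph P Q t).toLinearPMap

theorem diracOperator_graph (P Q : ℝ → ℂ) (t : ℂ) :
    (diracOperator P Q t).graph = diracGraph P Q t :=
  Submodule.toLinearPMap_graph_eq _ (diracGraph_single_valued P Q t)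

/-- The boundary condition that goes with the index `n`: periodic, `y(π) = y(0)`, if `n` is even,
and antiperiodic, `y(π) = -y(0)`, if `n` is odd. -/
def boundarySign (n : ℤ) : ℂ := if Even n then 1 else -1

/-- `l` and `l'` are the eigenvalues `λₙ⁻` and `λₙ⁺`: they are exactly the eigenvalues, counted with
algebraic multiplicity, in the disc `|z - n| < 1/2` of the periodic (`n` even) or antiperiodic
(`n` odd) Dirac operator, listed by real part and then by imaginary part. This determines `l`
and `l'`. -/
def IsEigenvaluePair (P Q : ℝ → ℂ) (n : ℤ) (l l' : ℂ) : Prop :=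
  l ∈ Metric.ball (n : ℂ) (1 / 2) ∧ l' ∈ Metric.ball (n : ℂ) (1 / 2) ∧
  (∀ z ∈ Metric.ball (n : ℂ) (1 / 2),
    algebraicMultiplicity (diracOperator P Q (boundarySign n)) z =
      (Multiset.count z {l, l'} : ℕ)) ∧
  (l.re < l'.re ∨ (l.re = l'.re ∧ l.im ≤ l'.im))

/-- The function `x ↦ c e^{-2ix} + C e^{2ix}`. -/
noncomputable def trigPotential (c C : ℂ) (x : ℝ) : ℂ :=
  c * Complex.exp (-2 * Complex.I * x) + C * Complex.exp (2 * Complex.I * x)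

/-! In the Fourier basis `e^{-i(2k+p)x}` (`p = 0` periodic, `p = 1` antiperiodic) the operator is an
infinite matrix with diagonal entries `±(2k+p)`. The potential is off-diagonal and has only the
frequencies `±2`, so every step in `k` changes the component. The matrix therefore splits into two
tridiagonal chains, and a diagonal similarity makes them symmetric, with links alternately `σ` and
`τ`, where `σ² = Ab` and `τ² = aB`, and diagonal `ε(-1)^k(2k+p)` with `ε = 1` and `ε = -1`.
Coefficients of root functions decay faster than every geometric sequence, so algebraic
multiplicities can be computed on such sequences (`algebraicMultiplicity_diracOperator`,
`rank_diracChain`).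

Because of the alternating sign, the neighbours of a site with entry near `n` have entries near
`-n`. Bounded links are then a small perturbation: an isolated diagonal entry carries exactly one
nearby eigenvalue, and it is algebraically simple (`Isolated.exists_eigen`, `IsEigen.rank`). The
equations at the five sites around it give the expansion up to `O(|n|⁻³)` (`eigenvalue_expansion`).

For even `n` the reflection `k ↦ -k` exchanges the chains, so the eigenvalue is double. For odd `n`
only one chain has `n` on its diagonal, at two sites exchanged by `k ↦ -1-k`. Its symmetric and
antisymmetric parts are one-sided chains that differ only in the perturbation `±τ` of the first
diagonal entry (`rank_symChain_one`). Each contributes one eigenvalue, and `γ_n` is their difference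
up to sign.

This difference comes from a discrete Green identity, `(z - z') ∑ w_k w'_k = 2τ w_0 w'_0`
(`halfChain_splitting`). With `w_m = w'_m = 1` the sum is `1 + O(m⁻²)`. Solving the recurrence from
site `0` to site `m` expresses `w_0` as the product of the links over the product of the distances
`4, 8, …, 4m`, that is `4^m m!`, up to a factor close to `1` (`halfChain_first_component`). The
corrections of order `log m / m` to this factor cancel: the shift of the eigenvalue contributes `1 +
t`, the recurrence `1 - t`. The remaining first-order term is odd in the boundary perturbation and
cancels in `w_0 w'_0`, which leaves a relative error `O(log² m / m²)` (`halfChain_gap_asymptotics`).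
-/

/-! ### Rapidly decaying sequences and tridiagonal operators -/

/-- The functions on `ι` that decay faster than every geometric sequence in the height `ht`. -/
def rapid {ι : Type*} (ht : ι → ℕ) : Submodule ℂ (ι → ℂ) where
  carrier := {w | ∀ M : ℕ, 1 ≤ M → ∃ K : ℝ, ∀ i, (M : ℝ) ^ ht i * ‖w i‖ ≤ K}
  add_mem' := by
    intro v w hv hw M hM
    obtain ⟨K, hK⟩ := hv M hM
    obtain ⟨K', hK'⟩ := hw M hM
    refine ⟨K + K', fun i => ?_⟩
    calc (M : ℝ) ^ ht i * ‖(v + w) i‖ ≤ (M : ℝ) ^ ht i * (‖v i‖ + ‖w i‖) := by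
          gcongr; exact norm_add_le _ _
      _ ≤ K + K' := by rw [mul_add]; exact add_le_add (hK i) (hK' i)
  zero_mem' := fun M _ => ⟨0, fun i => by simp⟩
  smul_mem' := by
    intro c v hv M hM
    obtain ⟨K, hK⟩ := hv M hM
    refine ⟨‖c‖ * K, fun i => ?_⟩
    have := mul_le_mul_of_nonneg_left (hK i) (norm_nonneg c)
    simp only [Pi.smul_apply, norm_smul]
    linarith

theorem rapid.bounded {ι : Type*} {ht : ι → ℕ} {w : ι → ℂ} (hw : w ∈ rapid ht) :
    ∃ K : ℝ, ∀ i, ‖w i‖ ≤ K := by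
  obtain ⟨K, hK⟩ := hw 1 le_rfl
  exact ⟨K, fun i => by simpa using hK i⟩

/-- A weighted change of variables preserves rapid decay when the weight grows at most
geometrically and the change of variables lowers the height by a bounded amount. -/
theorem rapid.weighted_comp {ι κ : Type*} {ht : ι → ℕ} {ht' : κ → ℕ} {w : ι → ℂ}
    (hw : w ∈ rapid ht) (φ : κ → ι) (g : κ → ℂ) (D : ℝ) (G N : ℕ) (hG : 1 ≤ G)
    (hg : ∀ k, ‖g k‖ ≤ D * (G : ℝ) ^ ht' k) (hφ : ∀ k, ht' k ≤ ht (φ k) + N) :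
    (fun k => g k * w (φ k)) ∈ rapid ht' := by
  intro M hM
  -- The weight `G ^ ht' k` is absorbed by using the decay of `w` at the ratio `M * G`.
  obtain ⟨K, hK⟩ := hw (M * G) (Nat.mul_pos hM hG)
  refine ⟨|D| * ((M * G : ℕ) : ℝ) ^ N * K, fun k => ?_⟩
  have h1 : (1 : ℝ) ≤ ((M * G : ℕ) : ℝ) := by exact_mod_cast Nat.mul_pos hM hG
  have h2 : ((M * G : ℕ) : ℝ) ^ ht' k ≤ ((M * G : ℕ) : ℝ) ^ (ht (φ k)) *
      ((M * G : ℕ) : ℝ) ^ N := by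
    rw [← pow_add]; exact pow_le_pow_right₀ h1 (hφ k)
  calc (M : ℝ) ^ ht' k * ‖g k * w (φ k)‖
      ≤ (M : ℝ) ^ ht' k * ((|D| * (G : ℝ) ^ ht' k) * ‖w (φ k)‖) := by
        rw [norm_mul]
        gcongr
        exact (hg k).trans (by gcongr; exact le_abs_self D)
    _ = |D| * (((M * G : ℕ) : ℝ) ^ ht' k * ‖w (φ k)‖) := by push_cast; rw [mul_pow]; ring
    _ ≤ |D| * (((M * G : ℕ) : ℝ) ^ (ht (φ k)) * ((M * G : ℕ) : ℝ) ^ N * ‖w (φ k)‖) := by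
        gcongr
    _ = |D| * ((M * G : ℕ) : ℝ) ^ N * (((M * G : ℕ) : ℝ) ^ (ht (φ k)) * ‖w (φ k)‖) := by ring
    _ ≤ _ := by gcongr; exact hK _

/-- The weighted change of variables as a linear map between spaces of rapidly decaying
functions. -/
def rapid.weightedComp {ι κ : Type*} {ht : ι → ℕ} {ht' : κ → ℕ} (φ : κ → ι) (g : κ → ℂ)
    (hg : ∃ (D : ℝ) (G N : ℕ), 1 ≤ G ∧ (∀ k, ‖g k‖ ≤ D * (G : ℝ) ^ ht' k) ∧
      ∀ k, ht' k ≤ ht (φ k) + N) : rapid ht →ₗ[ℂ] rapid ht' where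
  toFun w := ⟨fun k => g k * w.1 (φ k), by
    obtain ⟨D, G, N, h1, h2, h3⟩ := hg
    exact rapid.weighted_comp w.2 φ g D G N h1 h2 h3⟩
  map_add' v w := by ext k; simp [mul_add]
  map_smul' c w := by ext k; simp; ring

/-- The data of a tridiagonal operator
`(J w) i = e i * w i + c i * w (r i) + d i * w (l i)` with bounded off-diagonal entries and
diagonal entries of at least linear and at most geometric growth. -/
structure Chain (ι : Type*) where
  e : ι → ℂ
  c : ι → ℂ
  d : ι → ℂ
  l : ι → ι
  r : ι → ι
  ht : ι → ℕ
  bound : ℝ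
  one_le_bound : 1 ≤ bound
  norm_c_le : ∀ i, ‖c i‖ ≤ bound
  norm_d_le : ∀ i, ‖d i‖ ≤ bound
  ht_l : ∀ i, ht i ≤ ht (l i) + 1
  ht_r : ∀ i, ht i ≤ ht (r i) + 1
  e_le : ∀ i, ‖e i‖ ≤ bound * 2 ^ ht i
  le_e : ∀ i, (ht i : ℝ) ≤ ‖e i‖ + bound

namespace Chain

variable {ι : Type*} (J : Chain ι)

/-- The action of the tridiagonal operator on arbitrary functions. -/
def act (w : ι → ℂ) (i : ι) : ℂ := J.e i * w i + J.c i * w (J.r i) + J.d i * w (J.l i)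

theorem bound_nonneg : 0 ≤ J.bound := zero_le_one.trans J.one_le_bound

theorem act_add (v w : ι → ℂ) (i : ι) : J.act (v + w) i = J.act v i + J.act w i := by
  simp only [act, Pi.add_apply]; ring

theorem act_sub (v w : ι → ℂ) (i : ι) : J.act (v - w) i = J.act v i - J.act w i := by
  simp only [act, Pi.sub_apply]; ring

theorem act_smul (k : ℂ) (w : ι → ℂ) (i : ι) : J.act (k • w) i = k * J.act w i := by
  simp only [act, Pi.smul_apply, smul_eq_mul]; ring

theorem act_mem_rapid {w : ι → ℂ} (hw : w ∈ rapid J.ht) : J.act w ∈ rapid J.ht := by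
  have h1 := rapid.weighted_comp hw (fun i => i) J.e J.bound 2 0 one_le_two
    (by simpa using J.e_le) (by simp)
  have h2 := rapid.weighted_comp hw J.r J.c J.bound 1 1 le_rfl
    (by simpa using J.norm_c_le) J.ht_r
  have h3 := rapid.weighted_comp hw J.l J.d J.bound 1 1 le_rfl
    (by simpa using J.norm_d_le) J.ht_l
  exact Submodule.add_mem _ (Submodule.add_mem _ h1 h2) h3

/-- The tridiagonal operator on rapidly decaying functions. -/
def op : Module.End ℂ (rapid J.ht) where
  toFun w := ⟨J.act w.1, J.act_mem_rapid w.2⟩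
  map_add' v w := by ext i; exact J.act_add _ _ i
  map_smul' k w := by ext i; exact J.act_smul _ _ i

@[simp] theorem op_apply (w : rapid J.ht) (i : ι) : (J.op w).1 i = J.act w.1 i := rfl

theorem norm_off_le (w : ι → ℂ) (i : ι) (m : ℝ) (hl : ‖w (J.l i)‖ ≤ m) (hr : ‖w (J.r i)‖ ≤ m) :
    ‖J.c i * w (J.r i) + J.d i * w (J.l i)‖ ≤ 2 * J.bound * m := by
  have hb := J.bound_nonneg
  calc _ ≤ ‖J.c i * w (J.r i)‖ + ‖J.d i * w (J.l i)‖ := norm_add_le _ _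
    _ ≤ J.bound * m + J.bound * m := by
        rw [norm_mul, norm_mul]
        gcongr
        exacts [J.norm_c_le i, J.norm_d_le i]
    _ = _ := by ring

/-- Bounded solutions of the resolvent equation with a rapidly decaying right-hand side decay
rapidly. -/
theorem mem_rapid_of_bounded {w : ι → ℂ} (z : ℂ) (hw : ∃ K, ∀ i, ‖w i‖ ≤ K)
    (h : (fun i => J.act w i - z * w i) ∈ rapid J.ht) : w ∈ rapid J.ht := by
  intro M hM
  obtain ⟨H, hH⟩ := h M hM
  obtain ⟨K₀, hK₀⟩ := hw
  have hM1 : (1 : ℝ) ≤ M := by exact_mod_cast hM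
  have hM0 : (0 : ℝ) < M := by linarith
  have hb := J.bound_nonneg
  -- Above height `N` the diagonal dominates so strongly that one use of the equation gains a factor
  -- `M`. Up to height `N` boundedness suffices, at the price of the term `|K₀| * M ^ N` in `K`.
  obtain ⟨N, hN⟩ := exists_nat_ge (2 * J.bound * M + 1 + J.bound + ‖z‖)
  obtain ⟨K, hKdef⟩ : ∃ K, K = |H| + |K₀| * (M : ℝ) ^ N := ⟨_, rfl⟩
  have hK0 : 0 ≤ K := by rw [hKdef]; positivity
  have hHK : H ≤ K := by
    rw [hKdef]; have := le_abs_self H; have : 0 ≤ |K₀| * (M : ℝ) ^ N := by positivity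
    linarith
  -- The induction is over a lower bound for the height: the neighbours of a site of height at least
  -- `k + 1` have height at least `k`.
  have key : ∀ k : ℕ, ∀ i, k ≤ J.ht i → (M : ℝ) ^ k * ‖w i‖ ≤ K := by
    intro k
    induction k with
    | zero =>
      intro i _
      have h1 : (1 : ℝ) ≤ (M : ℝ) ^ N := one_le_pow₀ hM1
      have h2 := (hK₀ i).trans (le_abs_self _)
      have h3 : |K₀| * 1 ≤ |K₀| * (M : ℝ) ^ N := by gcongr
      rw [pow_zero, one_mul, hKdef]
      linarith [abs_nonneg H]
    | succ k ih =>
      intro i hi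
      by_cases hkN : k + 1 ≤ N
      · have h1 : (M : ℝ) ^ (k + 1) ≤ (M : ℝ) ^ N := pow_le_pow_right₀ hM1 hkN
        have h2 := (hK₀ i).trans (le_abs_self _)
        calc (M : ℝ) ^ (k + 1) * ‖w i‖ ≤ (M : ℝ) ^ N * |K₀| := by gcongr
          _ ≤ K := by rw [hKdef]; linarith [abs_nonneg H]
      · have hht : (N : ℝ) ≤ J.ht i := by exact_mod_cast (by omega : N ≤ J.ht i)
        have hl := ih (J.l i) (by have := J.ht_l i; omega)
        have hr := ih (J.r i) (by have := J.ht_r i; omega)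
        have hpk : (0 : ℝ) < (M : ℝ) ^ k := by positivity
        have hl' : ‖w (J.l i)‖ ≤ K / (M : ℝ) ^ k := by rw [le_div_iff₀ hpk]; linarith
        have hr' : ‖w (J.r i)‖ ≤ K / (M : ℝ) ^ k := by rw [le_div_iff₀ hpk]; linarith
        have hoff := J.norm_off_le w i _ hl' hr'
        have hres : (M : ℝ) ^ (k + 1) * ‖J.act w i - z * w i‖ ≤ H := by
          refine le_trans ?_ (hH i)
          gcongr
        have hez : 2 * J.bound * M + 1 ≤ ‖J.e i - z‖ := by
          have h1 := J.le_e i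
          have h2 := norm_sub_norm_le (J.e i) z
          linarith
        have heq : (J.e i - z) * w i = (J.act w i - z * w i) -
            (J.c i * w (J.r i) + J.d i * w (J.l i)) := by simp only [act]; ring
        have h4 : ‖J.e i - z‖ * ‖w i‖ ≤ ‖J.act w i - z * w i‖ + 2 * J.bound * (K / (M : ℝ) ^ k) := by
          rw [← norm_mul, heq]
          exact (norm_sub_le _ _).trans (by gcongr)
        have h5 : (2 * J.bound * M + 1) * ((M : ℝ) ^ (k + 1) * ‖w i‖) ≤
            (2 * J.bound * M + 1) * K := by
          calc (2 * J.bound * M + 1) * ((M : ℝ) ^ (k + 1) * ‖w i‖)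
              = (M : ℝ) ^ (k + 1) * ((2 * J.bound * M + 1) * ‖w i‖) := by ring
            _ ≤ (M : ℝ) ^ (k + 1) * (‖J.e i - z‖ * ‖w i‖) := by gcongr
            _ ≤ (M : ℝ) ^ (k + 1) * (‖J.act w i - z * w i‖ + 2 * J.bound * (K / (M : ℝ) ^ k)) := by
                gcongr
            _ = (M : ℝ) ^ (k + 1) * ‖J.act w i - z * w i‖ + 2 * J.bound * M * K := by
                rw [mul_add, pow_succ]; field_simp
            _ ≤ H + 2 * J.bound * M * K := by gcongr
            _ ≤ _ := by linarith
        exact le_of_mul_le_mul_left h5 (by positivity)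
  exact ⟨K, fun i => key _ i le_rfl⟩

end Chain

/-! ### Root spaces -/

theorem rank_maxGenEigenspace_conj {V W : Type} [AddCommGroup V] [Module ℂ V]
    [AddCommGroup W] [Module ℂ W] (φ : V ≃ₗ[ℂ] W) (f : Module.End ℂ V) (g : Module.End ℂ W)
    (h : ∀ v, φ (f v) = g (φ v)) (z : ℂ) :
    Module.rank ℂ (f.maxGenEigenspace z) = Module.rank ℂ (g.maxGenEigenspace z) := by
  have hk : ∀ (k : ℕ) v, φ (((f - z • 1) ^ k) v) = ((g - z • 1) ^ k) (φ v) := by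
    intro k
    induction k with
    | zero => simp
    | succ k ih =>
      intro v
      rw [pow_succ, pow_succ, Module.End.mul_apply, Module.End.mul_apply, ih]
      simp [h]
  have hmap : (f.maxGenEigenspace z).map (φ : V →ₗ[ℂ] W) = g.maxGenEigenspace z := by
    ext w
    simp only [Submodule.mem_map, Module.End.mem_maxGenEigenspace]
    constructor
    · rintro ⟨v, ⟨k, hv⟩, rfl⟩
      refine ⟨k, ?_⟩
      have := hk k v
      rw [hv, map_zero] at this
      exact this.symm
    · rintro ⟨k, hw⟩
      refine ⟨φ.symm w, ⟨k, φ.injective ?_⟩, by simp⟩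
      rw [hk]; simpa using hw
  rw [← hmap]
  exact (LinearEquiv.rank_eq (φ.submoduleMap _))

theorem rank_maxGenEigenspace_prodMap {V W : Type} [AddCommGroup V] [Module ℂ V]
    [AddCommGroup W] [Module ℂ W] (f : Module.End ℂ V) (g : Module.End ℂ W) (z : ℂ) :
    Module.rank ℂ (Module.End.maxGenEigenspace (f.prodMap g : Module.End ℂ (V × W)) z) =
      Module.rank ℂ (f.maxGenEigenspace z) + Module.rank ℂ (g.maxGenEigenspace z) := by
  have hk : ∀ (k : ℕ) (v : V × W), (((f.prodMap g : Module.End ℂ (V × W)) - z • 1) ^ k) v =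
      (((f - z • 1) ^ k) v.1, ((g - z • 1) ^ k) v.2) := by
    intro k
    induction k with
    | zero => simp
    | succ k ih =>
      intro v
      rw [pow_succ, pow_succ, pow_succ, Module.End.mul_apply, Module.End.mul_apply,
        Module.End.mul_apply, ih]
      simp
  have hprod : Module.End.maxGenEigenspace (f.prodMap g : Module.End ℂ (V × W)) z =
      (f.maxGenEigenspace z).prod (g.maxGenEigenspace z) := by
    ext v
    simp only [Submodule.mem_prod, Module.End.mem_maxGenEigenspace, hk, Prod.mk_eq_zero]
    constructor
    · rintro ⟨k, h1, h2⟩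
      exact ⟨⟨k, h1⟩, ⟨k, h2⟩⟩
    · rintro ⟨⟨k, h1⟩, ⟨l, h2⟩⟩
      refine ⟨k + l, ?_, ?_⟩
      · rw [add_comm, pow_add, Module.End.mul_apply, h1, map_zero]
      · rw [pow_add, Module.End.mul_apply, h2, map_zero]
  rw [hprod, ← rank_prod']
  exact LinearEquiv.rank_eq
    { toFun := fun v => (⟨v.1.1, v.2.1⟩, ⟨v.1.2, v.2.2⟩)
      invFun := fun v => ⟨(v.1.1, v.2.1), v.1.2, v.2.2⟩
      map_add' := fun _ _ => rfl
      map_smul' := fun _ _ => rfl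
      left_inv := fun _ => rfl
      right_inv := fun _ => rfl }

theorem maxGenEigenspace_eq_bot {V : Type} [AddCommGroup V] [Module ℂ V] (f : Module.End ℂ V)
    (z : ℂ) (h : ∀ v, f v = z • v → v = 0) : f.maxGenEigenspace z = ⊥ := by
  rw [eq_bot_iff]
  intro v hv
  obtain ⟨k, hk⟩ := (Module.End.mem_maxGenEigenspace _ _ _).1 hv
  induction k with
  | zero => simpa using hk
  | succ k ih =>
    rw [pow_succ', Module.End.mul_apply] at hk
    exact ih (h _ (by simpa [sub_eq_zero] using hk))

/-- If the eigenspace is a line and there are no generalized eigenvectors of order two, then the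
root space is a line. -/
theorem rank_maxGenEigenspace_eq_one {V : Type} [AddCommGroup V] [Module ℂ V]
    (f : Module.End ℂ V) (z : ℂ) (u : V) (hu : u ≠ 0) (hfu : f u = z • u)
    (h1 : ∀ v, f v = z • v → ∃ k : ℂ, v = k • u) (h2 : ∀ v, f v - z • v ≠ u) :
    Module.rank ℂ (f.maxGenEigenspace z) = 1 := by
  have hspan : f.maxGenEigenspace z = Submodule.span ℂ {u} := by
    apply le_antisymm
    · intro v hv
      obtain ⟨k, hk⟩ := (Module.End.mem_maxGenEigenspace _ _ _).1 hv
      clear hv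
      induction k generalizing v with
      | zero =>
        have : v = 0 := by simpa using hk
        rw [this]; exact Submodule.zero_mem _
      | succ k ih =>
        rw [pow_succ, Module.End.mul_apply] at hk
        obtain ⟨a, ha⟩ := Submodule.mem_span_singleton.1 (ih hk)
        have ha' : f v - z • v = a • u := by rw [ha]; simp
        by_cases ha0 : a = 0
        · rw [ha0, zero_smul, sub_eq_zero] at ha'
          obtain ⟨k, rfl⟩ := h1 v ha'
          exact Submodule.smul_mem _ _ (Submodule.mem_span_singleton_self u)
        -- Rescaling `v` by `a⁻¹` would produce a generalized eigenvector of order two above `u`.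
        · exfalso
          apply h2 (a⁻¹ • v)
          rw [map_smul, smul_comm, ← smul_sub, ha', smul_smul, inv_mul_cancel₀ ha0, one_smul]
    · rw [Submodule.span_singleton_le_iff_mem, Module.End.mem_maxGenEigenspace]
      exact ⟨1, by simp [hfu]⟩
  rw [hspan, ← (LinearEquiv.toSpanNonzeroSingleton ℂ V u hu).rank_eq, Module.rank_self]

/-! ### Fourier analysis on `[0, π]` -/

/-- The exponential `x ↦ e^{ijx}`. -/
noncomputable def mode (j : ℤ) (x : ℝ) : ℂ := Complex.exp (Complex.I * j * x)

theorem norm_mode (j : ℤ) (x : ℝ) : ‖mode j x‖ = 1 := by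
  have : Complex.I * j * x = ((j * x : ℝ) : ℂ) * Complex.I := by push_cast; ring
  rw [mode, this, Complex.norm_exp_ofReal_mul_I]

theorem mode_add (j k : ℤ) (x : ℝ) : mode (j + k) x = mode j x * mode k x := by
  simp only [mode, ← Complex.exp_add]; congr 1; push_cast; ring

theorem mode_zero (x : ℝ) : mode 0 x = 1 := by simp [mode]

theorem mode_neg_mul (j : ℤ) (x : ℝ) : mode (-j) x * mode j x = 1 := by
  rw [← mode_add, neg_add_cancel, mode_zero]

theorem mode_at_zero (j : ℤ) : mode j 0 = 1 := by simp [mode]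

theorem mode_two_mul_pi (k : ℤ) : mode (2 * k) Real.pi = 1 := by
  rw [mode, Complex.exp_eq_one_iff]; exact ⟨k, by push_cast; ring⟩

theorem mode_shift_pi (k p : ℤ) : mode (2 * k + p) Real.pi = mode p Real.pi := by
  rw [mode_add, mode_two_mul_pi, one_mul]

theorem hasDerivAt_mode (j : ℤ) (x : ℝ) :
    HasDerivAt (mode j) (Complex.I * j * mode j x) x := by
  have h : HasDerivAt (fun x : ℝ => Complex.I * j * (x : ℂ)) (Complex.I * j) x := by
    simpa using (Complex.ofRealCLM.hasDerivAt (x := x)).const_mul (Complex.I * j)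
  have := h.cexp
  rw [mul_comm (Complex.I * (j : ℂ))]
  exact this

theorem continuous_mode (j : ℤ) : Continuous (mode j) :=
  continuous_iff_continuousAt.2 fun x => (hasDerivAt_mode j x).continuousAt

theorem integral_mode_two_mul {k : ℤ} (hk : k ≠ 0) :
    ∫ x in (0 : ℝ)..Real.pi, mode (2 * k) x = 0 := by
  have hc : Complex.I * ((2 * k : ℤ) : ℂ) ≠ 0 := by
    simp [hk]
  have h : ∀ x ∈ Set.uIcc 0 Real.pi, HasDerivAt
      (fun x => (Complex.I * ((2 * k : ℤ) : ℂ))⁻¹ * mode (2 * k) x) (mode (2 * k) x) x := by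
    intro x _
    have := (hasDerivAt_mode (2 * k) x).const_mul (Complex.I * ((2 * k : ℤ) : ℂ))⁻¹
    rwa [inv_mul_cancel_left₀ hc] at this
  rw [intervalIntegral.integral_eq_sub_of_hasDerivAt h
    ((continuous_mode _).intervalIntegrable _ _), mode_two_mul_pi, mode_at_zero, sub_self]

instance : IsFiniteMeasure intervalMeasure := by unfold intervalMeasure; infer_instance

theorem intervalIntegral_eq_integral_intervalMeasure (f : ℝ → ℂ) :
    ∫ x in (0 : ℝ)..Real.pi, f x = ∫ x, f x ∂intervalMeasure := by
  rw [intervalIntegral.integral_of_le Real.pi_pos.le, intervalMeasure, integral_Icc_eq_integral_Ioc]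

/-- The integral of `f` against `e^{ijx}` over `[0, π]`, normalized. -/
noncomputable def coef (f : ℝ → ℂ) (j : ℤ) : ℂ :=
  (Real.pi : ℂ)⁻¹ * ∫ x, f x * mode j x ∂intervalMeasure

theorem coef_congr {f g : ℝ → ℂ} (h : f =ᵐ[intervalMeasure] g) (j : ℤ) : coef f j = coef g j := by
  unfold coef
  congr 1
  exact integral_congr_ae (by filter_upwards [h] with x hx; rw [hx])

theorem integrable_mul_mode {f : ℝ → ℂ} (hf : Integrable f intervalMeasure) (j : ℤ) :
    Integrable (fun x => f x * mode j x) intervalMeasure :=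
  hf.mul_bdd (c := 1) (continuous_mode j).aestronglyMeasurable
    (Filter.Eventually.of_forall fun x => (norm_mode j x).le)

theorem coef_add {f g : ℝ → ℂ} (hf : Integrable f intervalMeasure)
    (hg : Integrable g intervalMeasure) (j : ℤ) :
    coef (fun x => f x + g x) j = coef f j + coef g j := by
  unfold coef
  simp only [add_mul]
  rw [integral_add (integrable_mul_mode hf j) (integrable_mul_mode hg j), mul_add]

theorem coef_const_mul (c : ℂ) (f : ℝ → ℂ) (j : ℤ) :
    coef (fun x => c * f x) j = c * coef f j := by
  unfold coef
  simp only [mul_assoc]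
  rw [integral_const_mul]; ring

theorem coef_mode_mul (i : ℤ) (f : ℝ → ℂ) (j : ℤ) :
    coef (fun x => mode i x * f x) j = coef f (i + j) := by
  unfold coef
  congr 2; ext x; rw [mode_add]; ring

theorem norm_coef_le (f : ℝ → ℂ) (j : ℤ) :
    ‖coef f j‖ ≤ Real.pi⁻¹ * ∫ x, ‖f x‖ ∂intervalMeasure := by
  unfold coef
  rw [norm_mul, norm_inv, Complex.norm_real, Real.norm_of_nonneg Real.pi_pos.le]
  refine mul_le_mul_of_nonneg_left ((norm_integral_le_integral_norm _).trans ?_)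
    (inv_nonneg.2 Real.pi_pos.le)
  simp [norm_mode]

/-- A square-integrable function is determined by its Fourier coefficients. -/
theorem ae_eq_zero_of_coef_eq_zero {f : ℝ → ℂ} (hf : MemLp f 2 intervalMeasure) (p : ℤ)
    (h : ∀ k : ℤ, coef f (2 * k + p) = 0) : f =ᵐ[intervalMeasure] 0 := by
  -- Multiplication by `e^{ipx}` moves the frequencies `2k + p` to `2k`, the full Fourier system on
  -- an interval of length `π`; Parseval then applies.
  have hg : MemLp (fun x => f x * mode p x) 2 intervalMeasure := by
    refine hf.of_le (hf.1.mul (continuous_mode p).aestronglyMeasurable) ?_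
    exact Filter.Eventually.of_forall fun x => by rw [norm_mul, norm_mode, mul_one]
  have hμ : intervalMeasure = volume.restrict (Set.Ioc 0 Real.pi) := by
    exact Measure.restrict_congr_set Ioc_ae_eq_Icc.symm
  have hg' := hg
  rw [hμ] at hg'
  have hsum := tsum_sq_fourierCoeffOn Real.pi_pos hg'
  have hz : ∀ k : ℤ, fourierCoeffOn Real.pi_pos (fun x => f x * mode p x) k = 0 := by
    intro k
    rw [fourierCoeffOn_eq_integral, intervalIntegral_eq_integral_intervalMeasure]
    have hk := h (-k)
    unfold coef at hk
    have hk' := (mul_eq_zero.1 hk).resolve_left (by simp [Real.pi_ne_zero])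
    convert smul_zero _
    rw [← hk']
    congr 1; ext x
    rw [fourier_coe_apply, mode_add, smul_eq_mul]
    have : Complex.exp (2 * Real.pi * Complex.I * ((-k : ℤ) : ℂ) * (x : ℂ) /
        ((Real.pi - 0 : ℝ) : ℂ)) = mode (2 * -k) x := by
      rw [mode]; congr 1
      have : (Real.pi : ℂ) ≠ 0 := by exact_mod_cast Real.pi_ne_zero
      push_cast; field_simp; ring
    rw [this]; ring
  simp only [hz, norm_zero, ne_eq, OfNat.ofNat_ne_zero, not_false_eq_true, zero_pow, tsum_zero,
    sub_zero, smul_eq_mul] at hsum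
  have h0 : ∫ x in (0 : ℝ)..Real.pi, ‖f x * mode p x‖ ^ 2 = 0 :=
    (mul_eq_zero.1 hsum.symm).resolve_left (inv_ne_zero Real.pi_ne_zero)
  rw [intervalIntegral.integral_of_le Real.pi_pos.le, ← hμ,
    integral_eq_zero_iff_of_nonneg (fun x => by positivity) hg.integrable_norm_pow'] at h0
  filter_upwards [h0] with x hx
  simpa [norm_mode] using hx

theorem HasL2Deriv.integrable {y d : ℝ → ℂ} (h : HasL2Deriv y d) :
    Integrable d intervalMeasure := h.1.integrable (by norm_num)

theorem HasL2Deriv.continuousOn {y d : ℝ → ℂ} (h : HasL2Deriv y d) :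
    ContinuousOn y (Set.Icc 0 Real.pi) := by
  have h1 := intervalIntegral.continuousOn_primitive_interval' h.intervalIntegrable
    Set.left_mem_uIcc
  rw [Set.uIcc_of_le Real.pi_pos.le] at h1
  exact (continuousOn_const.add h1).congr h.2

theorem HasL2Deriv.integrable_self {y d : ℝ → ℂ} (h : HasL2Deriv y d) :
    Integrable y intervalMeasure := h.continuousOn.integrableOn_Icc

/-- Integration by parts of an absolutely continuous function against an exponential. -/
theorem HasL2Deriv.integral_mul_mode {y d : ℝ → ℂ} (h : HasL2Deriv y d) (j : ℤ) :
    ∫ x, d x * mode j x ∂intervalMeasure = y Real.pi * mode j Real.pi - y 0 -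
      Complex.I * j * ∫ x, y x * mode j x ∂intervalMeasure := by
  have hd := h.integrable
  have hmode : Integrable (mode j) intervalMeasure := by
    have := integrable_mul_mode (integrable_const (1 : ℂ)) j
    simpa using this
  have hDint : ∀ x ∈ Set.Icc 0 Real.pi,
      ∫ t in (0 : ℝ)..x, d t = ∫ t, (Set.Iic x).indicator d t ∂intervalMeasure := by
    intro x hx
    rw [integral_indicator measurableSet_Iic, intervalMeasure,
      Measure.restrict_restrict measurableSet_Iic, intervalIntegral.integral_of_le hx.1,
      ← integral_Icc_eq_integral_Ioc]
    congr 2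
    ext t
    simp only [Set.mem_Icc, Set.mem_inter_iff, Set.mem_Iic]
    exact ⟨fun ht => ⟨ht.2, ht.1, ht.2.trans hx.2⟩, fun ht => ⟨ht.2.1, ht.1⟩⟩
  -- Integration by parts is Fubini on the triangle `t ≤ x`: `y x - y 0` is the integral of `d t`
  -- over `t ≤ x`, and the inner integral of the exponential over `x ≥ t` is explicit.
  have hswapint : Integrable (Function.uncurry fun x t : ℝ =>
      (Set.Iic x).indicator d t * mode j x) (intervalMeasure.prod intervalMeasure) := by
    have h1 : Integrable (fun q : ℝ × ℝ => mode j q.1 * d q.2)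
        (intervalMeasure.prod intervalMeasure) := hmode.mul_prod hd
    have h2 : MeasurableSet {q : ℝ × ℝ | q.2 ≤ q.1} := measurableSet_le measurable_snd measurable_fst
    refine (h1.indicator h2).congr (Filter.Eventually.of_forall fun q => ?_)
    by_cases hq : q.2 ≤ q.1
    · simp [Function.uncurry, Set.indicator, hq, mul_comm]
    · simp [Function.uncurry, Set.indicator, hq]
  have hswap := integral_integral_swap hswapint
  have hinner : ∀ t ∈ Set.Icc 0 Real.pi, Complex.I * j *
      ∫ x, (Set.Iic x).indicator d t * mode j x ∂intervalMeasure =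
      d t * mode j Real.pi - d t * mode j t := by
    intro t ht
    have h1 : ∀ x, (Set.Iic x).indicator d t * mode j x =
        (Set.Ici t).indicator (fun x => d t * mode j x) x := by
      intro x
      by_cases hx : t ≤ x <;> simp [Set.indicator, hx]
    simp only [h1]
    rw [integral_indicator measurableSet_Ici, intervalMeasure,
      Measure.restrict_restrict measurableSet_Ici]
    have h2 : Set.Ici t ∩ Set.Icc 0 Real.pi = Set.Icc t Real.pi := by
      ext x; simp only [Set.mem_Icc, Set.mem_inter_iff, Set.mem_Ici]
      exact ⟨fun hx => ⟨hx.1, hx.2.2⟩, fun hx => ⟨hx.1, ht.1.trans hx.1, hx.2⟩⟩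
    rw [h2, integral_Icc_eq_integral_Ioc, ← intervalIntegral.integral_of_le ht.2,
      intervalIntegral.integral_const_mul]
    have h3 : ∫ x in t..Real.pi, Complex.I * j * mode j x = mode j Real.pi - mode j t :=
      intervalIntegral.integral_eq_sub_of_hasDerivAt (fun x _ => hasDerivAt_mode j x)
        ((continuous_const.mul (continuous_mode j)).intervalIntegrable _ _)
    rw [intervalIntegral.integral_const_mul] at h3
    linear_combination d t * h3
  have hm : ∀ᵐ x : ℝ ∂intervalMeasure, x ∈ Set.Icc (0 : ℝ) Real.pi :=
    ae_restrict_mem measurableSet_Icc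
  have hy : ∫ x, y x * mode j x ∂intervalMeasure = y 0 * ∫ x, mode j x ∂intervalMeasure +
      ∫ x, ∫ t, (Set.Iic x).indicator d t * mode j x ∂intervalMeasure ∂intervalMeasure := by
    have hsi : Integrable (fun x => ∫ t, (Set.Iic x).indicator d t * mode j x ∂intervalMeasure)
        intervalMeasure := hswapint.integral_prod_left
    rw [← integral_const_mul, ← integral_add (hmode.const_mul _) hsi]
    refine integral_congr_ae ?_
    filter_upwards [hm] with x hx
    rw [integral_mul_const, ← hDint x hx, h.2 x hx]; ring
  have hmodeint : Complex.I * j * ∫ x, mode j x ∂intervalMeasure = mode j Real.pi - 1 := by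
    rw [← intervalIntegral_eq_integral_intervalMeasure, ← intervalIntegral.integral_const_mul,
      intervalIntegral.integral_eq_sub_of_hasDerivAt (fun x _ => hasDerivAt_mode j x)
        ((continuous_const.mul (continuous_mode j)).intervalIntegrable _ _), mode_at_zero]
  have hout : Complex.I * j * ∫ x, ∫ t, (Set.Iic x).indicator d t * mode j x ∂intervalMeasure
      ∂intervalMeasure = (∫ t, d t ∂intervalMeasure) * mode j Real.pi -
        ∫ t, d t * mode j t ∂intervalMeasure := by
    rw [hswap, ← integral_const_mul, ← integral_mul_const,
      ← integral_sub (hd.mul_const _) (integrable_mul_mode hd j)]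
    refine integral_congr_ae ?_
    filter_upwards [hm] with t ht
    exact hinner t ht
  have hπ := h.2 Real.pi ⟨Real.pi_pos.le, le_rfl⟩
  rw [intervalIntegral_eq_integral_intervalMeasure] at hπ
  rw [hy, mul_add, hout, hπ]
  linear_combination (y 0) * hmodeint

/-- The Fourier coefficients of the derivative under a quasi-periodic boundary condition. -/
theorem HasL2Deriv.coef_deriv {y d : ℝ → ℂ} (h : HasL2Deriv y d) {t : ℂ} {p : ℤ}
    (ht : t * mode p Real.pi = 1) (hy : y Real.pi = t * y 0) (k : ℤ) :
    coef d (2 * k + p) = -(Complex.I * ((2 * k + p : ℤ) : ℂ) * coef y (2 * k + p)) := by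
  unfold coef
  rw [h.integral_mul_mode, mode_shift_pi, hy]
  linear_combination (Real.pi : ℂ)⁻¹ * y 0 * ht

/-! ### Synthesis of functions from rapidly decaying coefficients -/

theorem rapid.summable_norm {w : ℤ → ℂ} (hw : w ∈ rapid Int.natAbs) :
    Summable fun k => ‖w k‖ := by
  obtain ⟨K, hK⟩ := hw 2 one_le_two
  have hs : Summable fun k : ℤ => ((2 : ℝ)⁻¹) ^ k.natAbs := by
    have hg : Summable fun k : ℕ => ((2 : ℝ)⁻¹) ^ k :=
      summable_geometric_of_lt_one (by norm_num) (by norm_num)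
    exact Summable.of_nat_of_neg (by simpa using hg) (by simpa using hg)
  refine Summable.of_nonneg_of_le (fun _ => norm_nonneg _) (fun k => ?_) (hs.mul_left K)
  rw [inv_pow, ← div_eq_mul_inv, le_div_iff₀ (by positivity), mul_comm]
  exact_mod_cast hK k

theorem rapid.summable_mul_mode {w : ℤ → ℂ} (hw : w ∈ rapid Int.natAbs) (p : ℤ) (x : ℝ) :
    Summable fun k : ℤ => w k * mode (-(2 * k + p)) x :=
  Summable.of_norm (by simpa [norm_mode] using rapid.summable_norm hw)

/-- The trigonometric series with coefficients `w`. -/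
noncomputable def synth (p : ℤ) (w : ℤ → ℂ) (x : ℝ) : ℂ := ∑' k : ℤ, w k * mode (-(2 * k + p)) x

theorem freq_norm_le (p k : ℤ) : ‖(2 * k + p : ℂ)‖ ≤ (2 + |(p : ℝ)|) * 2 ^ k.natAbs := by
  have h1 : ‖(2 * k + p : ℂ)‖ ≤ 2 * |(k : ℝ)| + |(p : ℝ)| := by
    refine (norm_add_le _ _).trans ?_
    simp
  have h2 : |(k : ℝ)| = (k.natAbs : ℝ) := by rw [Nat.cast_natAbs, Int.cast_abs]
  have h3 : (k.natAbs : ℝ) ≤ 2 ^ k.natAbs := by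
    exact_mod_cast Nat.lt_two_pow_self.le
  have h4 : (1 : ℝ) ≤ 2 ^ k.natAbs := one_le_pow₀ (by norm_num)
  nlinarith [abs_nonneg (p : ℝ)]

theorem rapid.freq_mul {w : ℤ → ℂ} (hw : w ∈ rapid Int.natAbs) (p : ℤ) :
    (fun k : ℤ => (2 * k + p : ℂ) * w k) ∈ rapid Int.natAbs :=
  rapid.weighted_comp hw (fun k => k) _ (2 + |(p : ℝ)|) 2 0 one_le_two
    (by simpa using freq_norm_le p) (by simp)

theorem synth_add {v w : ℤ → ℂ} (hv : v ∈ rapid Int.natAbs) (hw : w ∈ rapid Int.natAbs) (p : ℤ)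
    (x : ℝ) : synth p (fun k => v k + w k) x = synth p v x + synth p w x := by
  unfold synth
  rw [← (rapid.summable_mul_mode hv p x).tsum_add (rapid.summable_mul_mode hw p x)]
  simp only [add_mul]

theorem synth_const_mul (c : ℂ) (w : ℤ → ℂ) (p : ℤ) (x : ℝ) :
    synth p (fun k => c * w k) x = c * synth p w x := by
  unfold synth
  rw [← tsum_mul_left]
  simp only [mul_assoc]

/-- The index `k` stands for the frequency `-(2k+p)`, so multiplication by `e^{2ijx}` lowers the
index by `j`. -/
theorem synth_shift (j : ℤ) (w : ℤ → ℂ) (p : ℤ) (x : ℝ) :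
    synth p (fun k => w (k + j)) x = mode (2 * j) x * synth p w x := by
  unfold synth
  rw [← tsum_mul_left, ← (Equiv.addRight j).tsum_eq (fun k => mode (2 * j) x *
    (w k * mode (-(2 * k + p)) x))]
  refine tsum_congr fun k => ?_
  simp only [Equiv.coe_addRight]
  rw [show -(2 * k + p) = 2 * j + -(2 * (k + j) + p) by ring, mode_add]
  ring

theorem hasDerivAt_synth {w : ℤ → ℂ} (hw : w ∈ rapid Int.natAbs) (p : ℤ) (x : ℝ) :
    HasDerivAt (synth p w) (synth p (fun k => -Complex.I * ((2 * k + p : ℂ) * w k)) x) x := by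
  have h := hasDerivAt_tsum (u := fun k : ℤ => ‖(2 * k + p : ℂ) * w k‖)
    (g := fun (k : ℤ) x => w k * mode (-(2 * k + p)) x)
    (g' := fun (k : ℤ) x => (-Complex.I * ((2 * k + p : ℂ) * w k)) * mode (-(2 * k + p)) x)
    (rapid.summable_norm (rapid.freq_mul hw p)) (fun k y => ?_) (fun k y => ?_)
    (rapid.summable_mul_mode hw p 0) x
  · exact h
  · refine ((hasDerivAt_mode (-(2 * k + p)) y).const_mul (w k)).congr_deriv ?_
    push_cast; ring
  · simp [norm_mode]

theorem norm_synth_le {w : ℤ → ℂ} (hw : w ∈ rapid Int.natAbs) (p : ℤ) (x : ℝ) :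
    ‖synth p w x‖ ≤ ∑' k, ‖w k‖ := by
  refine (norm_tsum_le_tsum_norm ?_).trans ?_
  · simpa [norm_mode] using rapid.summable_norm hw
  · simp [norm_mode]

theorem continuous_synth {w : ℤ → ℂ} (hw : w ∈ rapid Int.natAbs) (p : ℤ) :
    Continuous (synth p w) :=
  continuous_iff_continuousAt.2 fun x => (hasDerivAt_synth hw p x).continuousAt

theorem memLp_synth {w : ℤ → ℂ} (hw : w ∈ rapid Int.natAbs) (p : ℤ) :
    MemLp (synth p w) 2 intervalMeasure :=
  MemLp.of_bound (continuous_synth hw p).aestronglyMeasurable _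
    (Filter.Eventually.of_forall fun x => norm_synth_le hw p x)

theorem rapid.const_mul {ι : Type*} {ht : ι → ℕ} {w : ι → ℂ} (hw : w ∈ rapid ht) (c : ℂ) :
    (fun k => c * w k) ∈ rapid ht := Submodule.smul_mem _ c hw

theorem hasL2Deriv_synth {w : ℤ → ℂ} (hw : w ∈ rapid Int.natAbs) (p : ℤ) :
    HasL2Deriv (synth p w) (synth p (fun k => -Complex.I * ((2 * k + p : ℂ) * w k))) := by
  have hw' := rapid.const_mul (rapid.freq_mul hw p) (-Complex.I)
  refine ⟨memLp_synth hw' p, fun x _ => ?_⟩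
  rw [intervalIntegral.integral_eq_sub_of_hasDerivAt (fun y _ => hasDerivAt_synth hw p y)
    ((continuous_synth hw' p).intervalIntegrable _ _)]
  ring

/-- All exponentials `e^{-i(2k+p)x}` take the same value at `π`, and the hypothesis says that this
value is `t`. -/
theorem synth_pi {t : ℂ} {p : ℤ} (ht : t * mode p Real.pi = 1) (w : ℤ → ℂ) :
    synth p w Real.pi = t * synth p w 0 := by
  unfold synth
  rw [← tsum_mul_left]
  refine tsum_congr fun k => ?_
  have h1 := mode_neg_mul (2 * k + p) Real.pi
  rw [mode_shift_pi] at h1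
  have h2 : mode (-(2 * k + p)) Real.pi = t := by
    linear_combination t * h1 - mode (-(2 * k + p)) Real.pi * ht
  rw [h2, mode_at_zero]; ring

theorem coef_synth {w : ℤ → ℂ} (hw : w ∈ rapid Int.natAbs) (p k : ℤ) :
    coef (synth p w) (2 * k + p) = w k := by
  unfold coef synth
  have h1 : ∀ x, (∑' i : ℤ, w i * mode (-(2 * i + p)) x) * mode (2 * k + p) x =
      ∑' i : ℤ, w i * mode (2 * (k - i)) x := by
    intro x
    rw [← tsum_mul_right]
    refine tsum_congr fun i => ?_
    rw [mul_assoc, ← mode_add]; congr 2; ring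
  simp only [h1]
  rw [← integral_tsum_of_summable_integral_norm]
  · have h2 : ∀ i : ℤ, ∫ x, w i * mode (2 * (k - i)) x ∂intervalMeasure =
        if i = k then w k * Real.pi else 0 := by
      intro i
      rw [integral_const_mul, ← intervalIntegral_eq_integral_intervalMeasure]
      split_ifs with hi
      · subst hi; simp [mode_zero]
      · rw [integral_mode_two_mul (sub_ne_zero.2 (Ne.symm hi)), mul_zero]
    simp only [h2]
    rw [tsum_ite_eq]
    have : (Real.pi : ℂ) ≠ 0 := by exact_mod_cast Real.pi_ne_zero
    field_simp
  · intro i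
    have := (integrable_mul_mode (integrable_const (w i)) (2 * (k - i)))
    exact this
  · simp only [norm_mul, norm_mode, mul_one, integral_const, smul_eq_mul]
    exact (rapid.summable_norm hw).mul_left _

/-! ### The Dirac operator as a tridiagonal operator -/

/-- The matrix of the Dirac operator in the basis `e^{-i(2k+p)x}` of either component; the
component is encoded by a Boolean. -/
noncomputable def diracChain (a A b B : ℂ) (p : ℤ) : Chain (Bool × ℤ) where
  e s := (if s.1 then 1 else -1) * (2 * s.2 + p)
  c s := if s.1 then A else B
  d s := if s.1 then a else b
  -- Both the component and the parity of the index change along a link, so their relation is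
  -- preserved. This is the source of the splitting into two chains.
  l s := (!s.1, s.2 - 1)
  r s := (!s.1, s.2 + 1)
  ht s := s.2.natAbs
  bound := ‖a‖ + ‖A‖ + ‖b‖ + ‖B‖ + |(p : ℝ)| + 2
  one_le_bound := by
    have : 0 ≤ ‖a‖ + ‖A‖ + ‖b‖ + ‖B‖ + |(p : ℝ)| := by positivity
    linarith
  norm_c_le := by
    rintro ⟨s, k⟩
    cases s <;> simp <;>
    nlinarith [norm_nonneg a, norm_nonneg A, norm_nonneg b, norm_nonneg B, abs_nonneg (p : ℝ)]
  norm_d_le := by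
    rintro ⟨s, k⟩
    cases s <;> simp <;>
    nlinarith [norm_nonneg a, norm_nonneg A, norm_nonneg b, norm_nonneg B, abs_nonneg (p : ℝ)]
  ht_l := fun s => by dsimp only; omega
  ht_r := fun s => by dsimp only; omega
  e_le := by
    rintro ⟨s, k⟩
    have h1 := freq_norm_le p k
    have h2 : ‖(if s then (1 : ℂ) else -1) * (2 * k + p)‖ = ‖(2 * k + p : ℂ)‖ := by
      cases s <;> simp [-neg_add_rev]
    refine (h2.le.trans h1).trans ?_
    refine mul_le_mul_of_nonneg_right ?_ (by positivity)
    linarith [norm_nonneg a, norm_nonneg A, norm_nonneg b, norm_nonneg B]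
  le_e := by
    rintro ⟨s, k⟩
    have h2 : ‖(if s then (1 : ℂ) else -1) * (2 * k + p)‖ = ‖(2 * k + p : ℂ)‖ := by
      cases s <;> simp [-neg_add_rev]
    have h3 : ‖(2 * k + p : ℂ)‖ = |2 * (k : ℝ) + p| := by
      rw [← Real.norm_eq_abs, ← Complex.norm_real]; push_cast; rfl
    have h4 : (k.natAbs : ℝ) = |(k : ℝ)| := by rw [Nat.cast_natAbs, Int.cast_abs]
    rw [h2, h3, h4]
    have h5 : |2 * (k : ℝ)| ≤ |2 * (k : ℝ) + p| + |(p : ℝ)| := by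
      have := abs_sub (2 * (k : ℝ) + p) p
      simpa using this
    rw [abs_mul, abs_two] at h5
    nlinarith [norm_nonneg a, norm_nonneg A, norm_nonneg b, norm_nonneg B, abs_nonneg (k : ℝ)]

section Synthesis

variable (a A b B : ℂ) (p : ℤ)

theorem rapid_component {w : Bool × ℤ → ℂ} (hw : w ∈ rapid (diracChain a A b B p).ht) (s : Bool) :
    (fun k : ℤ => w (s, k)) ∈ rapid Int.natAbs := by
  have := rapid.weighted_comp (ht' := Int.natAbs) hw (fun k : ℤ => (s, k)) (fun _ => 1) 1 1 0 le_rfl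
    (by simp) (fun k => le_rfl)
  simpa using this

/-- The function with the given Fourier coefficients, as an element of `L²`. -/
noncomputable def diracSynth : rapid (diracChain a A b B p).ht →ₗ[ℂ] DiracSpace where
  toFun w := WithLp.toLp 2 ((memLp_synth (rapid_component a A b B p w.2 true) p).toLp,
    (memLp_synth (rapid_component a A b B p w.2 false) p).toLp)
  map_add' v w := by
    rw [← WithLp.toLp_add, Prod.mk_add_mk, ← MemLp.toLp_add, ← MemLp.toLp_add]
    congr 2 <;>
    · apply MemLp.toLp_congr
      refine Filter.Eventually.of_forall fun x => ?_
      exact synth_add (rapid_component a A b B p v.2 _) (rapid_component a A b B p w.2 _) p x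
  map_smul' c w := by
    rw [RingHom.id_apply, ← WithLp.toLp_smul, Prod.smul_mk, ← MemLp.toLp_const_smul,
      ← MemLp.toLp_const_smul]
    congr 2 <;>
    · apply MemLp.toLp_congr
      refine Filter.Eventually.of_forall fun x => ?_
      exact synth_const_mul c _ p x

variable {a A b B p}

theorem diracSynth_fst (w : rapid (diracChain a A b B p).ht) :
    (diracSynth a A b B p w).fst =ᵐ[intervalMeasure] synth p (fun k => w.1 (true, k)) :=
  MemLp.coeFn_toLp (memLp_synth (rapid_component a A b B p w.2 true) p)

theorem diracSynth_snd (w : rapid (diracChain a A b B p).ht) :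
    (diracSynth a A b B p w).snd =ᵐ[intervalMeasure] synth p (fun k => w.1 (false, k)) :=
  MemLp.coeFn_toLp (memLp_synth (rapid_component a A b B p w.2 false) p)

/-- The Fourier coefficients of an element of `L²([0, π], ℂ²)`. -/
noncomputable def diracCoef (p : ℤ) (f : DiracSpace) (s : Bool × ℤ) : ℂ :=
  if s.1 then coef f.fst (2 * s.2 + p) else coef f.snd (2 * s.2 + p)

theorem diracCoef_synth (w : rapid (diracChain a A b B p).ht) :
    diracCoef p (diracSynth a A b B p w) = w.1 := by
  ext ⟨s, k⟩
  cases s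
  · simp only [diracCoef, Bool.false_eq_true, if_false]
    rw [coef_congr (diracSynth_snd w), coef_synth (rapid_component a A b B p w.2 false)]
  · simp only [diracCoef, if_true]
    rw [coef_congr (diracSynth_fst w), coef_synth (rapid_component a A b B p w.2 true)]

theorem integrable_coe_Lp (f : Lp ℂ 2 intervalMeasure) : Integrable f intervalMeasure :=
  (Lp.memLp f).integrable (by norm_num)

theorem coef_Lp_sub (f g : Lp ℂ 2 intervalMeasure) (j : ℤ) :
    coef (f - g : Lp ℂ 2 intervalMeasure) j = coef f j - coef g j := by
  rw [coef_congr (Lp.coeFn_sub f g)]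
  have := coef_add (integrable_coe_Lp f) ((integrable_coe_Lp g).const_mul (-1)) j
  rw [coef_const_mul] at this
  rw [sub_eq_add_neg (coef f j), ← neg_one_mul (coef g j), ← this]
  congr 1; ext x; simp [sub_eq_add_neg]

theorem diracCoef_sub (f g : DiracSpace) (s : Bool × ℤ) :
    diracCoef p (f - g) s = diracCoef p f s - diracCoef p g s := by
  unfold diracCoef
  split_ifs
  · exact coef_Lp_sub f.fst g.fst _
  · exact coef_Lp_sub f.snd g.snd _

theorem coef_Lp_smul (c : ℂ) (f : Lp ℂ 2 intervalMeasure) (j : ℤ) :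
    coef (c • f : Lp ℂ 2 intervalMeasure) j = c * coef f j := by
  rw [coef_congr (Lp.coeFn_smul c f)]
  exact coef_const_mul c f j

theorem diracCoef_smul (c : ℂ) (f : DiracSpace) (s : Bool × ℤ) :
    diracCoef p (c • f) s = c * diracCoef p f s := by
  unfold diracCoef
  split_ifs
  · exact coef_Lp_smul c f.fst _
  · exact coef_Lp_smul c f.snd _

theorem diracCoef_injective {f g : DiracSpace} (h : diracCoef p f = diracCoef p g) : f = g := by
  have hz : ∀ s, diracCoef p (f - g) s = 0 := fun s => by rw [diracCoef_sub, h, sub_self]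
  rw [← sub_eq_zero]
  have h1 : (f - g).fst = 0 := by
    rw [Lp.eq_zero_iff_ae_eq_zero]
    refine ae_eq_zero_of_coef_eq_zero (Lp.memLp _) p fun k => ?_
    simpa [diracCoef] using hz (true, k)
  have h2 : (f - g).snd = 0 := by
    rw [Lp.eq_zero_iff_ae_eq_zero]
    refine ae_eq_zero_of_coef_eq_zero (Lp.memLp _) p fun k => ?_
    simpa [diracCoef] using hz (false, k)
  exact (WithLp.ofLp_injective 2) (Prod.ext h1 h2)

theorem diracSynth_injective : Function.Injective (diracSynth a A b B p) := by
  intro v w h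
  have := congrArg (diracCoef p) h
  rw [diracCoef_synth, diracCoef_synth] at this
  exact Subtype.ext this

/-- Boundedness is the only a priori information that `Chain.mem_rapid_of_bounded` needs about a
root function. -/
theorem diracCoef_bounded (f : DiracSpace) : ∃ K, ∀ s, ‖diracCoef p f s‖ ≤ K := by
  refine ⟨Real.pi⁻¹ * (∫ x, ‖f.fst x‖ ∂intervalMeasure) +
    Real.pi⁻¹ * (∫ x, ‖f.snd x‖ ∂intervalMeasure), fun s => ?_⟩
  have h1 : 0 ≤ Real.pi⁻¹ * (∫ x, ‖f.fst x‖ ∂intervalMeasure) := by positivity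
  have h2 : 0 ≤ Real.pi⁻¹ * (∫ x, ‖f.snd x‖ ∂intervalMeasure) := by positivity
  unfold diracCoef
  split_ifs
  · exact (norm_coef_le _ _).trans (by linarith)
  · exact (norm_coef_le _ _).trans (by linarith)

theorem trigPotential_eq (c C : ℂ) (x : ℝ) :
    trigPotential c C x = c * mode (-2) x + C * mode 2 x := by
  unfold trigPotential mode
  congr 3 <;> · push_cast; ring_nf

theorem coef_trigPotential_mul (c C : ℂ) {y : ℝ → ℂ} (hy : Integrable y intervalMeasure) (k : ℤ) :
    coef (fun x => trigPotential c C x * y x) (2 * k + p) =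
      c * coef y (2 * (k - 1) + p) + C * coef y (2 * (k + 1) + p) := by
  have hi : ∀ j, Integrable (fun x => mode j x * y x) intervalMeasure := fun j => by
    simpa only [mul_comm] using integrable_mul_mode hy j
  have h1 : (fun x => trigPotential c C x * y x) =
      fun x => c * (mode (-2) x * y x) + C * (mode 2 x * y x) := by
    ext x; rw [trigPotential_eq]; ring
  rw [h1, coef_add ((hi _).const_mul c) ((hi _).const_mul C), coef_const_mul, coef_const_mul,
    coef_mode_mul, coef_mode_mul]
  congr 3 <;> ring_nf

theorem synth_trigPotential (c C : ℂ) {w : ℤ → ℂ} (hw : w ∈ rapid Int.natAbs) (x : ℝ) :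
    synth p (fun k => c * w (k - 1) + C * w (k + 1)) x = trigPotential c C x * synth p w x := by
  have hs : ∀ j : ℤ, (fun k => w (k + j)) ∈ rapid Int.natAbs := fun j => by
    simpa using rapid.weighted_comp (ht' := Int.natAbs) hw (fun k : ℤ => k + j) (fun _ => 1) 1 1
      j.natAbs le_rfl (by simp) (fun k => by omega)
  have h1 := synth_shift (-1) w p x
  have h2 := synth_shift 1 w p x
  have h3 := hs (-1)
  simp only [← sub_eq_add_neg] at h1 h3
  rw [synth_add (rapid.const_mul h3 c) (rapid.const_mul (hs 1) C), synth_const_mul,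
    synth_const_mul, h1, h2, trigPotential_eq]
  ring_nf

theorem integrable_trigPotential_mul (c C : ℂ) {y : ℝ → ℂ} (hy : Integrable y intervalMeasure) :
    Integrable (fun x => trigPotential c C x * y x) intervalMeasure := by
  have h := ((integrable_mul_mode hy (-2)).const_mul c).add ((integrable_mul_mode hy 2).const_mul C)
  refine h.congr (Filter.Eventually.of_forall fun x => ?_)
  simp only [Pi.add_apply, trigPotential_eq]; ring

/-- On the domain of the Dirac operator the Fourier coefficients intertwine it with the
tridiagonal operator. -/
theorem diracCoef_of_mem_graph {t : ℂ} (ht : t * mode p Real.pi = 1) {w : DiracSpace × DiracSpace}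
    (hw : w ∈ diracGraph (trigPotential a A) (trigPotential b B) t) :
    diracCoef p w.2 = (diracChain a A b B p).act (diracCoef p w.1) := by
  obtain ⟨y₁, y₂, d₁, d₂, h1, h2, h3, h4, h5, h6, h7, h8⟩ := hw
  ext ⟨s, k⟩
  cases s
  · simp only [diracCoef, Chain.act, diracChain, Bool.false_eq_true, if_false, Bool.not_false,
      if_true]
    rw [coef_congr h8, coef_congr h5, coef_congr h5, coef_congr h6,
      coef_add (h2.integrable.const_mul _) (integrable_trigPotential_mul _ _ h1.integrable_self),
      coef_const_mul, coef_trigPotential_mul _ _ h1.integrable_self, h2.coef_deriv ht h4]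
    push_cast
    linear_combination ((2 * k + p : ℂ) * coef y₂ (2 * k + p)) * Complex.I_sq
  · simp only [diracCoef, Chain.act, diracChain, Bool.false_eq_true, if_false, Bool.not_true,
      if_true]
    rw [coef_congr h7, coef_congr h6, coef_congr h6, coef_congr h5,
      coef_add (h1.integrable.const_mul _) (integrable_trigPotential_mul _ _ h2.integrable_self),
      coef_const_mul, coef_trigPotential_mul _ _ h2.integrable_self, h1.coef_deriv ht h3]
    push_cast
    linear_combination (-(2 * k + p : ℂ) * coef y₁ (2 * k + p)) * Complex.I_sq

/-- Converse of `diracCoef_of_mem_graph`: rapid decay makes the synthesized function smooth enough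
to lie in the domain, whatever the coefficients are. -/
theorem diracSynth_mem_graph {t : ℂ} (ht : t * mode p Real.pi = 1)
    (w : rapid (diracChain a A b B p).ht) :
    (diracSynth a A b B p w, diracSynth a A b B p ((diracChain a A b B p).op w)) ∈
      diracGraph (trigPotential a A) (trigPotential b B) t := by
  have hr := fun s => rapid_component a A b B p w.2 s
  refine ⟨_, _, _, _, hasL2Deriv_synth (hr true) p, hasL2Deriv_synth (hr false) p,
    synth_pi ht _, synth_pi ht _, diracSynth_fst w, diracSynth_snd w, ?_, ?_⟩
  · refine (diracSynth_fst _).trans (Filter.Eventually.of_forall fun x => ?_)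
    have h1 : ∀ k : ℤ, ((diracChain a A b B p).op w).1 (true, k) =
        Complex.I * (-Complex.I * ((2 * k + p : ℂ) * w.1 (true, k))) +
          (a * w.1 (false, k - 1) + A * w.1 (false, k + 1)) := by
      intro k
      change (diracChain a A b B p).act w.1 (true, k) = _
      simp only [Chain.act, diracChain, if_true, Bool.not_true]
      linear_combination ((2 * k + p : ℂ) * w.1 (true, k)) * Complex.I_sq
    have h2 : (fun k : ℤ => a * w.1 (false, k - 1) + A * w.1 (false, k + 1)) ∈
        rapid Int.natAbs := by
      refine Submodule.add_mem _ (rapid.const_mul ?_ a) (rapid.const_mul ?_ A)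
      · simpa using rapid.weighted_comp (ht' := Int.natAbs) (hr false) (fun k : ℤ => k - 1)
          (fun _ => 1) 1 1 1 le_rfl (by simp) (fun k => by omega)
      · simpa using rapid.weighted_comp (ht' := Int.natAbs) (hr false) (fun k : ℤ => k + 1)
          (fun _ => 1) 1 1 1 le_rfl (by simp) (fun k => by omega)
    simp only [h1]
    rw [synth_add (rapid.const_mul (rapid.const_mul (rapid.freq_mul (hr true) p) _) _) h2,
      synth_const_mul, synth_trigPotential _ _ (hr false)]
  · refine (diracSynth_snd _).trans (Filter.Eventually.of_forall fun x => ?_)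
    have h1 : ∀ k : ℤ, ((diracChain a A b B p).op w).1 (false, k) =
        -Complex.I * (-Complex.I * ((2 * k + p : ℂ) * w.1 (false, k))) +
          (b * w.1 (true, k - 1) + B * w.1 (true, k + 1)) := by
      intro k
      change (diracChain a A b B p).act w.1 (false, k) = _
      simp only [Chain.act, diracChain, Bool.false_eq_true, if_false, Bool.not_false]
      linear_combination (-(2 * k + p : ℂ) * w.1 (false, k)) * Complex.I_sq
    have h2 : (fun k : ℤ => b * w.1 (true, k - 1) + B * w.1 (true, k + 1)) ∈
        rapid Int.natAbs := by
      refine Submodule.add_mem _ (rapid.const_mul ?_ b) (rapid.const_mul ?_ B)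
      · simpa using rapid.weighted_comp (ht' := Int.natAbs) (hr true) (fun k : ℤ => k - 1)
          (fun _ => 1) 1 1 1 le_rfl (by simp) (fun k => by omega)
      · simpa using rapid.weighted_comp (ht' := Int.natAbs) (hr true) (fun k : ℤ => k + 1)
          (fun _ => 1) 1 1 1 le_rfl (by simp) (fun k => by omega)
    simp only [h1]
    rw [synth_add (rapid.const_mul (rapid.const_mul (rapid.freq_mul (hr false) p) _) _) h2,
      synth_const_mul, synth_trigPotential _ _ (hr true)]

theorem diracOperator_apply_iff (P Q : ℝ → ℂ) (t : ℂ) (f g : DiracSpace) :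
    (∃ h : f ∈ (diracOperator P Q t).domain, diracOperator P Q t ⟨f, h⟩ = g) ↔
      (f, g) ∈ diracGraph P Q t := by
  rw [← diracOperator_graph, LinearPMap.mem_graph_iff]
  constructor
  · rintro ⟨h, rfl⟩; exact ⟨⟨f, h⟩, rfl, rfl⟩
  · rintro ⟨⟨f', h⟩, h1, h2⟩
    dsimp only at h1 h2
    subst h1
    exact ⟨h, h2⟩

/-- By induction `T f - z f` has rapidly decaying coefficients. Those of `f` are bounded and solve
the resolvent equation with this right-hand side, so they decay rapidly as well, and no root
function is lost by restricting to such sequences. -/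
theorem generalizedEigenspace_diracOperator {t : ℂ} (ht : t * mode p Real.pi = 1) (z : ℂ) (k : ℕ) :
    generalizedEigenspace (diracOperator (trigPotential a A) (trigPotential b B) t) z k =
      (LinearMap.ker (((diracChain a A b B p).op - z • 1) ^ k)).map (diracSynth a A b B p) := by
  induction k with
  | zero =>
    simp [generalizedEigenspace, Module.End.one_eq_id]
  | succ k ih =>
    ext f
    rw [mem_generalizedEigenspace_succ, ih]
    constructor
    · rintro ⟨hf, v, hv, hvf⟩
      have hg := (diracOperator_apply_iff _ _ t f _).1 ⟨hf, rfl⟩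
      have hc := diracCoef_of_mem_graph ht hg
      have hv' : ∀ s, v.1 s = (diracChain a A b B p).act (diracCoef p f) s - z * diracCoef p f s := by
        intro s
        rw [← diracCoef_synth v, hvf, diracCoef_sub, diracCoef_smul, hc]
      have hrap : diracCoef p f ∈ rapid (diracChain a A b B p).ht := by
        refine (diracChain a A b B p).mem_rapid_of_bounded z (diracCoef_bounded f) ?_
        have : (fun i => (diracChain a A b B p).act (diracCoef p f) i - z * diracCoef p f i) = v.1 :=
          funext fun s => (hv' s).symm
        rw [this]; exact v.2
      refine ⟨⟨diracCoef p f, hrap⟩, ?_, ?_⟩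
      · change ((((diracChain a A b B p).op - z • 1) ^ (k + 1)) _) = 0
        rw [pow_succ, Module.End.mul_apply]
        have : ((diracChain a A b B p).op - z • 1) ⟨diracCoef p f, hrap⟩ = v := by
          ext s; exact (hv' s).symm
        rw [this]; exact hv
      · exact diracCoef_injective (p := p) (diracCoef_synth _)
    · rintro ⟨w, hw, rfl⟩
      obtain ⟨hd, hval⟩ := (diracOperator_apply_iff _ _ t _ _).2 (diracSynth_mem_graph ht w)
      refine ⟨hd, ((diracChain a A b B p).op - z • 1) w, ?_, ?_⟩
      · change ((((diracChain a A b B p).op - z • 1) ^ k) _) = 0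
        rw [← Module.End.mul_apply, ← pow_succ]; exact hw
      · rw [hval, LinearMap.sub_apply, map_sub]; simp

/-- The algebraic multiplicity of the Dirac operator is the dimension of the root space of the
tridiagonal operator. -/
theorem algebraicMultiplicity_diracOperator (a A b B : ℂ) (p : ℤ) {t : ℂ}
    (ht : t * mode p Real.pi = 1) (z : ℂ) :
    algebraicMultiplicity (diracOperator (trigPotential a A) (trigPotential b B) t) z =
      Module.rank ℂ ((diracChain a A b B p).op.maxGenEigenspace z) := by
  unfold algebraicMultiplicity
  have : ⨆ k : ℕ, generalizedEigenspace
      (diracOperator (trigPotential a A) (trigPotential b B) t) z k =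
      ((diracChain a A b B p).op.maxGenEigenspace z).map (diracSynth a A b B p) := by
    simp only [generalizedEigenspace_diracOperator ht, ← Submodule.map_iSup,
      ← Module.End.iSup_genEigenspace_eq, Module.End.genEigenspace_nat]
  rw [this]
  exact (LinearEquiv.rank_eq (Submodule.equivMapOfInjective _ diracSynth_injective _)).symm

end Synthesis

namespace Chain

/-! ### Isolated diagonal entries -/

variable {ι : Type*} (J : Chain ι)

/-- Outside `S` the diagonal entries keep distance `1` from `n`, and of two neighbouring diagonal
entries at least one has distance `R` from `n`. -/
structure Isolated (S : Set ι) (n : ℂ) (R : ℝ) : Prop where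
  near : ∀ i ∉ S, 1 ≤ ‖n - J.e i‖
  far : ∀ i, R ≤ ‖n - J.e i‖ ∨ (R ≤ ‖n - J.e (J.l i)‖ ∧ R ≤ ‖n - J.e (J.r i)‖)
  eq : ∀ i ∈ S, J.e i = n

/-- The operator minus `z` off the diagonal: the equation at the site `i`, solved for `w i`. -/
theorem norm_mul_le_of_eq {w : ι → ℂ} {z : ℂ} {i : ι} {H m : ℝ} (h : ‖J.act w i - z * w i‖ ≤ H)
    (hl : ‖w (J.l i)‖ ≤ m) (hr : ‖w (J.r i)‖ ≤ m) :
    ‖z - J.e i‖ * ‖w i‖ ≤ 2 * J.bound * m + H := by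
  have h1 : (z - J.e i) * w i = (J.c i * w (J.r i) + J.d i * w (J.l i)) -
      (J.act w i - z * w i) := by simp only [act]; ring
  rw [← norm_mul, h1]
  exact (norm_sub_le _ _).trans (add_le_add (J.norm_off_le w i m hl hr) h)

variable {J} {S : Set ι} {n z : ℂ} {R : ℝ}

theorem norm_shift_ge (hz : ‖z - n‖ ≤ 1 / 2) (x : ℂ) : ‖n - x‖ - 1 / 2 ≤ ‖z - x‖ := by
  have h1 : n - x = (z - x) - (z - n) := by ring
  have h2 : ‖n - x‖ ≤ ‖z - x‖ + ‖z - n‖ := by rw [h1]; exact norm_sub_le _ _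
  linarith

/-- A site with entry near `n` has both neighbours far from `n`. Since the entries on `S` are equal
to `n`, far sites lie outside `S`. -/
theorem Isolated.nbr_notMem (h : J.Isolated S n R) (hR : 0 < R) {i : ι} (hi : ‖n - J.e i‖ < R) :
    (R ≤ ‖n - J.e (J.l i)‖ ∧ R ≤ ‖n - J.e (J.r i)‖) ∧ J.l i ∉ S ∧ J.r i ∉ S := by
  have h1 := (h.far i).resolve_left (not_le.2 hi)
  refine ⟨h1, fun hs => ?_, fun hs => ?_⟩
  · have := h1.1; rw [h.eq _ hs, sub_self, norm_zero] at this; linarith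
  · have := h1.2; rw [h.eq _ hs, sub_self, norm_zero] at this; linarith

/-- A priori estimates for bounded solutions of the resolvent equation off `S`. -/
theorem Isolated.estimate (h : J.Isolated S n R) (hR : 40 * J.bound ^ 2 ≤ R)
    (hz : ‖z - n‖ ≤ 1 / 2) {w : ι → ℂ} (hw : ∃ K, ∀ i, ‖w i‖ ≤ K) {W H : ℝ} (hW0 : 0 ≤ W)
    (hH0 : 0 ≤ H) (hW : ∀ i ∈ S, ‖w i‖ ≤ W) (hH : ∀ i ∉ S, ‖J.act w i - z * w i‖ ≤ H) :
    (∀ i ∉ S, ‖w i‖ ≤ 40 * J.bound ^ 2 / R * W + 5 * H) ∧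
    (∀ i ∉ S, R ≤ ‖n - J.e i‖ → ‖w i‖ ≤ J.bound / R * (8 * W + 22 * H)) := by
  have hb := J.one_le_bound
  have hR40 : 40 ≤ R := by nlinarith
  have hR0 : 0 < R := by linarith
  obtain ⟨q, hq⟩ : ∃ q, q = J.bound / R := ⟨_, rfl⟩
  have hqR : q * R = J.bound := by rw [hq]; field_simp
  have hq0 : 0 ≤ q := by rw [hq]; positivity
  have hbq : 40 * J.bound * q ≤ 1 := by
    rw [hq, ← mul_div_assoc, div_le_one hR0]; nlinarith
  have hrew : 40 * J.bound ^ 2 / R * W = 40 * J.bound * q * W := by rw [hq]; ring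
  -- estimates in terms of a common bound
  have step : ∀ M, 0 ≤ M → (∀ i ∉ S, ‖w i‖ ≤ M) →
      (∀ i ∉ S, R ≤ ‖n - J.e i‖ → ‖w i‖ ≤ q * (4 * (M + W) + 2 * H)) ∧
      (∀ i ∉ S, ‖w i‖ ≤ M / 2 + 20 * J.bound * q * W + 5 / 2 * H) := by
    intro M hM0 hM
    have hall : ∀ i, ‖w i‖ ≤ M + W := fun i => by
      by_cases hi : i ∈ S
      · exact (hW i hi).trans (by linarith)
      · exact (hM i hi).trans (by linarith)
    -- At a far site the equation is divided by at least `R / 2`, so any bound at the neighbours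
    -- gains a factor of order `1 / R`.
    have hfar : ∀ i ∉ S, R ≤ ‖n - J.e i‖ → ‖w i‖ ≤ q * (4 * (M + W) + 2 * H) := by
      intro i hi hfi
      have h1 := J.norm_mul_le_of_eq (hH i hi) (hall _) (hall _)
      have h2 := norm_shift_ge hz (J.e i)
      have h3 : R / 2 * ‖w i‖ ≤ 2 * J.bound * (M + W) + H := by
        refine le_trans (mul_le_mul_of_nonneg_right ?_ (norm_nonneg _)) h1
        linarith
      have h4 : R * ‖w i‖ ≤ R * (q * (4 * (M + W) + 2 * H)) := by
        have h5 : R * (q * (4 * (M + W) + 2 * H)) = J.bound * (4 * (M + W) + 2 * H) := by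
          rw [← hqR]; ring
        rw [h5]; nlinarith
      exact le_of_mul_le_mul_left h4 hR0
    refine ⟨hfar, fun i hi => ?_⟩
    have hF0 : 0 ≤ q * (4 * (M + W) + 2 * H) := by positivity
    by_cases hfi : R ≤ ‖n - J.e i‖
    · refine (hfar i hi hfi).trans ?_
      have h6 : q * M ≤ J.bound * q * M := by
        nlinarith [mul_nonneg hq0 hM0]
      have h7 : q * W ≤ J.bound * q * W := by
        nlinarith [mul_nonneg hq0 hW0]
      have h8 : q * H ≤ J.bound * q * H := by
        nlinarith [mul_nonneg hq0 hH0]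
      have h9 : 40 * J.bound * q * M ≤ 1 * M := by gcongr
      have h10 : 40 * J.bound * q * H ≤ 1 * H := by gcongr
      have h11 : 0 ≤ J.bound * q * W := by positivity
      linarith
    -- At a near site the division is only by `1 / 2`, but both neighbours are far and already carry
    -- the factor `q`.
    · obtain ⟨hlr, hl, hr⟩ := h.nbr_notMem hR0 (not_le.1 hfi)
      have h1 := J.norm_mul_le_of_eq (hH i hi) (hfar _ hl hlr.1) (hfar _ hr hlr.2)
      have h2 := norm_shift_ge hz (J.e i)
      have h3 : 1 / 2 * ‖w i‖ ≤ 2 * J.bound * (q * (4 * (M + W) + 2 * H)) + H := by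
        refine le_trans (mul_le_mul_of_nonneg_right ?_ (norm_nonneg _)) h1
        linarith [h.near i hi]
      have h9 : 40 * J.bound * q * M ≤ 1 * M := by gcongr
      have h10 : 40 * J.bound * q * H ≤ 1 * H := by gcongr
      have h11 : 0 ≤ J.bound * q * W := by positivity
      linarith
  have main : ∀ i ∉ S, ‖w i‖ ≤ 40 * J.bound * q * W + 5 * H := by
    obtain ⟨K, hK⟩ := hw
    have hT0 : 0 ≤ 40 * J.bound * q * W + 5 * H := by
      have : 0 ≤ J.bound * q * W := by positivity
      linarith
    -- `step` improves a bound `M` to `M / 2` plus a constant, and the right-hand term is its fixed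
    -- point. Iterating from the bound `K` and letting `k → ∞` removes every dependence on `K`.
    have hk : ∀ k : ℕ, ∀ i ∉ S, ‖w i‖ ≤ |K| * (1 / 2) ^ k + (40 * J.bound * q * W + 5 * H) := by
      intro k
      induction k with
      | zero => intro i _; have := (hK i).trans (le_abs_self K); rw [pow_zero]; linarith
      | succ k ih =>
        intro i hi
        have := (step _ (by positivity) ih).2 i hi
        rw [pow_succ]; linarith
    intro i hi
    have hlim : Filter.Tendsto (fun k : ℕ => |K| * (1 / 2 : ℝ) ^ k +
        (40 * J.bound * q * W + 5 * H)) Filter.atTop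
        (nhds (|K| * 0 + (40 * J.bound * q * W + 5 * H))) :=
      ((tendsto_pow_atTop_nhds_zero_of_lt_one (by norm_num) (by norm_num)).const_mul _).add_const _
    have := ge_of_tendsto' hlim (fun k => hk k i hi)
    linarith
  rw [hrew, ← hq]
  refine ⟨main, fun i hi hfi => ?_⟩
  have hM0 : 0 ≤ 40 * J.bound * q * W + 5 * H := by
    have : 0 ≤ J.bound * q * W := by positivity
    linarith
  refine ((step _ hM0 main).1 i hi hfi).trans ?_
  have h9 : 40 * J.bound * q * W ≤ 1 * W := by gcongr
  refine mul_le_mul_of_nonneg_left ?_ hq0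
  linarith

/-! ### Counting eigenvalues near a diagonal entry -/

/-- Without a resonant site there are no eigenvalues near `n`. -/
theorem Isolated.rank_of_empty {ι : Type} {J : Chain ι} (h : J.Isolated ∅ n R)
    (hR : 40 * J.bound ^ 2 ≤ R) (hz : ‖z - n‖ ≤ 1 / 2) :
    Module.rank ℂ (J.op.maxGenEigenspace z) = 0 := by
  rw [maxGenEigenspace_eq_bot J.op z, rank_bot]
  intro v hv
  have hv' : ∀ i, J.act v.1 i - z * v.1 i = 0 := fun i => by
    have := congrArg (fun u : rapid J.ht => u.1 i) hv
    exact sub_eq_zero.2 this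
  have := (h.estimate hR hz (rapid.bounded v.2) (W := 0) (H := 0) le_rfl le_rfl (by simp)
    (fun i _ => by rw [hv' i, norm_zero])).1
  ext i
  simpa using this i (by simp)

variable (J)

/-- A normalized bounded eigenfunction of the tridiagonal operator. -/
structure IsEigen (o : ι) (z : ℂ) (w : ι → ℂ) : Prop where
  bounded : ∃ K, ∀ i, ‖w i‖ ≤ K
  one : w o = 1
  eq : ∀ i, J.act w i = z * w i

variable {J} {o : ι}

theorem IsEigen.mem_rapid {w : ι → ℂ} (h : J.IsEigen o z w) : w ∈ rapid J.ht := by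
  refine J.mem_rapid_of_bounded z h.bounded ?_
  have : (fun i => J.act w i - z * w i) = 0 := funext fun i => by simp [h.eq i]
  rw [this]; exact Submodule.zero_mem _

theorem IsEigen.estimate (h : J.Isolated {o} n R) (hR : 40 * J.bound ^ 2 ≤ R)
    (hz : ‖z - n‖ ≤ 1 / 2) {w : ι → ℂ} (hw : J.IsEigen o z w) :
    (∀ i ≠ o, ‖w i‖ ≤ 40 * J.bound ^ 2 / R) ∧ (∀ i, ‖w i‖ ≤ 1) ∧
    (∀ i, R ≤ ‖n - J.e i‖ → ‖w i‖ ≤ 8 * J.bound / R) := by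
  have hb := J.one_le_bound
  have hR40 : 40 ≤ R := by nlinarith
  have h1 := h.estimate hR hz hw.bounded (W := 1) (H := 0) zero_le_one le_rfl
    (fun i hi => by rw [Set.mem_singleton_iff.1 hi, hw.one, norm_one])
    (fun i _ => by rw [hw.eq i, sub_self, norm_zero])
  have h2 : ∀ i ≠ o, ‖w i‖ ≤ 40 * J.bound ^ 2 / R := fun i hi => by simpa using h1.1 i hi
  refine ⟨h2, fun i => ?_, fun i hi => ?_⟩
  · by_cases hio : i = o
    · rw [hio, hw.one, norm_one]
    · exact (h2 i hio).trans ((div_le_one (by linarith)).2 hR)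
  · have hio : i ∉ ({o} : Set ι) := fun hio => by
      rw [h.eq i hio, sub_self, norm_zero] at hi; linarith
    refine (h1.2 i hio hi).trans (le_of_eq ?_)
    ring

theorem IsEigen.eq_add {w : ι → ℂ} (hn : J.e o = n) (hw : J.IsEigen o z w) :
    z - n = J.c o * w (J.r o) + J.d o * w (J.l o) := by
  have := hw.eq o
  rw [act, hw.one, hn] at this
  linear_combination -this

/-- The eigenvalue near an isolated diagonal entry is unique. -/
theorem IsEigen.unique (h : J.Isolated {o} n R) (hR : 160 * J.bound ^ 2 ≤ R)
    (hz : ‖z - n‖ ≤ 1 / 2) {z' : ℂ} (hz' : ‖z' - n‖ ≤ 1 / 2) {w w' : ι → ℂ}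
    (hw : J.IsEigen o z w) (hw' : J.IsEigen o z' w') : z = z' ∧ w = w' := by
  have hb := J.one_le_bound
  have hR160 : 160 ≤ R := by nlinarith
  have hR0 : 0 < R := by linarith
  have hR' : 40 * J.bound ^ 2 ≤ R := by nlinarith
  have hn : J.e o = n := h.eq o rfl
  have hbd : ∃ K, ∀ i, ‖(w - w') i‖ ≤ K := by
    obtain ⟨K, hK⟩ := hw.bounded
    obtain ⟨K', hK'⟩ := hw'.bounded
    exact ⟨K + K', fun i => (norm_sub_le _ _).trans (add_le_add (hK i) (hK' i))⟩
  have hest' := hw'.estimate h hR' hz'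
  -- The difference `w - w'` vanishes at `o` and solves the resolvent equation with right-hand side
  -- `(z - z') w'`, whose size is at most `‖z - z'‖`.
  have h1 := h.estimate hR' hz hbd (W := 0) (H := ‖z - z'‖) le_rfl (norm_nonneg _)
    (fun i hi => by rw [Set.mem_singleton_iff.1 hi]; simp [hw.one, hw'.one])
    (fun i _ => by
      have : J.act (w - w') i - z * (w - w') i = (z - z') * w' i := by
        rw [act_sub, hw.eq, hw'.eq]; simp only [Pi.sub_apply]; ring
      rw [this, norm_mul]
      nlinarith [hest'.2.1 i, norm_nonneg (z - z')])
  have hnear : ‖n - J.e o‖ < R := by rw [hn, sub_self, norm_zero]; exact hR0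
  obtain ⟨hlr, hl, hr⟩ := h.nbr_notMem hR0 hnear
  -- The equation at `o` returns `‖z - z'‖` multiplied by `44 * bound ^ 2 / R`, which is below `1`
  -- because `R ≥ 160 * bound ^ 2`.
  have hzz : ‖z - z'‖ ≤ 2 * J.bound * (J.bound / R * (8 * 0 + 22 * ‖z - z'‖)) := by
    have : z - z' = J.c o * (w - w') (J.r o) + J.d o * (w - w') (J.l o) := by
      have e1 := hw.eq_add hn
      have e2 := hw'.eq_add hn
      simp only [Pi.sub_apply]; linear_combination e1 - e2
    calc ‖z - z'‖ = ‖J.c o * (w - w') (J.r o) + J.d o * (w - w') (J.l o)‖ := by rw [← this]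
      _ ≤ _ := J.norm_off_le (w - w') o _ (h1.2 _ hl hlr.1) (h1.2 _ hr hlr.2)
  have hz0 : ‖z - z'‖ = 0 := by
    have h3 : 2 * J.bound * (J.bound / R * (8 * 0 + 22 * ‖z - z'‖)) =
        44 * (J.bound ^ 2 / R) * ‖z - z'‖ := by ring
    have h4 : J.bound ^ 2 / R ≤ 1 / 160 := by rw [div_le_iff₀ hR0]; linarith
    rw [h3] at hzz
    nlinarith [norm_nonneg (z - z'), mul_le_mul_of_nonneg_right h4 (norm_nonneg (z - z'))]
  refine ⟨sub_eq_zero.1 (norm_eq_zero.1 hz0), funext fun i => sub_eq_zero.1 ?_⟩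
  by_cases hio : i = o
  · rw [hio, hw.one, hw'.one, sub_self]
  · have := h1.1 i hio
    rw [hz0] at this
    simpa [sub_eq_zero] using this

/-- Near an isolated diagonal entry, the root space at the eigenvalue is a line, and the other root
spaces are trivial. -/
theorem IsEigen.rank {ι : Type} {J : Chain ι} {o : ι} {l : ℂ} (h : J.Isolated {o} n R)
    (hR : 160 * J.bound ^ 2 ≤ R) (hl : ‖l - n‖ ≤ 1 / 2) {w : ι → ℂ} (hw : J.IsEigen o l w)
    (hz : ‖z - n‖ ≤ 1 / 2) :
    Module.rank ℂ (J.op.maxGenEigenspace z) = if z = l then 1 else 0 := by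
  have hb := J.one_le_bound
  have hR160 : 160 ≤ R := by nlinarith
  have hR0 : 0 < R := by linarith
  have hR' : 40 * J.bound ^ 2 ≤ R := by nlinarith
  have hn : J.e o = n := h.eq o rfl
  have hker : ∀ v : rapid J.ht, J.op v = z • v → v.1 o = 0 → v = 0 := by
    intro v hv hvo
    have hv' : ∀ i, J.act v.1 i - z * v.1 i = 0 := fun i => by
      have := congrArg (fun u : rapid J.ht => u.1 i) hv
      exact sub_eq_zero.2 this
    have := (h.estimate hR' hz (rapid.bounded v.2) (W := 0) (H := 0) le_rfl le_rfl
      (fun i hi => by rw [Set.mem_singleton_iff.1 hi, hvo, norm_zero])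
      (fun i _ => by rw [hv' i, norm_zero])).1
    ext i
    by_cases hio : i = o
    · rw [hio, hvo]; rfl
    · simpa using this i hio
  have heig : ∀ v : rapid J.ht, J.op v = z • v → v.1 o ≠ 0 →
      J.IsEigen o z ((v.1 o)⁻¹ • v.1) := by
    intro v hv hvo
    refine ⟨rapid.bounded (Submodule.smul_mem _ _ v.2), by simp [hvo], fun i => ?_⟩
    have : J.act v.1 i = z * v.1 i := congrArg (fun u : rapid J.ht => u.1 i) hv
    rw [act_smul, this, Pi.smul_apply, smul_eq_mul]; ring
  split_ifs with hzl
  · subst hzl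
    refine rank_maxGenEigenspace_eq_one J.op z ⟨w, hw.mem_rapid⟩ ?_ ?_ ?_ ?_
    · intro h0
      have : w o = 0 := congrArg (fun u : rapid J.ht => u.1 o) h0
      rw [hw.one] at this; exact one_ne_zero this
    · ext i; exact hw.eq i
    · intro v hv
      refine ⟨v.1 o, ?_⟩
      by_cases hvo : v.1 o = 0
      · rw [hker v hv hvo]; simp
      · have := (IsEigen.unique h hR hz hz (heig v hv hvo) hw).2
        ext i
        have hi := congrFun this i
        simp only [Pi.smul_apply, smul_eq_mul] at hi
        change v.1 i = v.1 o * w i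
        rw [← hi, mul_inv_cancel_left₀ hvo]
    · intro v hv
      -- There is no Jordan block: subtracting a multiple of the eigenfunction makes the generalized
      -- eigenvector vanish at `o`. It is then of order `1 / R` at the neighbours of `o`, whereas
      -- the equation at `o` demands that their combination be `1`.
      obtain ⟨u, hu⟩ : ∃ u : ι → ℂ, u = v.1 - v.1 o • w := ⟨_, rfl⟩
      have hur : u ∈ rapid J.ht := by
        rw [hu]; exact Submodule.sub_mem _ v.2 (Submodule.smul_mem _ _ hw.mem_rapid)
      have huo : u o = 0 := by rw [hu]; simp [hw.one]
      have hue : ∀ i, J.act u i - z * u i = w i := by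
        intro i
        have h1 : J.act v.1 i - z * v.1 i = w i := congrArg (fun u : rapid J.ht => u.1 i) hv
        rw [hu, act_sub, act_smul, hw.eq]
        simp only [Pi.sub_apply, Pi.smul_apply, smul_eq_mul]
        linear_combination h1
      have hest := hw.estimate h hR' hz
      have h1 := h.estimate hR' hz (rapid.bounded hur) (W := 0) (H := 1) le_rfl zero_le_one
        (fun i hi => by rw [Set.mem_singleton_iff.1 hi, huo, norm_zero])
        (fun i _ => by rw [hue i]; exact hest.2.1 i)
      have hnear : ‖n - J.e o‖ < R := by rw [hn, sub_self, norm_zero]; exact hR0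
      obtain ⟨hlr, hl, hr⟩ := h.nbr_notMem hR0 hnear
      have h2 := J.norm_off_le u o _ (h1.2 _ hl hlr.1) (h1.2 _ hr hlr.2)
      have h3 : J.c o * u (J.r o) + J.d o * u (J.l o) = 1 := by
        have := hue o
        rw [act, huo, hw.one] at this
        linear_combination this
      rw [h3, norm_one] at h2
      have h4 : J.bound ^ 2 / R ≤ 1 / 160 := by rw [div_le_iff₀ hR0]; linarith
      have h5 : 2 * J.bound * (J.bound / R * (8 * 0 + 22 * 1)) = 44 * (J.bound ^ 2 / R) := by ring
      rw [h5] at h2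
      linarith
  · rw [maxGenEigenspace_eq_bot J.op z, rank_bot]
    intro v hv
    by_contra hv0
    have hvo : v.1 o ≠ 0 := fun hvo => hv0 (hker v hv hvo)
    exact hzl (IsEigen.unique h hR hz hl (heig v hv hvo) hw).1

end Chain

namespace Chain

/-! ### Existence of the eigenvalue near an isolated diagonal entry -/

variable {ι : Type*} (J : Chain ι)

/-- The eigenvalue that the equation at the site `o` assigns to a normalized function. -/
def eigApprox (o : ι) (w : ι → ℂ) : ℂ := J.e o + (J.c o * w (J.r o) + J.d o * w (J.l o))

open Classical in
/-- One step of the iteration for the eigenvalue equation. -/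
noncomputable def iterStep (o : ι) (w : ι → ℂ) (i : ι) : ℂ :=
  if i = o then 1 else (J.c i * w (J.r i) + J.d i * w (J.l i)) / (J.eigApprox o w - J.e i)

variable {J} {o : ι} {n : ℂ} {R : ℝ}

/-- The region in which the iteration takes place. -/
structure IterRegion (J : Chain ι) (o : ι) (n : ℂ) (R : ℝ) (w : ι → ℂ) : Prop where
  one : w o = 1
  le_one : ∀ i, ‖w i‖ ≤ 1
  far : ∀ i, R ≤ ‖n - J.e i‖ → ‖w i‖ ≤ 4 * J.bound / R

theorem IterRegion.norm_eigApprox_sub (h : J.Isolated {o} n R) (hR : 160 * J.bound ^ 2 ≤ R)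
    {w : ι → ℂ} (hw : J.IterRegion o n R w) :
    ‖J.eigApprox o w - n‖ ≤ 8 * J.bound ^ 2 / R := by
  have hb := J.one_le_bound
  have hR0 : 0 < R := by nlinarith
  have hn : J.e o = n := h.eq o rfl
  have hnear : ‖n - J.e o‖ < R := by rw [hn, sub_self, norm_zero]; exact hR0
  obtain ⟨hlr, hl, hr⟩ := h.nbr_notMem hR0 hnear
  have := J.norm_off_le w o _ (hw.far _ hlr.1) (hw.far _ hlr.2)
  rw [eigApprox, hn, add_sub_cancel_left]
  refine this.trans (le_of_eq ?_)
  ring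

theorem IterRegion.norm_eigApprox_sub_le_half (h : J.Isolated {o} n R)
    (hR : 160 * J.bound ^ 2 ≤ R) {w : ι → ℂ} (hw : J.IterRegion o n R w) :
    ‖J.eigApprox o w - n‖ ≤ 1 / 2 := by
  have hb := J.one_le_bound
  have hR0 : 0 < R := by nlinarith
  refine (hw.norm_eigApprox_sub h hR).trans ?_
  rw [div_le_iff₀ hR0]; linarith

theorem IterRegion.le_shift (h : J.Isolated {o} n R) (hR : 160 * J.bound ^ 2 ≤ R)
    {w : ι → ℂ} (hw : J.IterRegion o n R w) {i : ι} (hi : i ≠ o) :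
    1 / 2 ≤ ‖J.eigApprox o w - J.e i‖ := by
  have h1 := norm_shift_ge (hw.norm_eigApprox_sub_le_half h hR) (J.e i)
  have h2 := h.near i hi
  linarith

theorem IterRegion.le_shift_far (h : J.Isolated {o} n R) (hR : 160 * J.bound ^ 2 ≤ R)
    {w : ι → ℂ} (hw : J.IterRegion o n R w) {i : ι} (hi : R ≤ ‖n - J.e i‖) :
    R / 2 ≤ ‖J.eigApprox o w - J.e i‖ := by
  have hb := J.one_le_bound
  have h1 := norm_shift_ge (hw.norm_eigApprox_sub_le_half h hR) (J.e i)
  nlinarith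

theorem Isolated.ne_of_far (h : J.Isolated {o} n R) (hR0 : 0 < R) {i : ι}
    (hi : R ≤ ‖n - J.e i‖) : i ≠ o := by
  rintro rfl
  rw [h.eq i rfl, sub_self, norm_zero] at hi; linarith

/-- The two bounds of the region reproduce each other: far sites are divided by `R / 2`, and the
other sites see only far neighbours, which gives `16 * bound ^ 2 / R ≤ 1`. -/
theorem IterRegion.iterStep (h : J.Isolated {o} n R) (hR : 160 * J.bound ^ 2 ≤ R)
    {w : ι → ℂ} (hw : J.IterRegion o n R w) : J.IterRegion o n R (J.iterStep o w) := by
  have hb := J.one_le_bound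
  have hR0 : 0 < R := by nlinarith
  have hfar : ∀ i, R ≤ ‖n - J.e i‖ → ‖J.iterStep o w i‖ ≤ 4 * J.bound / R := by
    intro i hi
    rw [Chain.iterStep, if_neg (h.ne_of_far hR0 hi), norm_div]
    have h1 := J.norm_off_le w i 1 (hw.le_one _) (hw.le_one _)
    have h2 := hw.le_shift_far h hR hi
    calc _ ≤ (2 * J.bound * 1) / (R / 2) := div_le_div₀ (by linarith) h1 (by linarith) h2
      _ = _ := by field_simp; ring
  have hle : 4 * J.bound / R ≤ 1 := by rw [div_le_one hR0]; nlinarith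
  refine ⟨by simp [Chain.iterStep], fun i => ?_, hfar⟩
  by_cases hio : i = o
  · simp [Chain.iterStep, hio]
  by_cases hi : R ≤ ‖n - J.e i‖
  · exact (hfar i hi).trans hle
  · obtain ⟨hlr, hl, hr⟩ := h.nbr_notMem hR0 (not_le.1 hi)
    rw [Chain.iterStep, if_neg hio, norm_div]
    have h1 := J.norm_off_le w i _ (hw.far _ hlr.1) (hw.far _ hlr.2)
    have h2 := hw.le_shift h hR hio
    calc _ ≤ (2 * J.bound * (4 * J.bound / R)) / (1 / 2) :=
          div_le_div₀ (by positivity) h1 (by norm_num) h2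
      _ = 16 * J.bound ^ 2 / R := by ring
      _ ≤ 1 := by rw [div_le_one hR0]; nlinarith

theorem norm_div_sub_div_le {a a' x x' : ℂ} {m α β δ : ℝ} (hm : 0 < m) (hx : m ≤ ‖x‖)
    (hx' : m ≤ ‖x'‖) (hα : ‖a - a'‖ ≤ α) (hβ : ‖a'‖ ≤ β) (hδ : ‖x - x'‖ ≤ δ) :
    ‖a / x - a' / x'‖ ≤ α / m + β * δ / m ^ 2 := by
  have hx0 : x ≠ 0 := norm_pos_iff.1 (hm.trans_le hx)
  have hx0' : x' ≠ 0 := norm_pos_iff.1 (hm.trans_le hx')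
  have h1 : a / x - a' / x' = (a - a') / x - a' * (x - x') / (x * x') := by
    field_simp; ring
  rw [h1]
  refine (norm_sub_le _ _).trans (add_le_add ?_ ?_)
  · rw [norm_div]; exact div_le_div₀ ((norm_nonneg _).trans hα) hα hm hx
  · rw [norm_div, norm_mul, norm_mul, sq]
    have hβ0 : 0 ≤ β := (norm_nonneg _).trans hβ
    have hδ0 : 0 ≤ δ := (norm_nonneg _).trans hδ
    refine div_le_div₀ (by positivity) ?_ (by positivity) ?_ <;> gcongr

/-- The step halves a norm with two scales. Far sites are measured against `D`, all sites against
the larger `16 * bound * D`. Large differences enter a far site only after division by `R / 2`; a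
near site has a small denominator but only far neighbours. -/
theorem iterStep_contract (h : J.Isolated {o} n R) (hR : 160 * J.bound ^ 2 ≤ R)
    {w w' : ι → ℂ} (hw : J.IterRegion o n R w) (hw' : J.IterRegion o n R w') {D : ℝ} (hD : 0 ≤ D)
    (hall : ∀ i, ‖w i - w' i‖ ≤ 16 * J.bound * D)
    (hfar : ∀ i, R ≤ ‖n - J.e i‖ → ‖w i - w' i‖ ≤ D) :
    (∀ i, ‖J.iterStep o w i - J.iterStep o w' i‖ ≤ 16 * J.bound * (D / 2)) ∧
    (∀ i, R ≤ ‖n - J.e i‖ → ‖J.iterStep o w i - J.iterStep o w' i‖ ≤ D / 2) := by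
  have hb := J.one_le_bound
  have hR0 : 0 < R := by nlinarith
  have hn : J.e o = n := h.eq o rfl
  have hnear : ‖n - J.e o‖ < R := by rw [hn, sub_self, norm_zero]; exact hR0
  have hoff : ∀ i m, ‖w (J.l i) - w' (J.l i)‖ ≤ m → ‖w (J.r i) - w' (J.r i)‖ ≤ m →
      ‖(J.c i * w (J.r i) + J.d i * w (J.l i)) - (J.c i * w' (J.r i) + J.d i * w' (J.l i))‖ ≤
        2 * J.bound * m := by
    intro i m h1 h2
    have := J.norm_off_le (w - w') i m h1 h2
    have e : (J.c i * w (J.r i) + J.d i * w (J.l i)) - (J.c i * w' (J.r i) + J.d i * w' (J.l i)) =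
      J.c i * (w - w') (J.r i) + J.d i * (w - w') (J.l i) := by simp only [Pi.sub_apply]; ring
    rw [e]; exact this
  have hlam : ∀ i, ‖(J.eigApprox o w - J.e i) - (J.eigApprox o w' - J.e i)‖ ≤ 2 * J.bound * D := by
    intro i
    obtain ⟨hlr, hl, hr⟩ := h.nbr_notMem hR0 hnear
    have := hoff o D (hfar _ hlr.1) (hfar _ hlr.2)
    have e : (J.eigApprox o w - J.e i) - (J.eigApprox o w' - J.e i) =
      (J.c o * w (J.r o) + J.d o * w (J.l o)) - (J.c o * w' (J.r o) + J.d o * w' (J.l o)) := by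
      simp only [eigApprox]; ring
    rw [e]; exact this
  have hbR : J.bound ^ 2 / R ≤ 1 / 160 := by rw [div_le_iff₀ hR0]; linarith
  have hbR0 : 0 ≤ J.bound ^ 2 / R := by positivity
  have hR1 : 1 ≤ R := by nlinarith
  have hfar' : ∀ i, R ≤ ‖n - J.e i‖ → ‖J.iterStep o w i - J.iterStep o w' i‖ ≤ D / 2 := by
    intro i hi
    have hio := h.ne_of_far hR0 hi
    rw [iterStep, iterStep, if_neg hio, if_neg hio]
    refine (norm_div_sub_div_le (half_pos hR0) (hw.le_shift_far h hR hi)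
      (hw'.le_shift_far h hR hi) (hoff i _ (hall _) (hall _))
      (J.norm_off_le w' i 1 (hw'.le_one _) (hw'.le_one _)) (hlam i)).trans ?_
    have e : 2 * J.bound * (16 * J.bound * D) / (R / 2) +
        2 * J.bound * 1 * (2 * J.bound * D) / (R / 2) ^ 2 =
        64 * (J.bound ^ 2 / R) * D + 16 * (J.bound ^ 2 / R) * D / R := by
      field_simp; ring
    rw [e]
    have h1 : 16 * (J.bound ^ 2 / R) * D / R ≤ 16 * (J.bound ^ 2 / R) * D :=
      div_le_self (by positivity) hR1
    -- The contributions `64 / 160` of the numerator and `16 / 160` of the denominator add up to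
    -- exactly `1 / 2`; this is what fixes the constant `160`.
    have h2 : J.bound ^ 2 / R * D ≤ 1 / 160 * D := by gcongr
    linarith
  refine ⟨fun i => ?_, hfar'⟩
  by_cases hio : i = o
  · simp only [iterStep, hio, if_true, sub_self, norm_zero]; positivity
  by_cases hi : R ≤ ‖n - J.e i‖
  · refine (hfar' i hi).trans ?_
    nlinarith
  · obtain ⟨hlr, hl, hr⟩ := h.nbr_notMem hR0 (not_le.1 hi)
    rw [iterStep, iterStep, if_neg hio, if_neg hio]
    refine (norm_div_sub_div_le one_half_pos (hw.le_shift h hR hio)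
      (hw'.le_shift h hR hio) (hoff i _ (hfar _ hlr.1) (hfar _ hlr.2))
      (J.norm_off_le w' i _ (hw'.far _ hlr.1) (hw'.far _ hlr.2)) (hlam i)).trans ?_
    have e : 2 * J.bound * D / (1 / 2) +
        2 * J.bound * (4 * J.bound / R) * (2 * J.bound * D) / (1 / 2) ^ 2 =
        4 * (J.bound * D) + 64 * (J.bound ^ 2 / R) * (J.bound * D) := by
      field_simp; ring
    rw [e]
    have h2 : J.bound ^ 2 / R * (J.bound * D) ≤ 1 / 160 * (J.bound * D) := by gcongr
    have h3 : 0 ≤ J.bound * D := by positivity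
    linarith

/-- The iteration starts from the unit vector at `o` and converges geometrically at every site. Away
from `o` the fixed-point equation is the eigenvalue equation; at `o` the latter holds by the choice
of `eigApprox`. -/
theorem Isolated.exists_eigen (h : J.Isolated {o} n R) (hR : 160 * J.bound ^ 2 ≤ R) :
    ∃ z w, J.IsEigen o z w ∧ ‖z - n‖ ≤ 8 * J.bound ^ 2 / R := by
  classical
  have hb := J.one_le_bound
  have hR0 : 0 < R := by nlinarith
  obtain ⟨x, hx0, hxs⟩ : ∃ x : ℕ → ι → ℂ, x 0 = Pi.single o 1 ∧
      ∀ k, x (k + 1) = J.iterStep o (x k) :=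
    ⟨fun k => (J.iterStep o)^[k] (Pi.single o 1), rfl, fun k => Function.iterate_succ_apply' _ _ _⟩
  have hreg : ∀ k, J.IterRegion o n R (x k) := by
    intro k
    induction k with
    | zero =>
      rw [hx0]
      refine ⟨by simp, fun i => ?_, fun i hi => ?_⟩
      · by_cases hio : i = o
        · subst hio; simp
        · simp [hio]
      · rw [Pi.single_eq_of_ne (h.ne_of_far hR0 hi), norm_zero]; positivity
    | succ k ih => rw [hxs]; exact ih.iterStep h hR
  have hdiff : ∀ k, (∀ i, ‖x (k + 1) i - x k i‖ ≤ 16 * J.bound * (1 / 2) ^ k) ∧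
      (∀ i, R ≤ ‖n - J.e i‖ → ‖x (k + 1) i - x k i‖ ≤ (1 / 2) ^ k) := by
    intro k
    induction k with
    | zero =>
      have h4 : 4 * J.bound / R ≤ 1 / 2 := by rw [div_le_iff₀ hR0]; nlinarith
      refine ⟨fun i => ?_, fun i hi => ?_⟩
      · refine (norm_sub_le _ _).trans ?_
        have h1 := (hreg 1).le_one i
        have h2 := (hreg 0).le_one i
        simp only [zero_add, pow_zero]; linarith
      · refine (norm_sub_le _ _).trans ?_
        have h1 := (hreg 1).far i hi
        have h2 := (hreg 0).far i hi
        simp only [zero_add, pow_zero]; linarith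
    | succ k ih =>
      have := iterStep_contract h hR (hreg (k + 1)) (hreg k) (by positivity) ih.1 ih.2
      rw [← hxs, ← hxs] at this
      simpa only [pow_succ, div_eq_mul_inv, one_mul] using this
  have hlim : ∀ i, ∃ l, Filter.Tendsto (fun k => x k i) Filter.atTop (nhds l) := by
    intro i
    refine cauchySeq_tendsto_of_complete
      (cauchySeq_of_le_geometric (1 / 2) (16 * J.bound) (by norm_num) fun k => ?_)
    rw [dist_comm, dist_eq_norm]; exact (hdiff k).1 i
  choose w hw using hlim
  have hregw : J.IterRegion o n R w := by
    refine ⟨tendsto_nhds_unique (hw o) ?_, fun i => ?_, fun i hi => ?_⟩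
    · simp only [(hreg _).one]; exact tendsto_const_nhds
    · exact le_of_tendsto' (hw i).norm fun k => (hreg k).le_one i
    · exact le_of_tendsto' (hw i).norm fun k => (hreg k).far i hi
  have hoff : ∀ i, Filter.Tendsto (fun k => J.c i * x k (J.r i) + J.d i * x k (J.l i))
      Filter.atTop (nhds (J.c i * w (J.r i) + J.d i * w (J.l i))) := fun i =>
    ((hw _).const_mul _).add ((hw _).const_mul _)
  have hfix : ∀ i ≠ o, w i = (J.c i * w (J.r i) + J.d i * w (J.l i)) /
      (J.eigApprox o w - J.e i) := by
    intro i hi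
    have h1 : Filter.Tendsto (fun k => x (k + 1) i) Filter.atTop (nhds (w i)) :=
      (hw i).comp (Filter.tendsto_add_atTop_nat 1)
    refine tendsto_nhds_unique h1 ?_
    simp only [hxs, iterStep, if_neg hi]
    refine (hoff i).div (((hoff o).const_add _).sub_const _) ?_
    have := hregw.le_shift h hR hi
    exact norm_pos_iff.1 (by linarith)
  refine ⟨J.eigApprox o w, w, ⟨⟨1, hregw.le_one⟩, hregw.one, fun i => ?_⟩,
    hregw.norm_eigApprox_sub h hR⟩
  by_cases hi : i = o
  · subst hi
    rw [act, hregw.one, eigApprox]; ring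
  · have h2 : J.eigApprox o w - J.e i ≠ 0 :=
      norm_pos_iff.1 (by have := hregw.le_shift h hR hi; linarith)
    have h1 := hfix i hi
    rw [eq_div_iff h2] at h1
    rw [act]; linear_combination -h1

end Chain

/-! ### Symmetric chains -/

/-- The sign `(-1)^k`. -/
def alt (k : ℤ) : ℂ := if Even k then 1 else -1

theorem alt_succ (k : ℤ) : alt (k + 1) = -alt k := by
  unfold alt; by_cases h : Even k <;> simp [h]

theorem alt_pred (k : ℤ) : alt (k - 1) = -alt k := by
  have := alt_succ (k - 1)
  rw [sub_add_cancel] at this; rw [this, neg_neg]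

theorem alt_neg (k : ℤ) : alt (-k) = alt k := by simp [alt]

theorem alt_sq (k : ℤ) : alt k * alt k = 1 := by unfold alt; split_ifs <;> simp

theorem norm_alt (k : ℤ) : ‖alt k‖ = 1 := by unfold alt; split_ifs <;> simp

theorem norm_sign {ε : ℂ} (hε : ε = 1 ∨ ε = -1) : ‖ε‖ = 1 := by rcases hε with rfl | rfl <;> simp

/-- The alternating link between the sites `k` and `k + 1`. -/
def link (σ τ : ℂ) (k : ℤ) : ℂ := if Even k then σ else τ

theorem norm_link_le (σ τ : ℂ) (k : ℤ) : ‖link σ τ k‖ ≤ ‖σ‖ + ‖τ‖ := by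
  unfold link; split_ifs <;> simp

/-- The reflection `k ↦ -1 - k` carries the link above `k` to the link below `-1 - k`, without
changing its type. -/
theorem link_reflect (σ τ : ℂ) (k : ℤ) : link σ τ (-1 - k - 1) = link σ τ k := by
  have : Even (-1 - k - 1) ↔ Even k := by
    rw [show -1 - k - 1 = -(k + 2) by ring]; simp [Int.even_add]
  simp only [link, this]

theorem norm_freq (p k : ℤ) : ‖(2 * k + p : ℂ)‖ = |2 * (k : ℝ) + p| := by
  rw [← Real.norm_eq_abs, ← Complex.norm_real]; push_cast; rfl

theorem natAbs_le_norm_freq (p k : ℤ) : (k.natAbs : ℝ) ≤ ‖(2 * k + p : ℂ)‖ + |(p : ℝ)| := by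
  rw [norm_freq]
  have h4 : (k.natAbs : ℝ) = |(k : ℝ)| := by rw [Nat.cast_natAbs, Int.cast_abs]
  have h5 : |2 * (k : ℝ)| ≤ |2 * (k : ℝ) + p| + |(p : ℝ)| := by
    have := abs_sub (2 * (k : ℝ) + p) p
    simpa using this
  rw [abs_mul, abs_two] at h5
  rw [h4]; linarith [abs_nonneg (k : ℝ)]

/-- The symmetric two-sided chain with alternating links. -/
noncomputable def symChain (ε : ℂ) (hε : ε = 1 ∨ ε = -1) (p : ℤ) (σ τ : ℂ) : Chain ℤ where
  e k := ε * alt k * (2 * k + p)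
  c k := link σ τ k
  d k := link σ τ (k - 1)
  l k := k - 1
  r k := k + 1
  ht := Int.natAbs
  bound := ‖σ‖ + ‖τ‖ + |(p : ℝ)| + 2
  one_le_bound := by have : 0 ≤ ‖σ‖ + ‖τ‖ + |(p : ℝ)| := by positivity
                     linarith
  norm_c_le k := (norm_link_le _ _ _).trans (by linarith [abs_nonneg (p : ℝ)])
  norm_d_le k := (norm_link_le _ _ _).trans (by linarith [abs_nonneg (p : ℝ)])
  ht_l k := by omega
  ht_r k := by omega
  e_le k := by
    rw [norm_mul, norm_mul, norm_sign hε, norm_alt, one_mul, one_mul]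
    refine (freq_norm_le p k).trans (mul_le_mul_of_nonneg_right ?_ (by positivity))
    linarith [norm_nonneg σ, norm_nonneg τ]
  le_e k := by
    rw [norm_mul, norm_mul, norm_sign hε, norm_alt, one_mul, one_mul]
    have := natAbs_le_norm_freq p k
    linarith [norm_nonneg σ, norm_nonneg τ]

/-- The symmetric one-sided chain with alternating links and a perturbed first diagonal entry. -/
noncomputable def halfChain (ε : ℂ) (hε : ε = 1 ∨ ε = -1) (σ τ δ : ℂ) : Chain ℕ where
  e k := ε * alt k * (2 * k + 1) + if k = 0 then δ else 0
  c k := link σ τ k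
  d k := if k = 0 then 0 else link σ τ (k - 1)
  -- Truncated subtraction makes site `0` its own left neighbour; the coefficient `d 0 = 0` removes
  -- this term.
  l k := k - 1
  r k := k + 1
  ht := id
  bound := ‖σ‖ + ‖τ‖ + ‖δ‖ + 3
  one_le_bound := by have : 0 ≤ ‖σ‖ + ‖τ‖ + ‖δ‖ := by positivity
                     linarith
  norm_c_le k := (norm_link_le _ _ _).trans (by linarith [norm_nonneg δ])
  norm_d_le k := by
    split_ifs
    · rw [norm_zero]; positivity
    · exact (norm_link_le _ _ _).trans (by linarith [norm_nonneg δ])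
  ht_l k := by dsimp only [id]; omega
  ht_r k := by dsimp only [id]; omega
  e_le k := by
    have h1 : ‖if k = 0 then δ else 0‖ ≤ ‖δ‖ := by split_ifs <;> simp
    have h2 := freq_norm_le 1 k
    have h3 : (1 : ℝ) ≤ 2 ^ k := one_le_pow₀ (by norm_num)
    refine (norm_add_le _ _).trans ?_
    rw [norm_mul, norm_mul, norm_sign hε, norm_alt, one_mul, one_mul]
    simp only [Int.cast_natCast, Int.cast_one, abs_one, Int.natAbs_natCast] at h2
    dsimp only [id]
    nlinarith [norm_nonneg σ, norm_nonneg τ, norm_nonneg δ]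
  le_e k := by
    have h1 : ‖if k = 0 then δ else 0‖ ≤ ‖δ‖ := by split_ifs <;> simp
    have h2 := natAbs_le_norm_freq 1 k
    have h3 := norm_sub_le (ε * alt k * (2 * k + 1) + if k = 0 then δ else 0)
      (if k = 0 then δ else 0)
    rw [add_sub_cancel_right, norm_mul, norm_mul, norm_sign hε, norm_alt, one_mul, one_mul] at h3
    simp only [Int.cast_natCast, Int.cast_one, abs_one, Int.natAbs_natCast] at h2
    dsimp only [id]
    linarith [norm_nonneg σ, norm_nonneg τ]

theorem symChain_act (ε : ℂ) (hε : ε = 1 ∨ ε = -1) (p : ℤ) (σ τ : ℂ) (w : ℤ → ℂ) (k : ℤ) :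
    (symChain ε hε p σ τ).act w k = ε * alt k * (2 * k + p) * w k + link σ τ k * w (k + 1) +
      link σ τ (k - 1) * w (k - 1) := rfl

theorem halfChain_act (ε : ℂ) (hε : ε = 1 ∨ ε = -1) (σ τ δ : ℂ) (w : ℕ → ℂ) (k : ℕ) :
    (halfChain ε hε σ τ δ).act w k = (ε * alt k * (2 * k + 1) + if k = 0 then δ else 0) * w k +
      link σ τ k * w (k + 1) + (if k = 0 then 0 else link σ τ (k - 1)) * w (k - 1) := rfl

theorem diracChain_act (a A b B : ℂ) (p : ℤ) (w : Bool × ℤ → ℂ) (s : Bool) (k : ℤ) :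
    (diracChain a A b B p).act w (s, k) = (if s then 1 else -1) * (2 * k + p) * w (s, k) +
      (if s then A else B) * w (!s, k + 1) + (if s then a else b) * w (!s, k - 1) := rfl

/-! ### Symmetrization -/

theorem norm_le_of_ratio_le {g : ℤ → ℂ} {G : ℝ} (h1 : ∀ k, ‖g (k + 1)‖ ≤ G * ‖g k‖)
    (h2 : ∀ k, ‖g k‖ ≤ G * ‖g (k + 1)‖) (hG : 0 ≤ G) (k : ℤ) :
    ‖g k‖ ≤ ‖g 0‖ * G ^ k.natAbs := by
  have hpos : ∀ j : ℕ, ‖g j‖ ≤ ‖g 0‖ * G ^ j := by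
    intro j
    induction j with
    | zero => simp
    | succ j ih =>
      have := h1 j
      push_cast
      rw [pow_succ]
      nlinarith
  have hneg : ∀ j : ℕ, ‖g (-j)‖ ≤ ‖g 0‖ * G ^ j := by
    intro j
    induction j with
    | zero => simp
    | succ j ih =>
      have := h2 (-(j + 1 : ℕ))
      rw [show -((j + 1 : ℕ) : ℤ) + 1 = -(j : ℤ) by push_cast; ring] at this
      rw [pow_succ]
      nlinarith
  rcases Int.natAbs_eq k with h | h
  · have := hpos k.natAbs; rwa [← h] at this
  · have := hneg k.natAbs; rwa [← h] at this

/-- The diagonal similarity that symmetrizes a tridiagonal matrix with alternating entries. -/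
theorem exists_gauge {A a B b σ τ : ℂ} (hA : A ≠ 0) (ha : a ≠ 0) (hB : B ≠ 0) (hb : b ≠ 0)
    (hσ : σ ^ 2 = A * b) (hτ : τ ^ 2 = a * B) :
    ∃ g : ℤ → ℂ, (∀ k, g k ≠ 0) ∧
      (∀ k, Even k → A * g (k + 1) = σ * g k ∧ a * g (k - 1) = τ * g k) ∧
      (∀ k, ¬Even k → B * g (k + 1) = τ * g k ∧ b * g (k - 1) = σ * g k) ∧
      ∃ (D : ℝ) (G : ℕ), 1 ≤ G ∧ (∀ k, ‖g k‖ ≤ D * (G : ℝ) ^ k.natAbs) ∧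
        ∀ k, ‖(g k)⁻¹‖ ≤ D * (G : ℝ) ^ k.natAbs := by
  have hσ0 : σ ≠ 0 := fun h => by rw [h] at hσ; simp [hA, hb] at hσ
  have hτ0 : τ ≠ 0 := fun h => by rw [h] at hτ; simp [ha, hB] at hτ
  -- The gauge gains `σ / A` across a link that starts at an even site and `τ / B` across one that
  -- starts at an odd site, hence `ρ` over each pair of links.
  obtain ⟨ρ, hρ⟩ : ∃ ρ, ρ = σ / A * (τ / B) := ⟨_, rfl⟩
  have hρ0 : ρ ≠ 0 := by rw [hρ]; positivity
  obtain ⟨g, hg⟩ : ∃ g : ℤ → ℂ, g = fun k => ρ ^ (k / 2) * if Even k then 1 else σ / A := ⟨_, rfl⟩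
  have hg0 : ∀ k, g k ≠ 0 := by
    intro k
    rw [hg]
    refine mul_ne_zero (zpow_ne_zero _ hρ0) ?_
    split_ifs
    · exact one_ne_zero
    · exact div_ne_zero hσ0 hA
  have heven : ∀ k, Even k → A * g (k + 1) = σ * g k := by
    intro k hk
    have h1 : ¬Even (k + 1) := by rwa [Int.even_add_one, not_not]
    have h2 : (k + 1) / 2 = k / 2 := by obtain ⟨j, rfl⟩ := hk; omega
    simp only [hg, hk, h1, h2, if_true, if_false]
    field_simp
  have hodd : ∀ k, ¬Even k → B * g (k + 1) = τ * g k := by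
    intro k hk
    have h1 : Even (k + 1) := by rwa [Int.even_add_one]
    have h2 : (k + 1) / 2 = k / 2 + 1 := by
      obtain ⟨j, rfl⟩ := Int.not_even_iff_odd.1 hk; omega
    simp only [hg, hk, h1, h2, if_true, if_false]
    rw [zpow_add₀ hρ0, zpow_one]
    nth_rewrite 2 [hρ]
    field_simp
  refine ⟨g, hg0, fun k hk => ⟨heven k hk, ?_⟩, fun k hk => ⟨hodd k hk, ?_⟩, ?_⟩
  -- The identity for the lower neighbour is the one for the upper neighbour at `k - 1`, because `τ
  -- ^ 2 = a * B`; similarly with `σ` below.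
  · have := hodd (k - 1) (by rwa [Int.even_sub_one, not_not])
    rw [sub_add_cancel] at this
    apply mul_left_cancel₀ hB
    linear_combination -τ * this - g (k - 1) * hτ
  · have := heven (k - 1) (by rwa [Int.even_sub_one])
    rw [sub_add_cancel] at this
    apply mul_left_cancel₀ hA
    linear_combination -σ * this - g (k - 1) * hσ
  · obtain ⟨G, hG⟩ := exists_nat_ge (‖σ / A‖ + ‖τ / B‖ + ‖A / σ‖ + ‖B / τ‖ + 1)
    have n1 := norm_nonneg (σ / A)
    have n2 := norm_nonneg (τ / B)
    have n3 := norm_nonneg (A / σ)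
    have n4 := norm_nonneg (B / τ)
    have hstep : ∀ k, ‖g (k + 1)‖ ≤ G * ‖g k‖ ∧ ‖g k‖ ≤ G * ‖g (k + 1)‖ := by
      intro k
      by_cases hk : Even k
      · have e1 : g (k + 1) = σ / A * g k := by
          have := heven k hk; field_simp; linear_combination this
        have e2 : g k = A / σ * g (k + 1) := by
          have := heven k hk; field_simp; linear_combination -this
        constructor
        · rw [e1, norm_mul]; gcongr; linarith
        · nth_rewrite 1 [e2]; rw [norm_mul]; gcongr; linarith
      · have e1 : g (k + 1) = τ / B * g k := by
          have := hodd k hk; field_simp; linear_combination this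
        have e2 : g k = B / τ * g (k + 1) := by
          have := hodd k hk; field_simp; linear_combination -this
        constructor
        · rw [e1, norm_mul]; gcongr; linarith
        · nth_rewrite 1 [e2]; rw [norm_mul]; gcongr; linarith
    have hG0 : (0 : ℝ) ≤ G := Nat.cast_nonneg G
    have hG1 : 1 ≤ G := by
      have : (1 : ℝ) ≤ G := by linarith
      exact_mod_cast this
    have hinv : ∀ k l, ‖g k‖ ≤ G * ‖g l‖ → ‖(g l)⁻¹‖ ≤ G * ‖(g k)⁻¹‖ := by
      intro k l h
      rw [norm_inv, norm_inv, ← div_eq_mul_inv, inv_eq_one_div,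
        div_le_div_iff₀ (norm_pos_iff.2 (hg0 l)) (norm_pos_iff.2 (hg0 k))]
      linarith
    refine ⟨‖g 0‖ + ‖(g 0)⁻¹‖, G, hG1, fun k => ?_, fun k => ?_⟩
    · refine (norm_le_of_ratio_le (fun k => (hstep k).1) (fun k => (hstep k).2) hG0 k).trans ?_
      gcongr; linarith [norm_nonneg (g 0)⁻¹]
    · refine (norm_le_of_ratio_le (g := fun k => (g k)⁻¹) (fun k => hinv _ _ (hstep k).2)
        (fun k => hinv _ _ (hstep k).1) hG0 k).trans ?_
      gcongr; linarith [norm_nonneg (g 0)]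

/-- The Dirac operator splits into two symmetric chains. -/
theorem rank_diracChain {a A b B σ τ : ℂ} (ha : a ≠ 0) (hA : A ≠ 0) (hb : b ≠ 0) (hB : B ≠ 0)
    (hσ : σ ^ 2 = A * b) (hτ : τ ^ 2 = a * B) (p : ℤ) (z : ℂ) :
    Module.rank ℂ ((diracChain a A b B p).op.maxGenEigenspace z) =
      Module.rank ℂ ((symChain 1 (Or.inl rfl) p σ τ).op.maxGenEigenspace z) +
      Module.rank ℂ ((symChain (-1) (Or.inr rfl) p τ σ).op.maxGenEigenspace z) := by
  obtain ⟨g, hg0, hge, hgo, D, G, hG, hgD, hgD'⟩ := exists_gauge hA ha hB hb hσ hτ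
  obtain ⟨g', hg0', hge', hgo', D', G', hG', hgD2, hgD2'⟩ := exists_gauge (σ := τ) (τ := σ) hB hb hA ha
    (by rw [hτ]; ring) (by rw [hσ]; ring)
  have hnn : ∀ (D : ℝ) (G : ℕ) (f : ℤ → ℂ) (s : Prop) [Decidable s] (k : ℤ),
      (∀ k, ‖f k‖ ≤ D * (G : ℝ) ^ k.natAbs) →
      ‖if s then f k else 0‖ ≤ D * (G : ℝ) ^ k.natAbs := by
    intro D G f s _ k hf
    split_ifs
    · exact hf k
    · rw [norm_zero]; exact (norm_nonneg _).trans (hf k)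
  rw [← rank_maxGenEigenspace_prodMap]
  -- The first chain runs through the sites whose component is the first one exactly at even `k`;
  -- the second chain runs through the others, so the two components, and with them `σ` and `τ`,
  -- change roles.
  let φ₁ : rapid (diracChain a A b B p).ht →ₗ[ℂ] rapid (symChain 1 (Or.inl rfl) p σ τ).ht :=
    rapid.weightedComp (fun k : ℤ => (decide (Even k), k)) (fun k => (g k)⁻¹)
      ⟨D, G, 0, hG, hgD', fun k => le_rfl⟩
  let φ₂ : rapid (diracChain a A b B p).ht →ₗ[ℂ] rapid (symChain (-1) (Or.inr rfl) p τ σ).ht :=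
    rapid.weightedComp (fun k : ℤ => (!decide (Even k), k)) (fun k => (g' k)⁻¹)
      ⟨D', G', 0, hG', hgD2', fun k => le_rfl⟩
  let ψ₁ : rapid (symChain 1 (Or.inl rfl) p σ τ).ht →ₗ[ℂ] rapid (diracChain a A b B p).ht :=
    rapid.weightedComp (fun s : Bool × ℤ => s.2)
      (fun s => if s.1 = decide (Even s.2) then g s.2 else 0)
      ⟨D, G, 0, hG, fun s => hnn D G g _ s.2 hgD, fun k => le_rfl⟩
  let ψ₂ : rapid (symChain (-1) (Or.inr rfl) p τ σ).ht →ₗ[ℂ] rapid (diracChain a A b B p).ht :=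
    rapid.weightedComp (fun s : Bool × ℤ => s.2)
      (fun s => if s.1 = !decide (Even s.2) then g' s.2 else 0)
      ⟨D', G', 0, hG', fun s => hnn D' G' g' _ s.2 hgD2, fun k => le_rfl⟩
  have f1 : ∀ w k, (φ₁ w).1 k = (g k)⁻¹ * w.1 (decide (Even k), k) := fun _ _ => rfl
  have f2 : ∀ w k, (φ₂ w).1 k = (g' k)⁻¹ * w.1 (!decide (Even k), k) := fun _ _ => rfl
  have f3 : ∀ u (s : Bool × ℤ), (ψ₁ u).1 s =
    (if s.1 = decide (Even s.2) then g s.2 else 0) * u.1 s.2 := fun _ _ => rfl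
  have f4 : ∀ u (s : Bool × ℤ), (ψ₂ u).1 s =
    (if s.1 = !decide (Even s.2) then g' s.2 else 0) * u.1 s.2 := fun _ _ => rfl
  let Φ : rapid (diracChain a A b B p).ht ≃ₗ[ℂ]
      rapid (symChain 1 (Or.inl rfl) p σ τ).ht × rapid (symChain (-1) (Or.inr rfl) p τ σ).ht :=
    LinearEquiv.ofLinearMap (φ₁.prod φ₂) (ψ₁.coprod ψ₂)
      (by
        refine LinearMap.ext fun u => Prod.ext (Subtype.ext (funext fun k => ?_))
          (Subtype.ext (funext fun k => ?_))
        · change (φ₁ (ψ₁ u.1 + ψ₂ u.2)).1 k = u.1.1 k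
          rw [f1]
          change (g k)⁻¹ * ((ψ₁ u.1).1 _ + (ψ₂ u.2).1 _) = _
          rw [f3, f4]
          simp [hg0 k]
        · change (φ₂ (ψ₁ u.1 + ψ₂ u.2)).1 k = u.2.1 k
          rw [f2]
          change (g' k)⁻¹ * ((ψ₁ u.1).1 _ + (ψ₂ u.2).1 _) = _
          rw [f3, f4]
          simp [hg0' k])
      (by
        refine LinearMap.ext fun w => Subtype.ext (funext fun s => ?_)
        change (ψ₁ (φ₁ w)).1 s + (ψ₂ (φ₂ w)).1 s = w.1 s
        rw [f3, f4, f1, f2]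
        obtain ⟨s, k⟩ := s
        by_cases hk : Even k <;> cases s <;> simp [hk, hg0 k, hg0' k])
  refine rank_maxGenEigenspace_conj Φ _ _ (fun w => ?_) z
  have hdiv : ∀ {x y c s : ℂ}, x ≠ 0 → y ≠ 0 → c * x = s * y → y⁻¹ * c = s * x⁻¹ := by
    intro x y c s hx hy h
    field_simp; linear_combination h
  refine Prod.ext (Subtype.ext (funext fun k => ?_)) (Subtype.ext (funext fun k => ?_))
  · change (φ₁ ((diracChain a A b B p).op w)).1 k =
      (symChain 1 (Or.inl rfl) p σ τ).act (φ₁ w).1 k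
    rw [f1, Chain.op_apply, diracChain_act, symChain_act, f1, f1, f1]
    simp only [link, alt]
    by_cases hk : Even k
    · have h1 := hdiv (hg0 _) (hg0 _) (hge k hk).1
      have h2 := hdiv (hg0 _) (hg0 _) (hge k hk).2
      simp only [hk, decide_true, if_true, Bool.not_true, Int.even_add_one, Int.even_sub_one,
        not_true, decide_false, if_false]
      linear_combination w.1 (false, k + 1) * h1 + w.1 (false, k - 1) * h2
    · have h1 := hdiv (hg0 _) (hg0 _) (hgo k hk).1
      have h2 := hdiv (hg0 _) (hg0 _) (hgo k hk).2
      simp only [hk, decide_true, if_true, Bool.not_false, Int.even_add_one, Int.even_sub_one,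
        not_false_eq_true, decide_false, if_false, Bool.false_eq_true]
      linear_combination w.1 (true, k + 1) * h1 + w.1 (true, k - 1) * h2
  · change (φ₂ ((diracChain a A b B p).op w)).1 k =
      (symChain (-1) (Or.inr rfl) p τ σ).act (φ₂ w).1 k
    rw [f2, Chain.op_apply, diracChain_act, symChain_act, f2, f2, f2]
    simp only [link, alt]
    by_cases hk : Even k
    · have h1 := hdiv (hg0' _) (hg0' _) (hge' k hk).1
      have h2 := hdiv (hg0' _) (hg0' _) (hge' k hk).2
      simp only [hk, decide_true, if_true, Bool.not_true, Int.even_add_one, Int.even_sub_one,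
        not_true, decide_false, if_false, Bool.not_false, Bool.false_eq_true]
      linear_combination w.1 (true, k + 1) * h1 + w.1 (true, k - 1) * h2
    · have h1 := hdiv (hg0' _) (hg0' _) (hgo' k hk).1
      have h2 := hdiv (hg0' _) (hg0' _) (hgo' k hk).2
      simp only [hk, decide_true, if_true, Bool.not_false, Int.even_add_one, Int.even_sub_one,
        not_false_eq_true, decide_false, if_false, Bool.not_true]
      linear_combination w.1 (false, k + 1) * h1 + w.1 (false, k - 1) * h2

/-- For even indices the two chains are reflections of each other. -/
theorem rank_symChain_reflect (σ τ z : ℂ) :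
    Module.rank ℂ ((symChain (-1) (Or.inr rfl) 0 τ σ).op.maxGenEigenspace z) =
      Module.rank ℂ ((symChain 1 (Or.inl rfl) 0 σ τ).op.maxGenEigenspace z) := by
  let φ : rapid (symChain (-1) (Or.inr rfl) 0 τ σ).ht →ₗ[ℂ]
      rapid (symChain 1 (Or.inl rfl) 0 σ τ).ht :=
    rapid.weightedComp (fun k : ℤ => -k) (fun _ => 1)
      ⟨1, 1, 0, le_rfl, by simp, fun k => (Int.natAbs_neg k).ge⟩
  let ψ : rapid (symChain 1 (Or.inl rfl) 0 σ τ).ht →ₗ[ℂ]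
      rapid (symChain (-1) (Or.inr rfl) 0 τ σ).ht :=
    rapid.weightedComp (fun k : ℤ => -k) (fun _ => 1)
      ⟨1, 1, 0, le_rfl, by simp, fun k => (Int.natAbs_neg k).ge⟩
  have f1 : ∀ w k, (φ w).1 k = 1 * w.1 (-k) := fun _ _ => rfl
  have f2 : ∀ w k, (ψ w).1 k = 1 * w.1 (-k) := fun _ _ => rfl
  let Φ : rapid (symChain (-1) (Or.inr rfl) 0 τ σ).ht ≃ₗ[ℂ]
      rapid (symChain 1 (Or.inl rfl) 0 σ τ).ht :=
    LinearEquiv.ofLinearMap φ ψ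
      (LinearMap.ext fun u => Subtype.ext (funext fun k => by
        change (φ (ψ u)).1 k = u.1 k
        rw [f1, f2, neg_neg, one_mul, one_mul]))
      (LinearMap.ext fun u => Subtype.ext (funext fun k => by
        change (ψ (φ u)).1 k = u.1 k
        rw [f2, f1, neg_neg, one_mul, one_mul]))
  refine rank_maxGenEigenspace_conj Φ _ _ (fun w => Subtype.ext (funext fun k => ?_)) z
  change (φ ((symChain (-1) (Or.inr rfl) 0 τ σ).op w)).1 k =
      (symChain 1 (Or.inl rfl) 0 σ τ).act (φ w).1 k
  -- Under `k ↦ -k` the diagonal changes sign, which turns `ε = -1` into `ε = 1`, and the lower end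
  -- of a link changes parity, which undoes the interchange of `σ` and `τ`.
  rw [f1, Chain.op_apply, symChain_act, symChain_act, f1, f1, f1]
  simp only [link, alt_neg, one_mul, even_neg, Int.even_sub_one]
  rw [show -(k + 1) = -k - 1 by ring, show -(k - 1) = -k + 1 by ring]
  push_cast
  by_cases hk : Even k
  · simp [hk]; ring
  · simp [hk]; ring

/-- For odd indices each chain splits into its symmetric and its antisymmetric part. -/
theorem rank_symChain_one (ε : ℂ) (hε : ε = 1 ∨ ε = -1) (σ τ z : ℂ) :
    Module.rank ℂ ((symChain ε hε 1 σ τ).op.maxGenEigenspace z) =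
      Module.rank ℂ ((halfChain ε hε σ τ τ).op.maxGenEigenspace z) +
      Module.rank ℂ ((halfChain ε hε σ τ (-τ)).op.maxGenEigenspace z) := by
  rw [← rank_maxGenEigenspace_prodMap]
  let pos : rapid (symChain ε hε 1 σ τ).ht →ₗ[ℂ] rapid (id : ℕ → ℕ) :=
    rapid.weightedComp (fun k : ℕ => (k : ℤ)) (fun _ => 1)
      ⟨1, 1, 0, le_rfl, by simp, fun k => le_rfl⟩
  let neg : rapid (symChain ε hε 1 σ τ).ht →ₗ[ℂ] rapid (id : ℕ → ℕ) :=
    rapid.weightedComp (fun k : ℕ => -1 - (k : ℤ)) (fun _ => 1)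
      ⟨1, 1, 0, le_rfl, by simp, fun k => by
        change k ≤ (-1 - (k : ℤ)).natAbs + 0; omega⟩
  let fold : ℤ → ℕ := fun k => if 0 ≤ k then k.natAbs else (-1 - k).natAbs
  have hfold : ∀ k : ℤ, (symChain ε hε 1 σ τ).ht k ≤ id (fold k) + 1 := by
    intro k
    change k.natAbs ≤ fold k + 1
    dsimp only [fold]; split_ifs <;> omega
  let ev : rapid (id : ℕ → ℕ) →ₗ[ℂ] rapid (symChain ε hε 1 σ τ).ht :=
    rapid.weightedComp fold (fun _ => 1 / 2) ⟨1, 1, 1, le_rfl, by norm_num, hfold⟩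
  let od : rapid (id : ℕ → ℕ) →ₗ[ℂ] rapid (symChain ε hε 1 σ τ).ht :=
    rapid.weightedComp fold (fun k => if 0 ≤ k then 1 / 2 else -(1 / 2))
      ⟨1, 1, 1, le_rfl, fun k => by split_ifs <;> norm_num, hfold⟩
  have f1 : ∀ w (k : ℕ), (pos w).1 k = 1 * w.1 (k : ℤ) := fun _ _ => rfl
  have f2 : ∀ w (k : ℕ), (neg w).1 k = 1 * w.1 (-1 - (k : ℤ)) := fun _ _ => rfl
  have f3 : ∀ u (k : ℤ), (ev u).1 k = 1 / 2 * u.1 (fold k) := fun _ _ => rfl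
  have f4 : ∀ u (k : ℤ), (od u).1 k = (if 0 ≤ k then 1 / 2 else -(1 / 2)) * u.1 (fold k) :=
    fun _ _ => rfl
  have fold1 : ∀ k : ℕ, fold k = k := fun k => by simp [fold]
  have fold2 : ∀ k : ℕ, fold (-1 - k) = k := fun k => by
    have : ¬(0 : ℤ) ≤ -1 - k := by omega
    simp only [fold, this, if_false]; omega
  have neg2 : ∀ k : ℕ, ¬(0 : ℤ) ≤ -1 - k := fun k => by omega
  let Φ : rapid (symChain ε hε 1 σ τ).ht ≃ₗ[ℂ]
      rapid (halfChain ε hε σ τ τ).ht × rapid (halfChain ε hε σ τ (-τ)).ht :=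
    LinearEquiv.ofLinearMap ((pos + neg).prod (pos - neg)) (ev.coprod od)
      (by
        refine LinearMap.ext fun u => Prod.ext (Subtype.ext (funext fun k => ?_))
          (Subtype.ext (funext fun k => ?_))
        · change (pos (ev u.1 + od u.2)).1 k + (neg (ev u.1 + od u.2)).1 k = u.1.1 k
          rw [f1, f2]
          change 1 * (1 / 2 * u.1.1 (fold k) + (if (0 : ℤ) ≤ k then 1 / 2 else -(1 / 2)) *
            u.2.1 (fold k)) + 1 * (1 / 2 * u.1.1 (fold (-1 - k)) +
            (if (0 : ℤ) ≤ -1 - k then 1 / 2 else -(1 / 2)) * u.2.1 (fold (-1 - k))) = _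
          rw [fold1, fold2, if_pos (Int.natCast_nonneg k), if_neg (neg2 k)]
          ring
        · change (pos (ev u.1 + od u.2)).1 k - (neg (ev u.1 + od u.2)).1 k = u.2.1 k
          rw [f1, f2]
          change 1 * (1 / 2 * u.1.1 (fold k) + (if (0 : ℤ) ≤ k then 1 / 2 else -(1 / 2)) *
            u.2.1 (fold k)) - 1 * (1 / 2 * u.1.1 (fold (-1 - k)) +
            (if (0 : ℤ) ≤ -1 - k then 1 / 2 else -(1 / 2)) * u.2.1 (fold (-1 - k))) = _
          rw [fold1, fold2, if_pos (Int.natCast_nonneg k), if_neg (neg2 k)]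
          ring)
      (by
        refine LinearMap.ext fun w => Subtype.ext (funext fun k => ?_)
        change (ev (pos w + neg w)).1 k + (od (pos w - neg w)).1 k = w.1 k
        rw [f3, f4]
        change 1 / 2 * ((pos w).1 _ + (neg w).1 _) + _ * ((pos w).1 _ - (neg w).1 _) = _
        rw [f1, f2]
        by_cases hk : 0 ≤ k
        · have : ((fold k : ℕ) : ℤ) = k := by simp only [fold, hk, if_true]; omega
          rw [if_pos hk, this]; ring
        · have : -1 - ((fold k : ℕ) : ℤ) = k := by simp only [fold, hk, if_false]; omega
          rw [if_neg hk, this]; ring)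
  -- For the combination `w k + κ * w (-1 - k)` the left neighbour `-1` of site `0` is the mirror
  -- image of `0` itself, so the link `τ` between them becomes the diagonal perturbation `κ * τ`.
  have hact : ∀ (w : rapid (symChain ε hε 1 σ τ).ht) (κ : ℂ), κ = 1 ∨ κ = -1 → ∀ k : ℕ,
      (symChain ε hε 1 σ τ).act w.1 k + κ * (symChain ε hε 1 σ τ).act w.1 (-1 - k) =
      (halfChain ε hε σ τ (κ * τ)).act
        (fun k : ℕ => w.1 (k : ℤ) + κ * w.1 (-1 - (k : ℤ))) k := by
    intro w κ hκ k
    have hκ2 : κ * κ = 1 := by rcases hκ with rfl | rfl <;> norm_num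
    have ha : alt (-1 - (k : ℤ)) = -alt k := by
      rw [show -1 - (k : ℤ) = -(k + 1) by ring, alt_neg, alt_succ]
    have hl := link_reflect σ τ k
    rw [symChain_act, symChain_act, halfChain_act, hl, ha]
    rcases k with _ | k
    · have h1 : link σ τ (-1) = τ := by simp [link]
      norm_num [h1, alt, link]
      linear_combination -w.1 (-1) * τ * hκ2
    · have h1 := link_reflect σ τ k
      rw [show -1 - (k : ℤ) - 1 = -1 - ((k + 1 : ℕ) : ℤ) by push_cast; ring] at h1
      have e1 : (-1 - ((k + 1 : ℕ) : ℤ) + 1) = -1 - (k : ℤ) := by push_cast; ring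
      have e2 : (-1 - ((k + 1 : ℕ) : ℤ) - 1) = -1 - ((k + 1 + 1 : ℕ) : ℤ) := by push_cast; ring
      have e3 : ((k + 1 : ℕ) : ℤ) - 1 = (k : ℤ) := by push_cast; ring
      have e4 : ((k + 1 : ℕ) : ℤ) + 1 = ((k + 1 + 1 : ℕ) : ℤ) := by push_cast; ring
      rw [h1, e1, e2, e3, e4, if_neg (Nat.succ_ne_zero k), if_neg (Nat.succ_ne_zero k),
        Nat.add_sub_cancel]
      push_cast
      ring
  refine rank_maxGenEigenspace_conj Φ _ _ (fun w => ?_) z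
  refine Prod.ext (Subtype.ext (funext fun k => ?_)) (Subtype.ext (funext fun k => ?_))
  · have h := hact w 1 (Or.inl rfl) k
    rw [one_mul, one_mul] at h
    have e : ∀ u, (pos u + neg u).1 = fun k : ℕ => u.1 (k : ℤ) + 1 * u.1 (-1 - (k : ℤ)) := by
      intro u; funext k
      change (pos u).1 k + (neg u).1 k = _
      rw [f1, f2, one_mul]
    change (pos _ + neg _).1 k = (halfChain ε hε σ τ τ).act (pos w + neg w).1 k
    rw [e, e, ← h, ← one_mul ((symChain ε hε 1 σ τ).act w.1 (-1 - k))]; rfl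
  · have h := hact w (-1) (Or.inr rfl) k
    rw [neg_one_mul τ] at h
    have e : ∀ u, (pos u - neg u).1 = fun k : ℕ => u.1 (k : ℤ) + -1 * u.1 (-1 - (k : ℤ)) := by
      intro u; funext k
      change (pos u).1 k - (neg u).1 k = _
      rw [f1, f2]; ring
    change (pos _ - neg _).1 k = (halfChain ε hε σ τ (-τ)).act (pos w - neg w).1 k
    rw [e, e, ← h]; rfl

/-! ### Isolated diagonal entries of the symmetric chains -/

theorem alt_eq_of_even {j m : ℤ} (h : Even (m + j)) : alt j = alt m := by
  have : Even j ↔ Even m := by rw [Int.even_add] at h; exact h.symm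
  simp only [alt, this]

theorem alt_eq_of_odd {j m : ℤ} (h : ¬Even (m + j)) : alt j = -alt m := by
  rw [Int.even_add] at h
  unfold alt
  by_cases h1 : Even m
  · have h2 : ¬Even j := fun h2 => h (iff_of_true h1 h2)
    rw [if_pos h1, if_neg h2]
  · have h2 : Even j := by
      by_contra h2
      exact h (iff_of_false h1 h2)
    rw [if_neg h1, if_pos h2, neg_neg]

theorem norm_sign_mul_int {ε : ℂ} (hε : ε = 1 ∨ ε = -1) (m j : ℤ) :
    ‖ε * alt m * (j : ℂ)‖ = ((|j| : ℤ) : ℝ) := by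
  rw [norm_mul, norm_mul, norm_sign hε, norm_alt, one_mul, one_mul, Complex.norm_intCast,
    Int.cast_abs]

/-- The distance between two diagonal entries of a symmetric chain. -/
theorem norm_diag_sub {ε : ℂ} (hε : ε = 1 ∨ ε = -1) (p m j : ℤ) :
    ‖ε * alt m * (2 * m + p) - ε * alt j * (2 * j + p)‖ =
      ((if Even (m + j) then |2 * (m - j)| else |2 * (m + j + p)| : ℤ) : ℝ) := by
  split_ifs with h
  · rw [alt_eq_of_even h, ← norm_sign_mul_int hε m]
    congr 1; push_cast; ring
  · rw [alt_eq_of_odd h, ← norm_sign_mul_int hε m]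
    congr 1; push_cast; ring

/-- Sites of the parity of `m` are at distance `2|m - j|`, the others at distance `2|m + j|`. If the
first is small then the second is large at the neighbours, and conversely. For opposite parity `m +
j` is odd, so the value at `m` is not repeated. -/
theorem isolated_symChain_zero (σ τ : ℂ) (m : ℤ) :
    (symChain 1 (Or.inl rfl) 0 σ τ).Isolated {m} (alt m * (2 * m)) |(m : ℝ)| := by
  have hd : ∀ j, ‖alt m * (2 * m) - (symChain 1 (Or.inl rfl) 0 σ τ).e j‖ =
      ((if Even (m + j) then |2 * (m - j)| else |2 * (m + j)| : ℤ) : ℝ) := by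
    intro j
    have := norm_diag_sub (ε := 1) (Or.inl rfl) 0 m j
    simpa [symChain] using this
  rw [← Int.cast_abs]
  refine ⟨fun j hj => ?_, fun j => ?_, fun j hj => ?_⟩
  · rw [hd]
    have hj' : j ≠ m := hj
    have h1 : (1 : ℤ) ≤ if Even (m + j) then |2 * (m - j)| else |2 * (m + j)| := by
      split_ifs with h
      · rw [le_abs]; omega
      · rw [le_abs]
        obtain ⟨k, hk⟩ := Int.not_even_iff_odd.1 h
        omega
    exact_mod_cast h1
  · change _ ∨ (_ ≤ ‖_ - (symChain 1 (Or.inl rfl) 0 σ τ).e (j - 1)‖ ∧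
      _ ≤ ‖_ - (symChain 1 (Or.inl rfl) 0 σ τ).e (j + 1)‖)
    rw [hd, hd, hd]
    by_cases h : Even (m + j)
    · have h1 : ¬Even (m + (j - 1)) := by
        rw [← add_sub_assoc, Int.even_sub_one, not_not]; exact h
      have h2 : ¬Even (m + (j + 1)) := by
        rw [← add_assoc, Int.even_add_one, not_not]; exact h
      rw [if_pos h, if_neg h1, if_neg h2]
      have : |m| ≤ |2 * (m - j)| ∨ (|m| ≤ |2 * (m + (j - 1))| ∧ |m| ≤ |2 * (m + (j + 1))|) := by
        simp only [abs_eq_max_neg]; omega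
      exact_mod_cast this
    · have h1 : Even (m + (j - 1)) := by
        rw [← add_sub_assoc, Int.even_sub_one]; exact h
      have h2 : Even (m + (j + 1)) := by
        rw [← add_assoc, Int.even_add_one]; exact h
      rw [if_neg h, if_pos h1, if_pos h2]
      have : |m| ≤ |2 * (m + j)| ∨ (|m| ≤ |2 * (m - (j - 1))| ∧ |m| ≤ |2 * (m - (j + 1))|) := by
        simp only [abs_eq_max_neg]; omega
      exact_mod_cast this
  · rw [Set.mem_singleton_iff.1 hj]; simp [symChain]

/-- The distances between the diagonal entries of a one-sided chain, up to the perturbation of the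
first one. -/
theorem norm_halfChain_sub {ε : ℂ} (hε : ε = 1 ∨ ε = -1) (σ τ δ : ℂ) (m j : ℕ) :
    ((if Even (m + j) then |2 * ((m : ℤ) - j)| else 2 * (m + j + 1) : ℤ) : ℝ) -
      (if j = 0 then ‖δ‖ else 0) ≤
      ‖ε * alt m * (2 * m + 1) - (halfChain ε hε σ τ δ).e j‖ := by
  have h1 := norm_diag_sub hε 1 m j
  have h2 : ‖if j = 0 then δ else 0‖ = if j = 0 then ‖δ‖ else 0 := by split_ifs <;> simp
  have h3 := norm_sub_norm_le (ε * alt m * (2 * m + 1) - ε * alt j * (2 * j + 1))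
    (if j = 0 then δ else 0)
  have h4 : ε * alt m * (2 * m + 1) - (halfChain ε hε σ τ δ).e j =
    ε * alt m * (2 * m + 1) - ε * alt j * (2 * j + 1) - if j = 0 then δ else 0 := by
    simp only [halfChain]; ring
  push_cast at h1
  rw [h4]
  refine le_trans (le_of_eq ?_) h3
  rw [h1, h2]
  have h5 : Even ((m : ℤ) + j) ↔ Even (m + j) := by
    rw [← Nat.cast_add, Int.even_coe_nat]
  have h6 : |2 * ((m : ℝ) + j + 1)| = 2 * (m + j + 1) := abs_of_nonneg (by positivity)
  simp only [h5]
  split_ifs <;> push_cast <;> simp [h6]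

/-- Around `-n` the two parity classes exchange their roles. -/
theorem norm_halfChain_sub_neg {ε : ℂ} (hε : ε = 1 ∨ ε = -1) (σ τ δ : ℂ) (m j : ℕ) :
    ((if Even (m + j) then 2 * (m + j + 1) else |2 * ((m : ℤ) - j)| : ℤ) : ℝ) -
      (if j = 0 then ‖δ‖ else 0) ≤
      ‖-(ε * alt m * (2 * m + 1)) - (halfChain ε hε σ τ δ).e j‖ := by
  have h2 : ‖if j = 0 then δ else 0‖ = if j = 0 then ‖δ‖ else 0 := by split_ifs <;> simp
  have h3 := norm_sub_norm_le (-(ε * alt m * (2 * m + 1)) - ε * alt j * (2 * j + 1))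
    (if j = 0 then δ else 0)
  have h4 : -(ε * alt m * (2 * m + 1)) - (halfChain ε hε σ τ δ).e j =
    -(ε * alt m * (2 * m + 1)) - ε * alt j * (2 * j + 1) - if j = 0 then δ else 0 := by
    simp only [halfChain]; ring
  have h5 : Even ((m : ℤ) + j) ↔ Even (m + j) := by
    rw [← Nat.cast_add, Int.even_coe_nat]
  rw [h4]
  refine le_trans (le_of_eq ?_) h3
  rw [h2]
  congr 1
  split_ifs with h
  · have := norm_sign_mul_int hε m (2 * (m + j + 1))
    rw [abs_of_nonneg (by positivity)] at this
    rw [← this, alt_eq_of_even (h5.2 h), ← norm_neg]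
    congr 1; push_cast; ring
  · rw [alt_eq_of_odd (fun h' => h (h5.1 h')), ← norm_sign_mul_int hε m, ← norm_neg]
    congr 1; push_cast; ring

/-- Only sites of the parity of `m` can be near `n`, and their neighbours have the other parity. The
condition on `m` keeps the perturbation `δ` from bringing the first entry close to `n`. -/
theorem isolated_halfChain {ε : ℂ} (hε : ε = 1 ∨ ε = -1) (σ τ δ : ℂ) (m : ℕ)
    (hm : ‖δ‖ + 1 ≤ m) :
    (halfChain ε hε σ τ δ).Isolated {m} (ε * alt m * (2 * m + 1)) m := by
  have hm1 : (1 : ℝ) ≤ m := by linarith [norm_nonneg δ]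
  have hm1' : 1 ≤ m := by exact_mod_cast hm1
  have hfar : ∀ j, ¬Even (m + j) →
      (m : ℝ) ≤ ‖ε * alt m * (2 * m + 1) - (halfChain ε hε σ τ δ).e j‖ := by
    intro j hj
    refine le_trans ?_ (norm_halfChain_sub hε σ τ δ m j)
    rw [if_neg hj]
    push_cast
    have : (0 : ℝ) ≤ j := Nat.cast_nonneg j
    split_ifs <;> linarith [norm_nonneg δ]
  -- Site `0` needs its own estimate: it carries `δ`, and its left neighbour is not of the other
  -- parity.
  have hzero : (m : ℝ) ≤ ‖ε * alt m * (2 * m + 1) - (halfChain ε hε σ τ δ).e 0‖ := by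
    by_cases h : Even (m + 0)
    · refine le_trans ?_ (norm_halfChain_sub hε σ τ δ m 0)
      rw [if_pos h, if_pos rfl]
      push_cast
      rw [abs_of_nonneg (by linarith)]
      linarith
    · exact hfar 0 h
  refine ⟨fun j hj => ?_, fun j => ?_, fun j hj => ?_⟩
  · by_cases h : Even (m + j)
    · rcases Nat.eq_zero_or_pos j with rfl | hj0
      · exact hm1.trans hzero
      · refine le_trans ?_ (norm_halfChain_sub hε σ τ δ m j)
        rw [if_pos h, if_neg hj0.ne', sub_zero]
        have hj' : j ≠ m := hj
        have : (1 : ℤ) ≤ |2 * ((m : ℤ) - j)| := by rw [le_abs]; omega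
        exact_mod_cast this
    · exact hm1.trans (hfar j h)
  · rcases Nat.eq_zero_or_pos j with rfl | hj0
    · exact Or.inl hzero
    · by_cases h : Even (m + j)
      · refine Or.inr ⟨hfar _ ?_, hfar _ ?_⟩
        · change ¬Even (m + (j - 1))
          rw [Nat.even_iff] at h ⊢; omega
        · change ¬Even (m + (j + 1))
          rw [Nat.even_iff] at h ⊢; omega
      · exact Or.inl (hfar j h)
  · rw [Set.mem_singleton_iff.1 hj]
    have : m ≠ 0 := by omega
    simp [halfChain, this]

/-- The unperturbed entries of the one-sided chain have pairwise different absolute values, so `-n`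
is missing: sites of the parity of `m` are far from it, and at the others `m - j` is odd. -/
theorem isolated_halfChain_neg {ε : ℂ} (hε : ε = 1 ∨ ε = -1) (σ τ δ : ℂ) (m : ℕ)
    (hm : ‖δ‖ + 1 ≤ m) :
    (halfChain ε hε σ τ δ).Isolated ∅ (-(ε * alt m * (2 * m + 1))) m := by
  have hm1 : (1 : ℝ) ≤ m := by linarith [norm_nonneg δ]
  have hfar : ∀ j, Even (m + j) →
      (m : ℝ) ≤ ‖-(ε * alt m * (2 * m + 1)) - (halfChain ε hε σ τ δ).e j‖ := by
    intro j hj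
    refine le_trans ?_ (norm_halfChain_sub_neg hε σ τ δ m j)
    rw [if_pos hj]
    push_cast
    have : (0 : ℝ) ≤ j := Nat.cast_nonneg j
    split_ifs <;> linarith [norm_nonneg δ]
  have hzero : (m : ℝ) ≤ ‖-(ε * alt m * (2 * m + 1)) - (halfChain ε hε σ τ δ).e 0‖ := by
    by_cases h : Even (m + 0)
    · exact hfar 0 h
    · refine le_trans ?_ (norm_halfChain_sub_neg hε σ τ δ m 0)
      rw [if_neg h, if_pos rfl]
      push_cast
      rw [abs_of_nonneg (by linarith)]
      linarith
  refine ⟨fun j _ => ?_, fun j => ?_, fun j hj => absurd hj (Set.notMem_empty j)⟩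
  · by_cases h : Even (m + j)
    · exact hm1.trans (hfar j h)
    · rcases Nat.eq_zero_or_pos j with rfl | hj0
      · exact hm1.trans hzero
      · refine le_trans ?_ (norm_halfChain_sub_neg hε σ τ δ m j)
        rw [if_neg h, if_neg hj0.ne', sub_zero]
        have : (1 : ℤ) ≤ |2 * ((m : ℤ) - j)| := by
          rw [Nat.even_iff] at h; rw [le_abs]; omega
        exact_mod_cast this
  · rcases Nat.eq_zero_or_pos j with rfl | hj0
    · exact Or.inl hzero
    · by_cases h : Even (m + j)
      · exact Or.inl (hfar j h)
      · refine Or.inr ⟨hfar _ ?_, hfar _ ?_⟩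
        · change Even (m + (j - 1))
          rw [Nat.even_iff] at h ⊢; omega
        · change Even (m + (j + 1))
          rw [Nat.even_iff] at h ⊢; omega

/-! ### Asymptotics of the eigenvalue -/

/-- The expansion of the eigenvalue from the equations at the five sites around the resonant
one. -/
theorem eigenvalue_expansion {n η μ x y w₁ w₂ w₃ v₁ v₂ v₃ : ℂ} {K : ℝ} (hη : η * η = 1)
    (hK : 1 ≤ K) (hn : 1 ≤ ‖n‖) (hx : ‖x‖ ≤ K) (hy : ‖y‖ ≤ K)
    (hw₁ : ‖w₁‖ ≤ K / ‖n‖) (hw₂ : ‖w₂‖ ≤ K / ‖n‖) (hv₁ : ‖v₁‖ ≤ K / ‖n‖) (hv₂ : ‖v₂‖ ≤ K / ‖n‖)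
    (hw₃ : ‖w₃‖ ≤ K / ‖n‖ ^ 2) (hv₃ : ‖v₃‖ ≤ K / ‖n‖ ^ 2)
    (e₀ : μ = x * w₁ + y * v₁) (e₁ : (μ + 2 * n + 2 * η) * w₁ = x + y * w₂)
    (e₂ : (μ - 4 * η) * w₂ = y * w₁ + x * w₃) (f₁ : (μ + 2 * n - 2 * η) * v₁ = y + x * v₂)
    (f₂ : (μ + 4 * η) * v₂ = x * v₁ + y * v₃) :
    ‖μ - ((x ^ 2 + y ^ 2) / (2 * n) + η * (y ^ 2 - x ^ 2) / (2 * n ^ 2))‖ ≤ 9 * K ^ 6 / ‖n‖ ^ 3 := by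
  have hn0 : n ≠ 0 := norm_pos_iff.1 (by linarith)
  have hηn : ‖η‖ = 1 := by
    have h := congrArg norm hη
    rw [norm_mul, norm_one] at h
    nlinarith [norm_nonneg η]
  obtain ⟨r, hr⟩ : ∃ r, r = ‖n‖⁻¹ := ⟨_, rfl⟩
  have hr0 : 0 ≤ r := by rw [hr]; positivity
  have hr1 : r ≤ 1 := by rw [hr]; exact inv_le_one_of_one_le₀ hn
  have hrn : r * ‖n‖ = 1 := by rw [hr]; exact inv_mul_cancel₀ (by linarith)
  rw [div_eq_mul_inv, ← hr] at hw₁ hw₂ hv₁ hv₂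
  rw [div_eq_mul_inv, ← inv_pow, ← hr] at hw₃ hv₃
  have hK0 : 0 ≤ K := by linarith
  have hmul : ∀ {p q : ℂ} {P Q : ℝ}, ‖p‖ ≤ P → ‖q‖ ≤ Q → ‖p * q‖ ≤ P * Q := by
    intro p q P Q hp hq
    rw [norm_mul]; exact mul_le_mul hp hq (norm_nonneg _) ((norm_nonneg _).trans hp)
  have hadd : ∀ {p q : ℂ} {P Q : ℝ}, ‖p‖ ≤ P → ‖q‖ ≤ Q → ‖p + q‖ ≤ P + Q := fun hp hq =>
    (norm_add_le _ _).trans (add_le_add hp hq)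
  have hsub : ∀ {p q : ℂ} {P Q : ℝ}, ‖p‖ ≤ P → ‖q‖ ≤ Q → ‖p - q‖ ≤ P + Q := fun hp hq =>
    (norm_sub_le _ _).trans (add_le_add hp hq)
  have hp1 : K ≤ K ^ 2 := by nlinarith
  have hp2 : K ^ 2 ≤ K ^ 3 := by nlinarith [sq_nonneg K]
  have hp3 : K ^ 3 ≤ K ^ 4 := by
    have : (0 : ℝ) ≤ K ^ 3 := by positivity
    nlinarith
  have hp4 : K ^ 4 ≤ K ^ 6 := pow_le_pow_right₀ hK (by norm_num)
  have hμ : ‖μ‖ ≤ 2 * K ^ 2 * r := by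
    rw [e₀]; exact (hadd (hmul hx hw₁) (hmul hy hv₁)).trans (by linarith)
  have hμ' : ‖μ‖ ≤ 2 * K ^ 2 := hμ.trans (by nlinarith [sq_nonneg K])
  have h2η : ‖2 * η‖ = 2 := by rw [norm_mul, hηn]; norm_num
  have hμp : ‖μ + 2 * η‖ ≤ 2 * K ^ 2 + 2 := hadd hμ' h2η.le
  have hμm : ‖μ - 2 * η‖ ≤ 2 * K ^ 2 + 2 := hsub hμ' h2η.le
  -- `E` is the error in `2n(x w₁ - y v₁) = x² - y² + E`; this difference carries the term of order
  -- `n⁻²` of the eigenvalue.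
  obtain ⟨E, hE⟩ : ∃ E, E = x * y * (w₂ - v₂) - x * w₁ * (μ + 2 * η) + y * v₁ * (μ - 2 * η) :=
    ⟨_, rfl⟩
  have hEb : ‖E‖ ≤ 10 * K ^ 4 * r := by
    rw [hE]
    refine (hadd (hsub (hmul (hmul hx hy) (hsub hw₂ hv₂)) (hmul (hmul hx hw₁) hμp))
      (hmul (hmul hy hv₁) hμm)).trans ?_
    have e : K * K * (K * r + K * r) + K * (K * r) * (2 * K ^ 2 + 2) +
      K * (K * r) * (2 * K ^ 2 + 2) = (2 * K ^ 3 + 4 * K ^ 2 + 4 * K ^ 4) * r := by ring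
    rw [e]; exact mul_le_mul_of_nonneg_right (by linarith) hr0
  -- In `y e₁ - x f₁` the constant terms `x y` cancel. Hence `y w₁ - x v₁ = F / (2n)` is one order
  -- smaller than its summands.
  obtain ⟨F, hF⟩ : ∃ F, F = y ^ 2 * w₂ - x ^ 2 * v₂ - y * w₁ * (μ + 2 * η) + x * v₁ * (μ - 2 * η) :=
    ⟨_, rfl⟩
  have hFb : ‖F‖ ≤ 10 * K ^ 4 * r := by
    rw [hF]
    have hx2 : ‖x ^ 2‖ ≤ K ^ 2 := by rw [norm_pow]; gcongr
    have hy2 : ‖y ^ 2‖ ≤ K ^ 2 := by rw [norm_pow]; gcongr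
    refine (hadd (hsub (hsub (hmul hy2 hw₂) (hmul hx2 hv₂)) (hmul (hmul hy hw₁) hμp))
      (hmul (hmul hx hv₁) hμm)).trans ?_
    have e : K ^ 2 * (K * r) + K ^ 2 * (K * r) + K * (K * r) * (2 * K ^ 2 + 2) +
      K * (K * r) * (2 * K ^ 2 + 2) = (2 * K ^ 3 + 4 * K ^ 2 + 4 * K ^ 4) * r := by ring
    rw [e]; exact mul_le_mul_of_nonneg_right (by linarith) hr0
  have hninv : ‖n⁻¹‖ = r := by rw [norm_inv, hr]
  have hG : y * w₁ - x * v₁ = n⁻¹ * F / 2 := by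
    rw [hF]; field_simp; linear_combination y * e₁ - x * f₁
  have hGb : ‖y * w₁ - x * v₁‖ ≤ 5 * K ^ 4 * r ^ 2 := by
    rw [hG, norm_div, norm_mul, hninv, RCLike.norm_ofNat]
    nlinarith
  -- The diagonal entries at `m ± 2` lie symmetrically about `n`, so `w₂` and `v₂` cancel to leading
  -- order and their sum is `O(n⁻²)`.
  have hwv : w₂ + v₂ = η * (μ * (w₂ - v₂) - (y * w₁ - x * v₁) - x * w₃ + y * v₃) / 4 := by
    have : 4 * (w₂ + v₂) = η * (μ * (w₂ - v₂) - (y * w₁ - x * v₁) - x * w₃ + y * v₃) := by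
      linear_combination -η * e₂ + η * f₂ - 4 * (w₂ + v₂) * hη
    linear_combination this / 4
  have hwvb : ‖w₂ + v₂‖ ≤ 3 * K ^ 4 * r ^ 2 := by
    rw [hwv, norm_div, norm_mul, hηn, one_mul, RCLike.norm_ofNat]
    have h := hadd (hsub (hsub (hmul hμ (hsub hw₂ hv₂)) hGb) (hmul hx hw₃)) (hmul hy hv₃)
    have e : 2 * K ^ 2 * r * (K * r + K * r) + 5 * K ^ 4 * r ^ 2 + K * (K * r ^ 2) +
      K * (K * r ^ 2) = (4 * K ^ 3 + 5 * K ^ 4 + 2 * K ^ 2) * r ^ 2 := by ring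
    rw [e] at h
    have h2 : (4 * K ^ 3 + 5 * K ^ 4 + 2 * K ^ 2) * r ^ 2 ≤ 12 * K ^ 4 * r ^ 2 :=
      mul_le_mul_of_nonneg_right (by linarith) (by positivity)
    linarith
  have hmain : μ - ((x ^ 2 + y ^ 2) / (2 * n) + η * (y ^ 2 - x ^ 2) / (2 * n ^ 2)) =
      n⁻¹ * (x * y * (w₂ + v₂) - μ * μ - η * n⁻¹ * E) / 2 := by
    -- The last term stems from the opposite corrections `±2η` at the two adjacent sites and, by
    -- `h2`, produces the term in `y² - x²`.
    have h1 : 2 * n * μ = x ^ 2 + y ^ 2 + x * y * (w₂ + v₂) - μ * μ - 2 * η * (x * w₁ - y * v₁) := by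
      linear_combination x * e₁ + y * f₁ + (2 * n + μ) * e₀
    have h2 : 2 * n * (x * w₁ - y * v₁) = x ^ 2 - y ^ 2 + E := by
      rw [hE]; linear_combination x * e₁ - y * f₁
    field_simp
    linear_combination n * h1 - η * h2
  rw [hmain, norm_div, norm_mul, hninv, RCLike.norm_ofNat]
  have h := hsub (hsub (hmul (hmul hx hy) hwvb) (hmul hμ hμ)) (hmul (hmul hηn.le hninv.le) hEb)
  have e : K * K * (3 * K ^ 4 * r ^ 2) + 2 * K ^ 2 * r * (2 * K ^ 2 * r) +
    1 * r * (10 * K ^ 4 * r) = (3 * K ^ 6 + 14 * K ^ 4) * r ^ 2 := by ring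
  rw [e] at h
  have h2 : (3 * K ^ 6 + 14 * K ^ 4) * r ^ 2 ≤ 18 * K ^ 6 * r ^ 2 :=
    mul_le_mul_of_nonneg_right (by linarith) (by positivity)
  have h3 := mul_le_mul_of_nonneg_left (h.trans h2) hr0
  have e2 : 9 * K ^ 6 / ‖n‖ ^ 3 = 9 * K ^ 6 * r ^ 3 := by
    rw [hr]; field_simp
  rw [e2]
  linarith

/-- The two links at any site are `σ` and `τ` in some order, so symmetric expressions in them do not
depend on the site. -/
theorem link_sq_add (σ τ : ℂ) (m : ℤ) :
    link σ τ m ^ 2 + link σ τ (m - 1) ^ 2 = σ ^ 2 + τ ^ 2 := by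
  unfold link
  by_cases h : Even m
  · simp [h]
  · have h' : Odd m := Int.not_even_iff_odd.1 h
    simp [h, h', add_comm]

/-- Moving to the next site exchanges the two links and changes the sign, so the product is
constant. This makes the coefficient of `n⁻²` independent of `m`. -/
theorem alt_mul_link_sq_sub (σ τ : ℂ) (m : ℤ) :
    alt m * (link σ τ (m - 1) ^ 2 - link σ τ m ^ 2) = τ ^ 2 - σ ^ 2 := by
  unfold link alt
  by_cases h : Even m
  · simp [h]
  · simp [h]

theorem link_succ_succ (σ τ : ℂ) (m : ℤ) : link σ τ (m + 1) = link σ τ (m - 1) := by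
  unfold link; simp [parity_simps]

theorem link_add_two (σ τ : ℂ) (m : ℤ) : link σ τ (m + 2) = link σ τ m := by
  unfold link; simp

theorem link_sub_two (σ τ : ℂ) (m : ℤ) : link σ τ (m - 2) = link σ τ m := by
  unfold link; simp

/-- The eigenvalue near a resonant site in the interior of a chain, up to `O(|n|⁻³)`. -/
theorem eigenvalue_asymptotics {ε : ℂ} (hε : ε = 1 ∨ ε = -1) (p : ℤ) (σ τ : ℂ) (m : ℤ) {z n : ℂ}
    {w : ℤ → ℂ} {K : ℝ} (hK : 1 ≤ K) (hn : n = ε * alt m * (2 * m + p)) (hn8 : 8 ≤ ‖n‖)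
    (hz : ‖z - n‖ ≤ 1 / 2) (hσ : ‖σ‖ ≤ K) (hτ : ‖τ‖ ≤ K)
    (hw : ∀ k, |k - m| ≤ 4 → k ≠ m → ‖w k‖ ≤ K / ‖n‖) (hm : w m = 1)
    (heq : ∀ k, |k - m| ≤ 3 → z * w k = ε * alt k * (2 * k + p) * w k +
      link σ τ k * w (k + 1) + link σ τ (k - 1) * w (k - 1)) :
    ‖z - (n + (σ ^ 2 + τ ^ 2) / (2 * n) + ε * (τ ^ 2 - σ ^ 2) / (2 * n ^ 2))‖ ≤
      9 * (2 * K ^ 2) ^ 6 / ‖n‖ ^ 3 := by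
  have hlink : ∀ k, ‖link σ τ k‖ ≤ K := fun k => by unfold link; split_ifs <;> assumption
  have hη : (ε * alt m) * (ε * alt m) = 1 := by
    have h1 := alt_sq m
    have h2 : ε * ε = 1 := by rcases hε with rfl | rfl <;> norm_num
    linear_combination ε * ε * h1 + h2
  have hηn : ‖ε * alt m‖ = 1 := by rw [norm_mul, norm_sign hε, norm_alt, one_mul]
  obtain ⟨η, hηd⟩ : ∃ η, η = ε * alt m := ⟨_, rfl⟩
  rw [← hηd] at hη hηn hn
  have hn0 : 0 < ‖n‖ := by linarith
  have hab : ∀ c d : ℤ, |c| ≤ d ↔ -d ≤ c ∧ c ≤ d := fun c d => abs_le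
  have q0 := heq m (by simp)
  have q1 := heq (m + 1) (by rw [hab]; omega)
  have q2 := heq (m + 2) (by rw [hab]; omega)
  have q3 := heq (m + 3) (by rw [hab]; omega)
  have r1 := heq (m - 1) (by rw [hab]; omega)
  have r2 := heq (m - 2) (by rw [hab]; omega)
  have r3 := heq (m - 3) (by rw [hab]; omega)
  have a1 : alt (m + 1) = -alt m := alt_succ m
  have a2 : alt (m + 2) = alt m := by
    rw [show m + 2 = m + 1 + 1 by ring, alt_succ, alt_succ, neg_neg]
  have a3 : alt (m + 3) = -alt m := by rw [show m + 3 = m + 2 + 1 by ring, alt_succ, a2]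
  have c1 : alt (m - 1) = -alt m := alt_pred m
  have c2 : alt (m - 2) = alt m := by
    rw [show m - 2 = m - 1 - 1 by ring, alt_pred, alt_pred, neg_neg]
  have c3 : alt (m - 3) = -alt m := by rw [show m - 3 = m - 2 - 1 by ring, alt_pred, c2]
  rw [a1, show m + 1 + 1 = m + 2 by ring, show m + 1 - 1 = m by ring, link_succ_succ] at q1
  rw [a2, show m + 2 + 1 = m + 3 by ring, show m + 2 - 1 = m + 1 by ring, link_add_two,
    link_succ_succ] at q2
  rw [a3, show m + 3 + 1 = m + 4 by ring, show m + 3 - 1 = m + 2 by ring, link_add_two] at q3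
  rw [c1, show m - 1 + 1 = m by ring, show m - 1 - 1 = m - 2 by ring, link_sub_two] at r1
  rw [c2, show m - 2 + 1 = m - 1 by ring, show m - 2 - 1 = m - 3 by ring,
    show m - 3 = m - 1 - 2 by ring, link_sub_two, link_sub_two,
    show m - 1 - 2 = m - 3 by ring] at r2
  rw [c3, show m - 3 + 1 = m - 2 by ring, show m - 3 - 1 = m - 4 by ring] at r3
  rw [hm] at q0 q1 r1
  push_cast at q0 q1 q2 q3 r1 r2 r3
  have hw₁ := hw (m + 1) (by rw [hab]; omega) (by omega)
  have hw₂ := hw (m + 2) (by rw [hab]; omega) (by omega)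
  have hw₄ := hw (m + 4) (by rw [hab]; omega) (by omega)
  have hv₁ := hw (m - 1) (by rw [hab]; omega) (by omega)
  have hv₂ := hw (m - 2) (by rw [hab]; omega) (by omega)
  have hv₄ := hw (m - 4) (by rw [hab]; omega) (by omega)
  -- The entries at `m ± 3` are `-n ∓ 6η`, so the equation is divided by `z + n ± 6η`, which is at
  -- least `‖n‖` in absolute value once `‖n‖ ≥ 8`. Values of order `1 / ‖n‖` at the neighbours then
  -- give `O(‖n‖⁻²)`.
  have hfar : ∀ (u x y s t : ℂ) (c : ℂ), ‖c‖ ≤ 6 → ‖s‖ ≤ K → ‖t‖ ≤ K → ‖x‖ ≤ K / ‖n‖ →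
      ‖y‖ ≤ K / ‖n‖ → (z - n + 2 * n + c) * u = s * x + t * y → ‖u‖ ≤ 2 * K ^ 2 / ‖n‖ ^ 2 := by
    intro u x y s t c hc hs ht hx hy h
    have h1 : ‖n‖ ≤ ‖z - n + 2 * n + c‖ := by
      have h2 : 2 * n = (z - n + 2 * n + c) - (z - n) - c := by ring
      have h3 : ‖2 * n‖ ≤ ‖z - n + 2 * n + c‖ + ‖z - n‖ + ‖c‖ := by
        nth_rewrite 1 [h2]
        exact (norm_sub_le _ _).trans (by gcongr; exact norm_sub_le _ _)
      rw [norm_mul, RCLike.norm_ofNat] at h3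
      linarith
    have h4 : ‖n‖ * ‖u‖ ≤ K * (K / ‖n‖) + K * (K / ‖n‖) := by
      refine (mul_le_mul_of_nonneg_right h1 (norm_nonneg u)).trans ?_
      rw [← norm_mul, h]
      refine (norm_add_le _ _).trans (add_le_add ?_ ?_) <;> rw [norm_mul] <;> gcongr
    rw [le_div_iff₀ (by positivity)]
    have h5 : K * (K / ‖n‖) + K * (K / ‖n‖) = 2 * K ^ 2 / ‖n‖ := by ring
    rw [h5, le_div_iff₀ hn0] at h4
    linarith
  have hKK : K ≤ 2 * K ^ 2 := by nlinarith
  have hKn : K / ‖n‖ ≤ 2 * K ^ 2 / ‖n‖ := by gcongr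
  have h6 : ‖6 * η‖ ≤ 6 := by rw [norm_mul, hηn]; norm_num
  have h6' : ‖-(6 * η)‖ ≤ 6 := by rw [norm_neg]; exact h6
  have hw₃ := hfar (w (m + 3)) (w (m + 4)) (w (m + 2)) (link σ τ (m + 3)) (link σ τ m) (6 * η) h6
    (hlink _) (hlink _) hw₄ hw₂ (by
      rw [hn, hηd] at *; linear_combination q3)
  have hv₃ := hfar (w (m - 3)) (w (m - 2)) (w (m - 4)) (link σ τ (m - 3)) (link σ τ (m - 4))
    (-(6 * η)) h6' (hlink _) (hlink _) hv₂ hv₄ (by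
      rw [hn, hηd] at *; linear_combination r3)
  have hmain := eigenvalue_expansion (n := n) (η := η) (μ := z - n) (x := link σ τ m)
    (y := link σ τ (m - 1)) hη (by linarith) (by linarith) ((hlink _).trans hKK)
    ((hlink _).trans hKK) (hw₁.trans hKn) (hw₂.trans hKn) (hv₁.trans hKn) (hv₂.trans hKn) hw₃ hv₃
    (by rw [hn, hηd]; linear_combination q0) (by rw [hn, hηd]; linear_combination q1)
    (by rw [hn, hηd]; linear_combination q2) (by rw [hn, hηd]; linear_combination r1)
    (by rw [hn, hηd]; linear_combination r2)
  refine le_trans (le_of_eq ?_) hmain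
  have h7 := link_sq_add σ τ m
  have h8 := alt_mul_link_sq_sub σ τ m
  rw [h7, hηd, mul_assoc ε, h8]
  congr 1; ring

/-! ### Eigenvalues of the symmetric chains -/

theorem norm_center {ε : ℂ} (hε : ε = 1 ∨ ε = -1) (m : ℕ) :
    ‖ε * alt m * (2 * m + 1)‖ = 2 * m + 1 := by
  have := norm_sign_mul_int hε m (2 * m + 1)
  rw [abs_of_nonneg (by positivity)] at this
  push_cast at this
  exact this

theorem norm_center_zero (m : ℤ) : ‖alt m * (2 * m)‖ = 2 * |(m : ℝ)| := by
  have := norm_sign_mul_int (Or.inl rfl) m (2 * m)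
  rw [abs_mul] at this
  push_cast at this
  simpa using this

theorem exists_eigenvalue_symChain_zero (σ τ : ℂ) : ∃ (K : ℝ) (N : ℕ), ∀ m : ℤ, (N : ℤ) ≤ |m| →
    ∃ l : ℂ, ‖l - alt m * (2 * m)‖ < 1 / 2 ∧
      (∀ z, ‖z - alt m * (2 * m)‖ ≤ 1 / 2 →
        Module.rank ℂ ((symChain 1 (Or.inl rfl) 0 σ τ).op.maxGenEigenspace z) =
          if z = l then 1 else 0) ∧
      ‖l - (alt m * (2 * m) + (σ ^ 2 + τ ^ 2) / (2 * (alt m * (2 * m))) +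
        (τ ^ 2 - σ ^ 2) / (2 * (alt m * (2 * m)) ^ 2))‖ ≤ K / ‖alt m * (2 * m : ℂ)‖ ^ 3 := by
  obtain ⟨b, hb⟩ : ∃ b, b = (symChain 1 (Or.inl rfl) 0 σ τ).bound := ⟨_, rfl⟩
  have hb1 : 1 ≤ b := by rw [hb]; exact Chain.one_le_bound _
  obtain ⟨N, hN⟩ := exists_nat_ge (160 * b ^ 2)
  -- The a priori bound is `40 * b ^ 2 / |m|`; the factor `3` in `120` converts `|m|` into `‖n‖`,
  -- which is `2|m|` here and `2m + 1 ≤ 3m` for the one-sided chains.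
  refine ⟨9 * (2 * (120 * b ^ 2) ^ 2) ^ 6, N, fun m hm => ?_⟩
  have hR : 160 * b ^ 2 ≤ |(m : ℝ)| := hN.trans (by rw [← Int.cast_abs]; exact_mod_cast hm)
  have hm160 : 160 ≤ |(m : ℝ)| := by nlinarith
  have hm0 : 0 < |(m : ℝ)| := by linarith
  have hiso := isolated_symChain_zero σ τ m
  rw [hb] at hR
  obtain ⟨l, w, hw, hl⟩ := hiso.exists_eigen hR
  rw [← hb] at hl
  have hl' : ‖l - alt m * (2 * m)‖ ≤ 1 / 20 := by
    refine hl.trans ?_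
    rw [div_le_iff₀ hm0]; rw [← hb] at hR; linarith
  have hl2 : ‖l - alt m * (2 * m)‖ ≤ 1 / 2 := by linarith
  refine ⟨l, by linarith, fun z hz => hw.rank hiso hR hl2 hz, ?_⟩
  have hest := hw.estimate hiso (by nlinarith [sq_nonneg (symChain 1 (Or.inl rfl) 0 σ τ).bound]) hl2
  have hn := norm_center_zero m
  have hbd : b = ‖σ‖ + ‖τ‖ + |((0 : ℤ) : ℝ)| + 2 := hb
  rw [Int.cast_zero, abs_zero, add_zero] at hbd
  have h120 : b ≤ 120 * b ^ 2 := by nlinarith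
  have := eigenvalue_asymptotics (Or.inl rfl) 0 σ τ m (z := l) (n := alt m * (2 * m)) (w := w)
    (K := 120 * b ^ 2) (by linarith) (by push_cast; ring) (by rw [hn]; linarith) hl2
    (by linarith [norm_nonneg τ]) (by linarith [norm_nonneg σ])
    (fun k _ hk => (hest.1 k hk).trans (by
      rw [hn, ← hb, div_le_div_iff₀ hm0 (by linarith)]
      have : 0 ≤ b ^ 2 * |(m : ℝ)| := by positivity
      linarith)) hw.one
    (fun k _ => by rw [← hw.eq k, symChain_act])
  simpa using this

section HalfChain

variable {ε : ℂ} {hε : ε = 1 ∨ ε = -1} {σ τ δ : ℂ} {m : ℕ} {z : ℂ} {w : ℕ → ℂ}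

theorem halfChain_eigenvalue_asymptotics {b : ℝ} (hb : b = (halfChain ε hε σ τ δ).bound)
    (hm : 160 * b ^ 2 ≤ m) (hw : (halfChain ε hε σ τ δ).IsEigen m z w)
    (hz : ‖z - ε * alt m * (2 * m + 1)‖ ≤ 1 / 2) :
    ‖z - (ε * alt m * (2 * m + 1) + (σ ^ 2 + τ ^ 2) / (2 * (ε * alt m * (2 * m + 1))) +
      ε * (τ ^ 2 - σ ^ 2) / (2 * (ε * alt m * (2 * m + 1)) ^ 2))‖ ≤
      9 * (2 * (120 * b ^ 2) ^ 2) ^ 6 / ‖ε * alt m * (2 * m + 1 : ℂ)‖ ^ 3 := by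
  have hb1 : 1 ≤ b := by rw [hb]; exact Chain.one_le_bound _
  have hbd : b = ‖σ‖ + ‖τ‖ + ‖δ‖ + 3 := hb
  have hm160 : (160 : ℝ) ≤ m := by nlinarith
  have hm0 : (0 : ℝ) < m := by linarith
  have hm5 : 160 ≤ m := by exact_mod_cast hm160
  have hiso := isolated_halfChain hε σ τ δ m (by nlinarith [norm_nonneg σ, norm_nonneg τ])
  have hest := hw.estimate hiso (by rw [← hb]; nlinarith) hz
  have hn := norm_center hε m
  have h120 : b ≤ 120 * b ^ 2 := by nlinarith
  have hab : ∀ c d : ℤ, |c| ≤ d ↔ -d ≤ c ∧ c ≤ d := fun c d => abs_le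
  have := eigenvalue_asymptotics hε 1 σ τ m (z := z) (n := ε * alt m * (2 * m + 1))
    -- Only sites within distance `4` of `m ≥ 160` matter, so neither the extension to negative
    -- indices nor the perturbed first entry plays a part.
    (w := fun k => w k.toNat)
    (K := 120 * b ^ 2) (by linarith) (by push_cast; ring) (by rw [hn]; linarith) hz
    (by linarith [norm_nonneg τ, norm_nonneg δ]) (by linarith [norm_nonneg σ, norm_nonneg δ])
    (fun k hk4 hk => (hest.1 k.toNat (by rw [hab] at hk4; omega)).trans (by
      rw [hn, ← hb, div_le_div_iff₀ hm0 (by linarith)]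
      have : 0 ≤ b ^ 2 := by positivity
      nlinarith)) (by simpa using hw.one)
    (fun k hk3 => by
      rw [hab] at hk3
      obtain ⟨j, rfl⟩ : ∃ j : ℕ, k = j := ⟨k.toNat, by omega⟩
      have hj : j ≠ 0 := by omega
      have h1 := hw.eq j
      rw [halfChain_act, if_neg hj, if_neg hj, add_zero] at h1
      have h2 : ((j : ℤ) + 1).toNat = j + 1 := by omega
      have h3 : ((j : ℤ) - 1).toNat = j - 1 := by omega
      simp only [h2, h3, Int.toNat_natCast]
      rw [← h1]; push_cast; ring)
  exact this

/-- The decay of the eigenfunction away from the resonant site. -/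
theorem halfChain_decay {b : ℝ} (hb : b = (halfChain ε hε σ τ δ).bound)
    (hm : 160 * b ^ 2 ≤ m) (hw : (halfChain ε hε σ τ δ).IsEigen m z w)
    (hz : ‖z - ε * alt m * (2 * m + 1)‖ ≤ 1 / 2) (k : ℕ) (hk : k ≠ m) :
    ‖w k‖ ≤ 80 * b ^ 3 / (m * |(k : ℝ) - m|) := by
  have hb1 : 1 ≤ b := by rw [hb]; exact Chain.one_le_bound _
  have hbd : b = ‖σ‖ + ‖τ‖ + ‖δ‖ + 3 := hb
  have hδ := norm_nonneg δ
  have hm160 : 160 * b ≤ m := by nlinarith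
  have hm0 : (0 : ℝ) < m := by linarith
  have hiso := isolated_halfChain hε σ τ δ m (by nlinarith [norm_nonneg σ, norm_nonneg τ])
  have hest := hw.estimate hiso (by rw [← hb]; nlinarith) hz
  rw [← hb] at hest
  have hkm : 0 < |(k : ℝ) - m| := abs_pos.2 (sub_ne_zero.2 (by exact_mod_cast hk))
  have hb3 : b ^ 2 ≤ b ^ 3 := pow_le_pow_right₀ hb1 (by norm_num)
  rw [le_div_iff₀ (by positivity)]
  by_cases hnb : k = m + 1 ∨ k + 1 = m
  · have h1 : |(k : ℝ) - m| = 1 := by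
      rcases hnb with h | h
      · rw [h]; push_cast; norm_num
      · rw [← h]; push_cast; norm_num
    have h2 := hest.1 k hk
    rw [le_div_iff₀ hm0] at h2
    rw [h1, mul_one]
    have : 0 ≤ b ^ 2 := by positivity
    linarith
  -- Neither neighbour of `k` is the resonant site, so both values are `O(1 / m)`. Dividing by the
  -- distance of the diagonal entries adds the factor `1 / |k - m|`.
  · push Not at hnb
    have hr : ‖w (k + 1)‖ ≤ 40 * b ^ 2 / m := hest.1 _ (by omega)
    have hl : ‖w (k - 1)‖ ≤ 40 * b ^ 2 / m := hest.1 _ (by omega)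
    have h1 := (halfChain ε hε σ τ δ).norm_mul_le_of_eq (z := z) (w := w) (i := k) (H := 0)
      (by rw [hw.eq k, sub_self, norm_zero]) hl hr
    rw [← hb] at h1
    have h2 := norm_halfChain_sub hε σ τ δ m k
    have h3 := Chain.norm_shift_ge hz ((halfChain ε hε σ τ δ).e k)
    have h4 : |(k : ℝ) - m| + 1 / 2 ≤
        ((if Even (m + k) then |2 * ((m : ℤ) - k)| else 2 * (m + k + 1) : ℤ) : ℝ) -
        (if k = 0 then ‖δ‖ else 0) := by
      have h5 : 2 * |(k : ℝ) - m| ≤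
          ((if Even (m + k) then |2 * ((m : ℤ) - k)| else 2 * (m + k + 1) : ℤ) : ℝ) := by
        split_ifs
        · push_cast
          rw [abs_mul, abs_two, abs_sub_comm]
        · push_cast
          have : |(k : ℝ) - m| ≤ k + m := by
            rw [abs_le]; constructor <;> linarith [(Nat.cast_nonneg k : (0 : ℝ) ≤ k)]
          linarith
      have h6 : (1 : ℝ) ≤ |(k : ℝ) - m| := by
        have : (1 : ℤ) ≤ |(k : ℤ) - m| := Int.one_le_abs (by omega)
        exact_mod_cast this
      have h8 : ∀ X : ℝ, 2 * |(k : ℝ) - m| ≤ X →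
          |(k : ℝ) - m| + 1 / 2 ≤ X - if k = 0 then ‖δ‖ else 0 := by
        intro X hX
        by_cases hk0 : k = 0
        · have h7 : |(k : ℝ) - m| = m := by
            rw [hk0, Nat.cast_zero, zero_sub, abs_neg, abs_of_pos hm0]
          rw [if_pos hk0]
          rw [h7] at hX ⊢
          linarith [norm_nonneg σ, norm_nonneg τ]
        · rw [if_neg hk0]
          linarith
      exact h8 _ h5
    have h5 : |(k : ℝ) - m| * ‖w k‖ ≤ 2 * b * (40 * b ^ 2 / m) + 0 :=
      (mul_le_mul_of_nonneg_right (by linarith) (norm_nonneg _)).trans h1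
    have h6 : 2 * b * (40 * b ^ 2 / m) + 0 = 80 * b ^ 3 / m := by ring
    rw [h6, le_div_iff₀ hm0] at h5
    linarith

theorem exists_halfChain_eigen (hε : ε = 1 ∨ ε = -1) (σ τ δ : ℂ) (m : ℕ) {b : ℝ}
    (hb : b = (halfChain ε hε σ τ δ).bound) (hm : 160 * b ^ 2 ≤ m) :
    ∃ z w, (halfChain ε hε σ τ δ).IsEigen m z w ∧
      ‖z - ε * alt m * (2 * m + 1)‖ ≤ 8 * b ^ 2 / m ∧
      ‖z - ε * alt m * (2 * m + 1)‖ < 1 / 2 ∧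
      ∀ z', ‖z' - ε * alt m * (2 * m + 1)‖ ≤ 1 / 2 →
        Module.rank ℂ ((halfChain ε hε σ τ δ).op.maxGenEigenspace z') =
          if z' = z then 1 else 0 := by
  have hb1 : 1 ≤ b := by rw [hb]; exact Chain.one_le_bound _
  have hbd : b = ‖σ‖ + ‖τ‖ + ‖δ‖ + 3 := hb
  have hm160 : 160 * b ≤ m := by nlinarith
  have hm0 : (0 : ℝ) < m := by linarith
  have hiso := isolated_halfChain hε σ τ δ m (by linarith [norm_nonneg σ, norm_nonneg τ])
  rw [hb] at hm
  obtain ⟨z, w, hw, hz⟩ := hiso.exists_eigen hm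
  have hz' : ‖z - ε * alt m * (2 * m + 1)‖ ≤ 1 / 20 := by
    refine hz.trans ?_
    rw [div_le_iff₀ hm0]; linarith
  exact ⟨z, w, hw, by rw [hb]; exact hz, by linarith, fun z' hz'' =>
    hw.rank hiso hm (by linarith) hz''⟩

end HalfChain

/-! ### The splitting of the eigenvalues of two one-sided chains -/

/-- The bound `1 / x² ≤ 2 / x - 2 / (x + 1)` telescopes to at most `2` on either side of `m`. -/
theorem sum_inv_sq_sub_le (m N : ℕ) :
    ∑ k ∈ (Finset.range N).erase m, 1 / ((k : ℝ) - m) ^ 2 ≤ 4 := by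
  have hstep : ∀ x : ℝ, 1 ≤ x → 1 / x ^ 2 ≤ 2 / x - 2 / (x + 1) := by
    intro x hx
    have hx0 : 0 < x := by linarith
    rw [div_sub_div _ _ hx0.ne' (by positivity), div_le_div_iff₀ (by positivity) (by positivity)]
    nlinarith [pow_pos hx0 2]
  have hsum : ∀ N : ℕ, ∑ k ∈ Finset.range N, (if k = m then 0 else 1 / ((k : ℝ) - m) ^ 2) ≤
      if N ≤ m then 2 / ((m : ℝ) - N + 1) else 4 - 2 / ((N : ℝ) - m) := by
    intro N
    induction N with
    | zero => simp; positivity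
    | succ N ih =>
      rw [Finset.sum_range_succ]
      rcases lt_trichotomy N m with h | h | h
      · rw [if_pos h.le] at ih
        rw [if_neg h.ne, if_pos (by omega)]
        have h1 : (N : ℝ) + 1 ≤ m := by exact_mod_cast h
        have h2 := hstep (m - N) (by linarith)
        have h3 : ((N : ℝ) - m) ^ 2 = (m - N) ^ 2 := by ring
        rw [h3]; push_cast
        rw [show (m : ℝ) - (N + 1) + 1 = m - N by ring]
        linarith
      · subst h
        simp only [le_refl, if_true, sub_self] at ih
        rw [if_pos rfl, if_neg (by omega)]
        push_cast
        rw [add_sub_cancel_left]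
        norm_num at ih ⊢; exact ih
      · rw [if_neg (by omega)] at ih
        rw [if_neg h.ne', if_neg (by omega)]
        have h1 : (m : ℝ) + 1 ≤ N := by exact_mod_cast h
        have h2 := hstep (N - m) (by linarith)
        push_cast
        rw [show (N : ℝ) + 1 - m = N - m + 1 by ring]
        linarith
  have h1 : ∑ k ∈ (Finset.range N).erase m, 1 / ((k : ℝ) - m) ^ 2 ≤
      ∑ k ∈ Finset.range N, (if k = m then 0 else 1 / ((k : ℝ) - m) ^ 2) := by
    rw [← Finset.sum_subset (Finset.erase_subset m (Finset.range N))]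
    · refine le_of_eq (Finset.sum_congr rfl fun k hk => ?_)
      rw [if_neg (Finset.ne_of_mem_erase hk)]
    · intro k hk hk'
      rw [if_pos]
      by_contra h
      exact hk' (Finset.mem_erase.2 ⟨h, hk⟩)
  refine h1.trans ((hsum N).trans ?_)
  split_ifs with h
  · have h2 : (N : ℝ) ≤ m := by exact_mod_cast h
    rw [div_le_iff₀ (by linarith)]
    linarith
  · have h2 : (m : ℝ) < N := by exact_mod_cast not_le.1 h
    have : 0 ≤ 2 / ((N : ℝ) - m) := div_nonneg zero_le_two (by linarith)
    linarith

section Splitting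

variable {ε : ℂ} {hε : ε = 1 ∨ ε = -1} {σ τ δ : ℂ} {m : ℕ} {z z' : ℂ} {w w' : ℕ → ℂ}

/-- Discrete Green identity: multiply the equation of each function by the other one and subtract.
The chains differ only in their first diagonal entries, by `2δ`; the off-diagonal terms telescope by
symmetry. -/
theorem halfChain_wronskian (hw : ∀ k, (halfChain ε hε σ τ δ).act w k = z * w k)
    (hw' : ∀ k, (halfChain ε hε σ τ (-δ)).act w' k = z' * w' k) (N : ℕ) :
    (z - z') * ∑ k ∈ Finset.range (N + 1), w k * w' k =
      2 * δ * (w 0 * w' 0) + link σ τ N * (w (N + 1) * w' N - w N * w' (N + 1)) := by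
  induction N with
  | zero =>
    have h1 := hw 0
    have h2 := hw' 0
    rw [halfChain_act] at h1 h2
    simp only [if_true] at h1 h2
    rw [Finset.sum_range_one]
    push_cast at *
    linear_combination -w' 0 * h1 + w 0 * h2
  | succ N ih =>
    have h1 := hw (N + 1)
    have h2 := hw' (N + 1)
    rw [halfChain_act, if_neg N.succ_ne_zero, if_neg N.succ_ne_zero] at h1 h2
    rw [Finset.sum_range_succ, mul_add, ih]
    push_cast at *
    simp only [add_sub_cancel_right] at h1 h2
    linear_combination -w' (N + 1) * h1 + w (N + 1) * h2

/-- The splitting of the eigenvalues of two one-sided chains in terms of the first components of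
the eigenfunctions. -/
theorem halfChain_splitting {b : ℝ} (hb : b = (halfChain ε hε σ τ δ).bound)
    (hm : 160 * b ^ 2 ≤ m) (hw : (halfChain ε hε σ τ δ).IsEigen m z w)
    (hw' : (halfChain ε hε σ τ (-δ)).IsEigen m z' w')
    (hz : ‖z - ε * alt m * (2 * m + 1)‖ ≤ 1 / 2) (hz' : ‖z' - ε * alt m * (2 * m + 1)‖ ≤ 1 / 2) :
    ∃ θ : ℂ, ‖θ‖ ≤ 4 * (80 * b ^ 3) ^ 2 / m ^ 2 ∧
      (z - z') * (1 + θ) = 2 * δ * (w 0 * w' 0) := by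
  have hb' : b = (halfChain ε hε σ τ (-δ)).bound := by
    rw [hb]; simp [halfChain]
  have hb1 : 1 ≤ b := by rw [hb]; exact Chain.one_le_bound _
  have hm0 : (0 : ℝ) < m := by nlinarith
  have hd := halfChain_decay hb hm hw hz
  have hd' := halfChain_decay hb' hm hw' hz'
  obtain ⟨K, hK⟩ : ∃ K, K = 80 * b ^ 3 := ⟨_, rfl⟩
  rw [← hK] at hd hd' ⊢
  have hK0 : 0 ≤ K := by rw [hK]; positivity
  have hlim : ∀ u : ℕ → ℂ, (∀ k, k ≠ m → ‖u k‖ ≤ K / (m * |(k : ℝ) - m|)) →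
      Filter.Tendsto u Filter.atTop (nhds 0) := by
    intro u hu
    refine squeeze_zero_norm' (a := fun k : ℕ => K / (m * |(k : ℝ) - m|)) ?_ ?_
    · filter_upwards [Filter.eventually_gt_atTop m] with k hk using hu k hk.ne'
    · refine Filter.Tendsto.const_div_atTop (Filter.Tendsto.const_mul_atTop hm0 ?_) K
      refine Filter.tendsto_abs_atTop_atTop.comp ?_
      exact Filter.tendsto_atTop_add_const_right _ (-(m : ℝ)) tendsto_natCast_atTop_atTop
  have hl := hlim w hd
  have hl' := hlim w' hd'
  obtain ⟨W, hW⟩ : ∃ W : ℕ → ℂ,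
      ∀ N, W N = link σ τ N * (w (N + 1) * w' N - w N * w' (N + 1)) := ⟨_, fun _ => rfl⟩
  have hWlim : Filter.Tendsto W Filter.atTop (nhds 0) := by
    have h1 := ((hl.comp (Filter.tendsto_add_atTop_nat 1)).mul hl').sub
      (hl.mul (hl'.comp (Filter.tendsto_add_atTop_nat 1)))
    simp only [mul_zero, sub_zero] at h1
    rw [tendsto_zero_iff_norm_tendsto_zero] at h1 ⊢
    refine squeeze_zero (fun _ => norm_nonneg _) (fun N => ?_)
      (by simpa using h1.const_mul (‖σ‖ + ‖τ‖))
    rw [hW, norm_mul]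
    exact mul_le_mul_of_nonneg_right (norm_link_le σ τ N) (norm_nonneg _)
  have hwr : ∀ N, (z - z') * ∑ k ∈ Finset.range (N + 1), w k * w' k =
      2 * δ * (w 0 * w' 0) + W N := fun N => by
    rw [hW]; exact halfChain_wronskian hw.eq hw'.eq N
  by_cases hzz : z = z'
  -- For equal eigenvalues the boundary term does not depend on `N`; as it tends to `0`, the product
  -- `δ * w 0 * w' 0` vanishes.
  · refine ⟨0, by rw [norm_zero]; positivity, ?_⟩
    have h1 : ∀ N, W N = -(2 * δ * (w 0 * w' 0)) := fun N => by
      have := hwr N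
      rw [hzz, sub_self, zero_mul] at this
      linear_combination -this
    have h2 := tendsto_nhds_unique hWlim ((Filter.tendsto_congr h1).2 tendsto_const_nhds)
    rw [hzz, sub_self, zero_mul]
    exact neg_eq_zero.1 h2.symm |>.symm
  · have hzz' : z - z' ≠ 0 := sub_ne_zero.2 hzz
    refine ⟨2 * δ * (w 0 * w' 0) / (z - z') - 1, ?_, by field_simp; ring⟩
    -- By the Green identity the quotient is a partial sum of `w k * w' k`. Its term at `m` is `1`,
    -- and the decay estimate makes the rest `O(m⁻²)`.
    have hS : ∀ N, m ≤ N → ‖(2 * δ * (w 0 * w' 0) + W N) / (z - z') - 1‖ ≤ 4 * K ^ 2 / m ^ 2 := by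
      intro N hN
      rw [← hwr, mul_div_cancel_left₀ _ hzz',
        ← Finset.add_sum_erase _ _ (Finset.mem_range.2 (Nat.lt_succ_of_le hN)), hw.one, hw'.one,
        mul_one, add_sub_cancel_left]
      have hterm : ∀ k ∈ (Finset.range (N + 1)).erase m,
          ‖w k * w' k‖ ≤ K ^ 2 / m ^ 2 * (1 / ((k : ℝ) - m) ^ 2) := by
        intro k hk
        have hk := Finset.ne_of_mem_erase hk
        rw [norm_mul]
        refine (mul_le_mul (hd k hk) (hd' k hk) (norm_nonneg _)
          (div_nonneg hK0 (by positivity))).trans (le_of_eq ?_)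
        rw [div_mul_div_comm, div_mul_div_comm, ← sq_abs ((k : ℝ) - m)]
        congr 1 <;> ring
      refine (norm_sum_le_of_le _ hterm).trans ?_
      rw [← Finset.mul_sum]
      refine (mul_le_mul_of_nonneg_left (sum_inv_sq_sub_le m (N + 1)) (by positivity)).trans
        (le_of_eq (by ring))
    have hlimS : Filter.Tendsto (fun N => (2 * δ * (w 0 * w' 0) + W N) / (z - z') - 1)
        Filter.atTop (nhds (2 * δ * (w 0 * w' 0) / (z - z') - 1)) := by
      have := ((hWlim.const_add (2 * δ * (w 0 * w' 0))).div_const (z - z')).sub_const 1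
      simpa using this
    refine le_of_tendsto hlimS.norm ?_
    filter_upwards [Filter.eventually_ge_atTop m] with N hN using hS N hN

end Splitting

/-! ### Perturbed recurrences -/

/-- First-order expansion of the solution of a recurrence with summable perturbation. -/
theorem recurrence_expansion {p x : ℕ → ℂ} {i : ℕ → ℕ} {m : ℕ} {X : ℝ} (h0 : p 0 = 1)
    (hp : ∀ k < m, p (k + 1) = p k - x k * p (i k)) (hi : ∀ k, i k ≤ k)
    (hX : ∑ k ∈ Finset.range m, ‖x k‖ ≤ X) (hX2 : X ≤ 1 / 2) :
    ‖p m - (1 - ∑ k ∈ Finset.range m, x k)‖ ≤ 2 * X ^ 2 := by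
  have hS : ∀ k ≤ m, ∑ j ∈ Finset.range k, ‖x j‖ ≤ X := fun k hk =>
    (Finset.sum_le_sum_of_subset_of_nonneg (Finset.range_mono hk)
      fun _ _ _ => norm_nonneg _).trans hX
  -- As long as the sum of the `‖x j‖` is at most `1 / 2`, all earlier values have norm at most `2`,
  -- so step `k` changes `p` by at most `2‖x k‖`.
  have h1 : ∀ k ≤ m, ‖p k - 1‖ ≤ 2 * ∑ j ∈ Finset.range k, ‖x j‖ := by
    intro k
    induction k using Nat.strong_induction_on with
    | _ k ih =>
      intro hk
      rcases k with _ | k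
      · simp [h0]
      · have h2 := ih k (by omega) (by omega)
        have h3 := ih (i k) (by have := hi k; omega) (by have := hi k; omega)
        have h4 := hS (i k) (by have := hi k; omega)
        have h5 : ‖p (i k)‖ ≤ 2 := by
          have := norm_add_le (p (i k) - 1) 1
          rw [sub_add_cancel, norm_one] at this
          linarith
        rw [hp k (by omega), Finset.sum_range_succ,
          show p k - x k * p (i k) - 1 = (p k - 1) - x k * p (i k) by ring]
        refine (norm_sub_le _ _).trans ?_
        rw [norm_mul]
        nlinarith [norm_nonneg (x k)]
  -- The exact remainder is quadratic: each `x j` is multiplied by a deviation which `h1` bounds by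
  -- `2X`.
  have h2 : ∀ k ≤ m, p k - (1 - ∑ j ∈ Finset.range k, x j) =
      -∑ j ∈ Finset.range k, x j * (p (i j) - 1) := by
    intro k
    induction k with
    | zero => simp [h0]
    | succ k ih =>
      intro hk
      rw [Finset.sum_range_succ, Finset.sum_range_succ, hp k (by omega)]
      linear_combination ih (by omega)
  rw [h2 m le_rfl, norm_neg]
  have hX0 : 0 ≤ X := (Finset.sum_nonneg fun _ _ => norm_nonneg _).trans hX
  have h3 : ∀ k ∈ Finset.range m, ‖x k * (p (i k) - 1)‖ ≤ ‖x k‖ * (2 * X) := by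
    intro k hk
    have hk := Finset.mem_range.1 hk
    have h4 : i k ≤ m := (hi k).trans hk.le
    rw [norm_mul]
    refine mul_le_mul_of_nonneg_left ((h1 _ h4).trans ?_) (norm_nonneg _)
    linarith [hS _ h4]
  refine (norm_sum_le_of_le _ h3).trans ?_
  rw [← Finset.sum_mul]
  nlinarith

/-! ### The distances of the resonant diagonal entry to the preceding ones -/

/-- The distance, up to sign, of the diagonal entries with indices `m` and `j ≤ m` of the
unperturbed one-sided chain. -/
def gap (m j : ℕ) : ℕ := if (m + j) % 2 = 0 then 2 * (m - j) else 2 * (m + j + 1)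

theorem diag_sub_eq_gap (ε : ℂ) {m j : ℕ} (hj : j ≤ m) :
    ε * alt m * (2 * m + 1) - ε * alt j * (2 * j + 1) = ε * alt m * gap m j := by
  unfold gap
  have h5 : Even ((m : ℤ) + j) ↔ (m + j) % 2 = 0 := by
    rw [← Nat.cast_add, Int.even_coe_nat, Nat.even_iff]
  split_ifs with h
  · rw [alt_eq_of_even (h5.2 h)]
    push_cast [hj]; ring
  · rw [alt_eq_of_odd (fun h' => h (h5.1 h'))]
    push_cast; ring

theorem two_le_gap {m j : ℕ} (h : j < m) : 2 ≤ gap m j := by unfold gap; split_ifs <;> omega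

theorem two_mul_le_gap_zero (m : ℕ) : 2 * m ≤ gap m 0 := by unfold gap; split_ifs <;> omega

theorem gap_last (m : ℕ) : gap (m + 1) m = 4 * (m + 1) := by unfold gap; split_ifs <;> omega

/-- One of two consecutive sites has the parity of `m`, so `j` cancels in the sum of the distances.
Thus the product of their inverses is the sum of the inverses over roughly `4m`, a linear expression
that can be summed. -/
theorem gap_add_gap {m j : ℕ} (h : j + 1 < m) :
    gap m j + gap m (j + 1) = 4 * m ∨ gap m j + gap m (j + 1) = 4 * m + 4 := by
  unfold gap; split_ifs <;> omega

/-- The distances are `4, 8, …, 4m` in some order. -/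
theorem prod_gap {M : Type*} [CommMonoid M] (m : ℕ) (F : ℕ → M) :
    ∏ j ∈ Finset.range m, F (gap m j) = ∏ j ∈ Finset.range m, F (4 * (j + 1)) := by
  -- Sites of the parity of `m` yield the multiples of `4` up to `2m`, the other sites those above
  -- `2m`; the inverse map makes the same distinction.
  refine Finset.prod_nbij' (fun j => gap m j / 4 - 1)
    (fun j => if 2 * (j + 1) ≤ m then m - 2 * (j + 1) else 2 * (j + 1) - m - 1) ?_ ?_ ?_ ?_ ?_
  · intro j hj
    rw [Finset.mem_range] at hj ⊢
    unfold gap; split_ifs <;> omega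
  · intro j hj
    rw [Finset.mem_range] at hj ⊢
    split_ifs <;> omega
  · intro j hj
    rw [Finset.mem_range] at hj
    unfold gap; split_ifs <;> omega
  · intro j hj
    rw [Finset.mem_range] at hj
    unfold gap; split_ifs <;> omega
  · intro j hj
    rw [Finset.mem_range] at hj
    congr 1
    unfold gap; split_ifs <;> omega

theorem prod_gap_eq (m : ℕ) : ∏ j ∈ Finset.range m, (gap m j : ℂ) = 4 ^ m * m.factorial := by
  rw [prod_gap m fun k => (k : ℂ)]
  push_cast
  rw [Finset.prod_mul_distrib, Finset.prod_const, Finset.card_range,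
    ← Finset.prod_range_add_one_eq_factorial]
  push_cast; rfl

/-- Reordering turns the sum into a quarter of the harmonic number, and `1 + log m ≤ 2 log m` once
`m ≥ 3`. -/
theorem sum_inv_gap_le {m : ℕ} (hm : 3 ≤ m) :
    ∑ j ∈ Finset.range m, (gap m j : ℝ)⁻¹ ≤ Real.log m / 2 := by
  have h1 : ∑ j ∈ Finset.range m, (gap m j : ℝ)⁻¹ =
      ∑ j ∈ Finset.range m, (((4 * (j + 1) : ℕ) : ℝ))⁻¹ :=
    -- The reordering of products, read in `Multiplicative ℝ`, is a reordering of sums.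
    congrArg Multiplicative.toAdd
      (prod_gap (M := Multiplicative ℝ) m fun k => Multiplicative.ofAdd (k : ℝ)⁻¹)
  have h2 := harmonic_le_one_add_log m
  have h3 : (harmonic m : ℝ) = ∑ j ∈ Finset.range m, ((j : ℝ) + 1)⁻¹ := by
    unfold harmonic; push_cast; rfl
  have h4 : ∑ j ∈ Finset.range m, (((4 * (j + 1) : ℕ) : ℝ))⁻¹ =
      4⁻¹ * ∑ j ∈ Finset.range m, ((j : ℝ) + 1)⁻¹ := by
    rw [Finset.mul_sum]
    refine Finset.sum_congr rfl fun j _ => ?_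
    push_cast; rw [mul_inv]
  have h5 : 1 ≤ Real.log m := by
    rw [Real.le_log_iff_exp_le (by positivity)]
    have : (3 : ℝ) ≤ m := by exact_mod_cast hm
    linarith [Real.exp_one_lt_d9]
  rw [h1, h4, ← h3]
  linarith

/-! ### Expansion of the first component of the eigenfunction -/

/-- Every interior `v k` collects the squares of both links at its site, whose sum is `σ² + τ²`;
only the two ends need a correction. -/
theorem sum_link_sq_mul (σ τ : ℂ) (v : ℕ → ℂ) (M : ℕ) :
    ∑ k ∈ Finset.range M, link σ τ k ^ 2 * (v k + v (k + 1)) =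
      (σ ^ 2 + τ ^ 2) * ∑ k ∈ Finset.range (M + 1), v k - link σ τ (-1) ^ 2 * v 0 -
        link σ τ M ^ 2 * v M := by
  induction M with
  | zero =>
    have := link_sq_add σ τ 0
    rw [zero_sub] at this
    simp only [Finset.range_zero, Finset.sum_empty, zero_add, Finset.sum_range_one, Nat.cast_zero]
    linear_combination v 0 * this
  | succ M ih =>
    have := link_sq_add σ τ (M + 1)
    rw [add_sub_cancel_right] at this
    rw [Finset.sum_range_succ, ih, Finset.sum_range_succ _ (M + 1)]
    push_cast
    linear_combination v (M + 1) * this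

/-- The recurrence coefficients are summed up to `O(log² m / m²)` by three replacements: `D k` by
its leading part, the product of two inverse distances by their sum over `4m`, and the squares of
the links by their pairwise sum. -/
theorem norm_sum_three_term_sub_le {σ τ δ μ η : ℂ} {m : ℕ} {C : ℝ} {D x : ℕ → ℂ} (hm : 3 ≤ m)
    (hC : 1 ≤ C) (hη : η * η = 1) (hσ : ‖σ‖ ≤ C) (hτ : ‖τ‖ ≤ C) (hδ : ‖δ‖ ≤ C)
    (hμ : ‖μ‖ ≤ C / m) (hμ1 : ‖μ‖ ≤ 1) (hD : ∀ k, D k = η * gap m k + μ) (hx0 : x 0 = δ / D 0)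
    (hxs : ∀ k, x (k + 1) = link σ τ k ^ 2 / (D (k + 1) * D k)) :
    ∑ k ∈ Finset.range m, ‖x k‖ ≤ 2 * C ^ 2 * (Real.log m / m) ∧
      ‖∑ k ∈ Finset.range m, x k - (δ * η / gap m 0 +
        (σ ^ 2 + τ ^ 2) / (4 * m) * ∑ k ∈ Finset.range m, (gap m k : ℂ)⁻¹)‖ ≤
        5 * C ^ 3 * (Real.log m / m) ^ 2 := by
  have hlink : ∀ k, ‖link σ τ k‖ ≤ C := fun k => by unfold link; split_ifs <;> assumption
  have hηn : ‖η‖ = 1 := by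
    have h := congrArg norm hη
    rw [norm_mul, norm_one] at h
    nlinarith [norm_nonneg η]
  have hη0 : η ≠ 0 := by rw [← norm_pos_iff, hηn]; exact one_pos
  obtain ⟨r, hr⟩ : ∃ r, r = Real.log m / m := ⟨_, rfl⟩
  have hm3 : (3 : ℝ) ≤ m := by exact_mod_cast hm
  have hm0 : (0 : ℝ) < m := by linarith
  have hlog : 1 ≤ Real.log m := by
    rw [Real.le_log_iff_exp_le hm0]
    linarith [Real.exp_one_lt_d9]
  have hrm : r * m = Real.log m := by rw [hr]; field_simp
  have hmr : 1 / (m : ℝ) ≤ r := by rw [hr]; gcongr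
  have hr0 : 0 < r := lt_of_lt_of_le (by positivity) hmr
  have hG := sum_inv_gap_le hm
  rw [← hrm] at hG
  rw [← hr]
  have hg2 : ∀ k < m, (2 : ℝ) ≤ gap m k := fun k hk => by exact_mod_cast two_le_gap hk
  have hDn : ∀ k < m, (gap m k : ℝ) / 2 ≤ ‖D k‖ := by
    intro k hk
    have h1 := norm_sub_norm_le (η * (gap m k : ℂ)) (-μ)
    rw [sub_neg_eq_add, ← hD, norm_neg, norm_mul, hηn, one_mul, Complex.norm_natCast] at h1
    have := hg2 k hk
    linarith
  have hDinv : ∀ k < m, ‖(D k)⁻¹‖ ≤ 2 * (gap m k : ℝ)⁻¹ := by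
    intro k hk
    have := hg2 k hk
    rw [norm_inv]
    refine (inv_anti₀ (by linarith) (hDn k hk)).trans (le_of_eq ?_)
    field_simp
  have hD0 : ∀ k < m, D k ≠ 0 := fun k hk => by
    rw [← norm_pos_iff]; have := hDn k hk; have := hg2 k hk; linarith
  obtain ⟨M, rfl⟩ : ∃ M, m = M + 1 := ⟨m - 1, by omega⟩
  obtain ⟨v, hv⟩ : ∃ v : ℕ → ℝ, ∀ k, v k = (gap (M + 1) k : ℝ)⁻¹ := ⟨_, fun _ => rfl⟩
  have hvc : ∀ k, (gap (M + 1) k : ℂ)⁻¹ = (v k : ℂ) := fun k => by rw [hv]; push_cast; rfl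
  simp only [← hv] at hG hDinv
  simp only [hvc, div_eq_mul_inv (δ * η)]
  have hv0 : ∀ k, 0 ≤ v k := fun k => by rw [hv]; positivity
  have hvz : v 0 ≤ 1 / (2 * ((M + 1 : ℕ) : ℝ)) := by
    rw [hv, ← one_div]
    exact one_div_le_one_div_of_le (by positivity) (by exact_mod_cast two_mul_le_gap_zero _)
  have hvl : v M = 1 / (4 * ((M + 1 : ℕ) : ℝ)) := by
    rw [hv, gap_last]; push_cast; rw [one_div]
  -- The replacement is exact when the two distances add up to `4m`, and has relative error `1 / m`
  -- when they add up to `4m + 4`.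
  have hvv : ∀ k < M, v k * v (k + 1) ≤ (v k + v (k + 1)) / (4 * ((M + 1 : ℕ) : ℝ)) ∧
      |v k * v (k + 1) - (v k + v (k + 1)) / (4 * ((M + 1 : ℕ) : ℝ))| ≤
        (v k + v (k + 1)) / (4 * ((M + 1 : ℕ) : ℝ) ^ 2) := by
    intro k hk
    have h1 := hg2 k (by omega)
    have h2 := hg2 (k + 1) (by omega)
    have h3 : v k + v (k + 1) =
        v k * v (k + 1) * ((gap (M + 1) k : ℝ) + gap (M + 1) (k + 1)) := by
      rw [hv, hv]; field_simp; ring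
    have h4 : 0 ≤ v k * v (k + 1) := mul_nonneg (hv0 _) (hv0 _)
    rcases gap_add_gap (m := M + 1) (j := k) (by omega) with h5 | h5
    · have h6 : (gap (M + 1) k : ℝ) + gap (M + 1) (k + 1) = 4 * ((M + 1 : ℕ) : ℝ) := by
        exact_mod_cast h5
      rw [h6] at h3
      have h7 : (v k + v (k + 1)) / (4 * ((M + 1 : ℕ) : ℝ)) = v k * v (k + 1) := by
        rw [h3]; field_simp
      rw [h7, sub_self, abs_zero]
      exact ⟨le_rfl, div_nonneg (add_nonneg (hv0 _) (hv0 _)) (by positivity)⟩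
    · have h6 : (gap (M + 1) k : ℝ) + gap (M + 1) (k + 1) = 4 * ((M + 1 : ℕ) : ℝ) + 4 := by
        exact_mod_cast h5
      rw [h6] at h3
      have h7 : (v k + v (k + 1)) / (4 * ((M + 1 : ℕ) : ℝ)) =
          v k * v (k + 1) + v k * v (k + 1) / ((M + 1 : ℕ) : ℝ) := by
        rw [h3]; field_simp
      have h8 : 0 ≤ v k * v (k + 1) / ((M + 1 : ℕ) : ℝ) := div_nonneg h4 hm0.le
      rw [h7, sub_add_cancel_left, abs_neg, abs_of_nonneg h8]
      refine ⟨by linarith, ?_⟩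
      rw [div_le_div_iff₀ hm0 (by positivity), h3]
      have : 0 ≤ v k * v (k + 1) * ((M + 1 : ℕ) : ℝ) := mul_nonneg h4 hm0.le
      nlinarith
  have hvsum : ∑ k ∈ Finset.range M, (v k + v (k + 1)) ≤ r * ((M + 1 : ℕ) : ℝ) := by
    rw [Finset.sum_add_distrib]
    have h1 := Finset.sum_range_succ v M
    have h2 := Finset.sum_range_succ' v M
    linarith [hv0 0, hv0 M]
  have hsq : ∀ k, ‖link σ τ k ^ 2‖ ≤ C ^ 2 := fun k => by
    rw [norm_pow]; exact pow_le_pow_left₀ (norm_nonneg _) (hlink k) 2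
  have hX : ∑ k ∈ Finset.range (M + 1), ‖x k‖ ≤ 2 * C ^ 2 * r := by
    rw [Finset.sum_range_succ']
    have h1 : ‖x 0‖ ≤ C * r := by
      rw [hx0, div_eq_mul_inv, norm_mul]
      have h2 : ‖(D 0)⁻¹‖ ≤ r := (hDinv 0 (by omega)).trans ((mul_le_mul_of_nonneg_left hvz
        zero_le_two).trans (le_trans (le_of_eq (by field_simp)) hmr))
      exact mul_le_mul hδ h2 (norm_nonneg _) (by linarith)
    have h2 : ∀ k ∈ Finset.range M, ‖x (k + 1)‖ ≤
        C ^ 2 / ((M + 1 : ℕ) : ℝ) * (v k + v (k + 1)) := by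
      intro k hk
      have hk := Finset.mem_range.1 hk
      rw [hxs, div_eq_mul_inv, mul_inv, norm_mul, norm_mul]
      have h3 := mul_le_mul (hDinv (k + 1) (by omega)) (hDinv k (by omega)) (norm_nonneg _)
        (mul_nonneg zero_le_two (hv0 _))
      refine (mul_le_mul (hsq k) h3 (by positivity) (by positivity)).trans ?_
      have h4 := mul_le_mul_of_nonneg_left (hvv k hk).1 (show (0 : ℝ) ≤ 4 * C ^ 2 by positivity)
      refine le_trans (le_of_eq (by ring)) (h4.trans (le_of_eq (by field_simp)))
    have h3 := Finset.sum_le_sum h2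
    rw [← Finset.mul_sum] at h3
    have h4 := mul_le_mul_of_nonneg_left hvsum (show (0 : ℝ) ≤ C ^ 2 / ((M + 1 : ℕ) : ℝ) by
      positivity)
    have h5 : C ^ 2 / ((M + 1 : ℕ) : ℝ) * (r * ((M + 1 : ℕ) : ℝ)) = C ^ 2 * r := by field_simp
    have h6 : C * r ≤ C ^ 2 * r := mul_le_mul_of_nonneg_right (by nlinarith) hr0.le
    linarith
  refine ⟨hX, ?_⟩
  obtain ⟨u, hu⟩ : ∃ u : ℕ → ℂ, ∀ k, u k = μ * η * v k := ⟨_, fun _ => rfl⟩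
  have hun : ∀ k < M + 1, ‖u k‖ ≤ ‖μ‖ / 2 := by
    intro k hk
    rw [hu, norm_mul, norm_mul, hηn, mul_one, Complex.norm_real, Real.norm_of_nonneg (hv0 k)]
    have : v k ≤ 2⁻¹ := by rw [hv]; exact inv_anti₀ zero_lt_two (hg2 k hk)
    nlinarith [norm_nonneg μ]
  -- Since `η² = 1`, replacing `1 / D k` by `η / gap` costs only the relative error `u k`, of size
  -- at most `‖μ‖ / 2`.
  have hDu : ∀ k < M + 1, (v k : ℂ) = η * (D k)⁻¹ * (1 + u k) := by
    intro k hk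
    have h1 : (gap (M + 1) k : ℂ) ≠ 0 :=
      Nat.cast_ne_zero.2 (by have := two_le_gap hk; omega)
    have h2 := hD0 k hk
    rw [hu, ← hvc]
    field_simp
    rw [hD]
    linear_combination -μ * hη
  have hy0 : ‖x 0 - δ * η * v 0‖ ≤ ‖x 0‖ * (2 * ‖μ‖) := by
    have h1 : x 0 - δ * η * v 0 = -(x 0 * u 0) := by
      rw [hDu 0 (by omega), hx0]; linear_combination -δ * (D 0)⁻¹ * (1 + u 0) * hη
    rw [h1, norm_neg, norm_mul]
    exact mul_le_mul_of_nonneg_left (by linarith [hun 0 (by omega), norm_nonneg μ]) (norm_nonneg _)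
  have hys : ∀ k ∈ Finset.range M, ‖x (k + 1) - link σ τ k ^ 2 * (v k * v (k + 1))‖ ≤
      ‖x (k + 1)‖ * (2 * ‖μ‖) := by
    intro k hk
    have hk := Finset.mem_range.1 hk
    have h1 : x (k + 1) - link σ τ k ^ 2 * (v k * v (k + 1)) =
        -(x (k + 1) * (u k + u (k + 1) + u k * u (k + 1))) := by
      rw [hDu k (by omega), hDu (k + 1) (by omega), hxs]
      linear_combination (-link σ τ k ^ 2 * (D (k + 1))⁻¹ * (D k)⁻¹ * (1 + u k) *
        (1 + u (k + 1))) * hη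
    rw [h1, norm_neg, norm_mul]
    refine mul_le_mul_of_nonneg_left ?_ (norm_nonneg _)
    refine (norm_add₃_le).trans ?_
    rw [norm_mul]
    have h2 := hun k (by omega)
    have h3 := hun (k + 1) (by omega)
    have h4 := mul_le_mul h2 h3 (norm_nonneg _) (by positivity)
    nlinarith [norm_nonneg μ]
  have hz : ∀ k ∈ Finset.range M, ‖link σ τ k ^ 2 * (v k * v (k + 1)) -
      link σ τ k ^ 2 * ((v k + v (k + 1)) / (4 * ((M + 1 : ℕ) : ℂ)))‖ ≤
      C ^ 2 / (4 * ((M + 1 : ℕ) : ℝ) ^ 2) * (v k + v (k + 1)) := by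
    intro k hk
    have hk := Finset.mem_range.1 hk
    have h1 : (v k * v (k + 1) - (v k + v (k + 1)) / (4 * ((M + 1 : ℕ) : ℂ)) : ℂ) =
        ((v k * v (k + 1) - (v k + v (k + 1)) / (4 * ((M + 1 : ℕ) : ℝ)) : ℝ) : ℂ) := by
      push_cast; rfl
    rw [← mul_sub, h1, norm_mul, Complex.norm_real, Real.norm_eq_abs]
    refine (mul_le_mul (hsq k) (hvv k hk).2 (abs_nonneg _) (by positivity)).trans (le_of_eq ?_)
    ring
  have htel := sum_link_sq_mul σ τ (fun k => (v k : ℂ)) M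
  -- The error consists of the first coefficient, the replacement of `D`, the replacement of
  -- products by sums, and the two end terms left by `sum_link_sq_mul`.
  have hdec : ∑ k ∈ Finset.range (M + 1), x k - (δ * η * v 0 +
      (σ ^ 2 + τ ^ 2) / (4 * ((M + 1 : ℕ) : ℂ)) * ∑ k ∈ Finset.range (M + 1), (v k : ℂ)) =
      (x 0 - δ * η * v 0) +
      ∑ k ∈ Finset.range M, (x (k + 1) - link σ τ k ^ 2 * (v k * v (k + 1))) +
      ∑ k ∈ Finset.range M, (link σ τ k ^ 2 * (v k * v (k + 1)) -
        link σ τ k ^ 2 * ((v k + v (k + 1)) / (4 * ((M + 1 : ℕ) : ℂ)))) +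
      (-(link σ τ (-1) ^ 2 * v 0) - link σ τ M ^ 2 * v M) / (4 * ((M + 1 : ℕ) : ℂ)) := by
    have h1 : ∑ k ∈ Finset.range M,
        link σ τ k ^ 2 * ((v k + v (k + 1) : ℂ) / (4 * ((M + 1 : ℕ) : ℂ))) =
        (∑ k ∈ Finset.range M, link σ τ k ^ 2 * (v k + v (k + 1) : ℂ)) /
          (4 * ((M + 1 : ℕ) : ℂ)) := by
      rw [Finset.sum_div]
      exact Finset.sum_congr rfl fun k _ => by ring
    rw [Finset.sum_sub_distrib, Finset.sum_sub_distrib, h1, htel, Finset.sum_range_succ' x]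
    ring
  rw [hdec]
  have hA : ‖x 0 - δ * η * v 0‖ +
      ‖∑ k ∈ Finset.range M, (x (k + 1) - link σ τ k ^ 2 * (v k * v (k + 1)))‖ ≤
      4 * C ^ 3 * r ^ 2 := by
    have h1 := norm_sum_le_of_le _ hys
    rw [← Finset.sum_mul] at h1
    rw [Finset.sum_range_succ'] at hX
    have h2 : ‖μ‖ ≤ C * r := by
      refine hμ.trans ?_
      rw [div_eq_mul_one_div]; exact mul_le_mul_of_nonneg_left hmr (by linarith)
    have h3 := mul_le_mul hX (mul_le_mul_of_nonneg_left h2 zero_le_two) (by positivity)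
      (by positivity)
    linarith
  have hm2 : 1 / ((M + 1 : ℕ) : ℝ) * (1 / ((M + 1 : ℕ) : ℝ)) ≤ r ^ 2 := by
    rw [sq]; exact mul_le_mul hmr hmr (by positivity) hr0.le
  have hB := norm_sum_le_of_le _ hz
  rw [← Finset.mul_sum] at hB
  have hB2 : C ^ 2 / (4 * ((M + 1 : ℕ) : ℝ) ^ 2) * ∑ k ∈ Finset.range M, (v k + v (k + 1)) ≤
      C ^ 2 * r ^ 2 / 4 := by
    refine (mul_le_mul_of_nonneg_left hvsum (by positivity)).trans ?_
    have h1 : C ^ 2 / (4 * ((M + 1 : ℕ) : ℝ) ^ 2) * (r * ((M + 1 : ℕ) : ℝ)) =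
        C ^ 2 * r / 4 * (1 / ((M + 1 : ℕ) : ℝ)) := by field_simp
    rw [h1]
    refine (mul_le_mul_of_nonneg_left hmr (by positivity)).trans (le_of_eq (by ring))
  have hE : ‖(-(link σ τ (-1) ^ 2 * v 0) - link σ τ M ^ 2 * v M) / (4 * ((M + 1 : ℕ) : ℂ))‖ ≤
      C ^ 2 * r ^ 2 / 4 := by
    have h1 : ‖(4 * ((M + 1 : ℕ) : ℂ))‖ = 4 * ((M + 1 : ℕ) : ℝ) := by
      rw [norm_mul, Complex.norm_natCast, RCLike.norm_ofNat]
    rw [norm_div, h1, div_le_iff₀ (by positivity)]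
    refine (norm_sub_le _ _).trans ?_
    rw [norm_neg, norm_mul, norm_mul, Complex.norm_real, Complex.norm_real,
      Real.norm_of_nonneg (hv0 _), Real.norm_of_nonneg (hv0 _), hvl]
    have h2 := mul_le_mul (hsq (-1)) hvz (hv0 0) (by positivity)
    have h3 := mul_le_mul_of_nonneg_right (hsq M)
      (show 0 ≤ 1 / (4 * ((M + 1 : ℕ) : ℝ)) by positivity)
    have h4 : C ^ 2 * (1 / (2 * ((M + 1 : ℕ) : ℝ))) + C ^ 2 * (1 / (4 * ((M + 1 : ℕ) : ℝ))) =
        C ^ 2 * (3 / 4 * (1 / ((M + 1 : ℕ) : ℝ) * (1 / ((M + 1 : ℕ) : ℝ)))) *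
          ((M + 1 : ℕ) : ℝ) := by field_simp; norm_num
    have h5 := mul_le_mul_of_nonneg_left hm2 (show (0 : ℝ) ≤ C ^ 2 * ((M + 1 : ℕ) : ℝ) by
      positivity)
    have h6 : 0 ≤ C ^ 2 * ((M + 1 : ℕ) : ℝ) * r ^ 2 := by positivity
    linarith
  have h23 : C ^ 2 * r ^ 2 ≤ C ^ 3 * r ^ 2 :=
    mul_le_mul_of_nonneg_right (pow_le_pow_right₀ hC (by norm_num)) (by positivity)
  refine (norm_add_le _ _).trans ?_
  have := (norm_add_le _ _).trans (add_le_add (norm_add_le (x 0 - δ * η * v 0)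
    (∑ k ∈ Finset.range M, (x (k + 1) - link σ τ k ^ 2 * (v k * v (k + 1))))) hB)
  linarith [show 0 ≤ C ^ 2 * r ^ 2 by positivity]

/-- The expansion of the normalized first component of the eigenfunction of a one-sided chain. -/
theorem first_component_expansion {σ τ δ μ η : ℂ} {m : ℕ} {C : ℝ} {D q : ℕ → ℂ} (hm : 3 ≤ m)
    (hC : 1 ≤ C) (hη : η * η = 1) (hσ : ‖σ‖ ≤ C) (hτ : ‖τ‖ ≤ C) (hδ : ‖δ‖ ≤ C)
    (hμ : ‖μ‖ ≤ C / m) (hμ' : ‖μ * η - (σ ^ 2 + τ ^ 2) / (4 * m)‖ ≤ C / m ^ 2)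
    (hr : 8 * C ^ 2 * (Real.log m / m) ≤ 1) (hD : ∀ k, D k = η * gap m k + μ) (hq0 : q 0 = 1)
    (hq1 : q 1 = 1 - δ / D 0)
    (hq : ∀ k, k + 1 < m → q (k + 2) = q (k + 1) - link σ τ k ^ 2 / (D (k + 1) * D k) * q k) :
    ‖q m * ∏ j ∈ Finset.range m, (1 + μ * η * (gap m j : ℂ)⁻¹) - (1 - δ * η / gap m 0)‖ ≤
      30 * C ^ 4 * (Real.log m / m) ^ 2 := by
  have hηn : ‖η‖ = 1 := by
    have h := congrArg norm hη
    rw [norm_mul, norm_one] at h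
    nlinarith [norm_nonneg η]
  have hm3 : (3 : ℝ) ≤ m := by exact_mod_cast hm
  have hm0 : (0 : ℝ) < m := by linarith
  have hlog : 1 ≤ Real.log m := by
    rw [Real.le_log_iff_exp_le hm0]
    linarith [Real.exp_one_lt_d9]
  have hG := sum_inv_gap_le hm
  have hmr : 1 / (m : ℝ) ≤ Real.log m / m := by gcongr
  have hr0 : 0 < Real.log m / m := lt_of_lt_of_le (by positivity) hmr
  have hCr : C * (Real.log m / m) ≤ C ^ 2 * (Real.log m / m) :=
    mul_le_mul_of_nonneg_right (by nlinarith) hr0.le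
  have hμr : ‖μ‖ ≤ C * (Real.log m / m) := by
    refine hμ.trans ?_
    rw [div_eq_mul_one_div]; exact mul_le_mul_of_nonneg_left hmr (by linarith)
  obtain ⟨x, hx0, hxs⟩ : ∃ x : ℕ → ℂ, x 0 = δ / D 0 ∧
      ∀ k, x (k + 1) = link σ τ k ^ 2 / (D (k + 1) * D k) :=
    ⟨fun k => Nat.rec (δ / D 0) (fun k _ => link σ τ k ^ 2 / (D (k + 1) * D k)) k,
      rfl, fun _ => rfl⟩
  obtain ⟨hX, hY⟩ := norm_sum_three_term_sub_le hm hC hη hσ hτ hδ hμ (by linarith) hD hx0 hxs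
  obtain ⟨r, hrd⟩ : ∃ r, r = Real.log m / m := ⟨_, rfl⟩
  have hrm : Real.log m = r * m := by rw [hrd]; field_simp
  rw [hrm] at hG
  rw [← hrd] at hX hY hr hmr hr0 hCr hμr ⊢
  -- The truncated index `k - 1` makes the initial two-term step an instance of the three-term
  -- recurrence, since both `q 0` terms then coincide.
  have hQ := recurrence_expansion (p := q) (x := x) (i := fun k => k - 1) (m := m) hq0
    (fun k hk => by
      rcases k with _ | k
      · rw [hq1, hx0, hq0, mul_one]
      · rw [hq k hk, hxs]; rfl) (fun k => Nat.sub_le _ _) hX (by linarith)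
  have hGc : ∑ j ∈ Finset.range m, (gap m j : ℂ)⁻¹ =
      ((∑ j ∈ Finset.range m, (gap m j : ℝ)⁻¹ : ℝ) : ℂ) := by push_cast; rfl
  have hG0 : 0 ≤ ∑ j ∈ Finset.range m, (gap m j : ℝ)⁻¹ :=
    Finset.sum_nonneg fun _ _ => by positivity
  have hP := recurrence_expansion (p := fun k => ∏ j ∈ Finset.range k,
      (1 + μ * η * (gap m j : ℂ)⁻¹)) (x := fun k => -(μ * η * (gap m k : ℂ)⁻¹)) (i := id)
    (m := m) (X := C * r / 2) (by simp)
    (fun k _ => by rw [Finset.prod_range_succ]; simp only [id]; ring) (fun k => le_rfl)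
    (by
      have h1 : ∀ k ∈ Finset.range m, ‖-(μ * η * (gap m k : ℂ)⁻¹)‖ = ‖μ‖ * (gap m k : ℝ)⁻¹ := by
        intro k _
        rw [norm_neg, norm_mul, norm_mul, hηn, mul_one, norm_inv, Complex.norm_natCast]
      rw [Finset.sum_congr rfl h1, ← Finset.mul_sum]
      refine (mul_le_mul hμ hG hG0 (by positivity)).trans (le_of_eq (by field_simp)))
    (by linarith)
  rw [Finset.sum_neg_distrib, sub_neg_eq_add, ← Finset.mul_sum] at hP
  rw [hGc] at hP hY
  obtain ⟨G, hGd⟩ : ∃ G, G = ∑ j ∈ Finset.range m, (gap m j : ℝ)⁻¹ := ⟨_, rfl⟩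
  rw [← hGd] at hP hY hG hG0
  obtain ⟨P, hPd⟩ : ∃ P, P = ∏ j ∈ Finset.range m, (1 + μ * η * (gap m j : ℂ)⁻¹) := ⟨_, rfl⟩
  rw [← hPd] at hP ⊢
  obtain ⟨y, hy⟩ : ∃ y, y = δ * η / gap m 0 := ⟨_, rfl⟩
  obtain ⟨t, ht⟩ : ∃ t, t = (σ ^ 2 + τ ^ 2) / (4 * m) * (G : ℂ) := ⟨_, rfl⟩
  rw [← hy, ← ht] at hY
  rw [← hy]
  have hyn : ‖y‖ ≤ C * r / 2 := by
    have h1 : 2 * (m : ℝ) ≤ gap m 0 := by exact_mod_cast two_mul_le_gap_zero m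
    rw [hy, norm_div, norm_mul, hηn, mul_one, Complex.norm_natCast]
    refine (div_le_div₀ (by linarith) hδ (by linarith) h1).trans ?_
    have h2 := mul_le_mul_of_nonneg_left hmr (show 0 ≤ C / 2 by linarith)
    refine le_trans (le_of_eq ?_) (h2.trans (le_of_eq (by ring)))
    field_simp
  have htn : ‖t‖ ≤ C ^ 2 * r / 4 := by
    rw [ht, norm_mul, norm_div, norm_mul, Complex.norm_natCast, RCLike.norm_ofNat,
      Complex.norm_real, Real.norm_of_nonneg hG0]
    have h1 : ‖σ ^ 2 + τ ^ 2‖ ≤ 2 * C ^ 2 := by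
      refine (norm_add_le _ _).trans ?_
      rw [norm_pow, norm_pow]
      have h2 := pow_le_pow_left₀ (norm_nonneg _) hσ 2
      have h3 := pow_le_pow_left₀ (norm_nonneg _) hτ 2
      linarith
    have h2 : ‖σ ^ 2 + τ ^ 2‖ / (4 * (m : ℝ)) ≤ 2 * C ^ 2 / (4 * m) := by gcongr
    refine (mul_le_mul h2 hG hG0 (by positivity)).trans (le_of_eq ?_)
    field_simp
  have hEp : ‖P - (1 + t)‖ ≤ C ^ 2 * r ^ 2 := by
    have h1 : P - (1 + t) = (P - (1 + μ * η * G)) + (μ * η - (σ ^ 2 + τ ^ 2) / (4 * m)) * G := by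
      rw [ht]; ring
    have h2 : ‖(μ * η - (σ ^ 2 + τ ^ 2) / (4 * m)) * G‖ ≤ C * r ^ 2 / 2 := by
      rw [norm_mul, Complex.norm_real, Real.norm_of_nonneg hG0]
      refine (mul_le_mul hμ' hG hG0 (by positivity)).trans ?_
      have h3 : C / (m : ℝ) ^ 2 * (r * m / 2) = C * r / 2 * (1 / m) := by field_simp
      rw [h3]
      refine (mul_le_mul_of_nonneg_left hmr (by positivity)).trans (le_of_eq (by ring))
    rw [h1]
    refine (norm_add_le _ _).trans ((add_le_add hP h2).trans ?_)
    have h3 : C * r ^ 2 ≤ C ^ 2 * r ^ 2 :=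
      mul_le_mul_of_nonneg_right (by nlinarith) (by positivity)
    have h4 : 2 * (C * r / 2) ^ 2 = C ^ 2 * r ^ 2 / 2 := by ring
    linarith
  have h34 : C ^ 3 * r ^ 2 ≤ C ^ 4 * r ^ 2 :=
    mul_le_mul_of_nonneg_right (pow_le_pow_right₀ hC (by norm_num)) (by positivity)
  have h24 : C ^ 2 * r ^ 2 ≤ C ^ 4 * r ^ 2 :=
    mul_le_mul_of_nonneg_right (pow_le_pow_right₀ hC (by norm_num)) (by positivity)
  have hEq : ‖q m - (1 - y - t)‖ ≤ 13 * (C ^ 4 * r ^ 2) := by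
    have h1 : q m - (1 - y - t) = (q m - (1 - ∑ k ∈ Finset.range m, x k)) -
      (∑ k ∈ Finset.range m, x k - (y + t)) := by ring
    rw [h1]
    refine (norm_sub_le _ _).trans ((add_le_add hQ hY).trans ?_)
    have h2 : 2 * (2 * C ^ 2 * r) ^ 2 = 8 * (C ^ 4 * r ^ 2) := by ring
    linarith
  -- The terms of size `log m / m` cancel here: `q m` is close to `1 - y - t` and `P` to `1 + t`,
  -- with the same `t`. What remains is quadratic in `y` and `t` or is an error term.
  have hfin : q m * P - (1 - y) = -(y * t) - t * t + (P - (1 + t)) * (1 - y - t) +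
      (q m - (1 - y - t)) * P := by ring
  have hP2 : ‖P‖ ≤ 2 := by
    have h1 := norm_add₃_le (a := P - (1 + t)) (b := 1) (c := t)
    rw [show P - (1 + t) + 1 + t = P by ring, norm_one] at h1
    have h2 : (C * r) ^ 2 ≤ 1 ^ 2 / 4 :=
      (pow_le_pow_left₀ (by positivity) (by linarith : C * r ≤ 1 / 8) 2).trans (by norm_num)
    rw [mul_pow] at h2
    linarith
  have hP3 : ‖1 - y - t‖ ≤ 2 := by
    have h1 := norm_sub_le (1 - y) t
    have h2 := norm_sub_le 1 y
    rw [norm_one] at h2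
    linarith
  rw [hfin]
  have k1 : ‖y * t‖ ≤ C ^ 4 * r ^ 2 / 8 := by
    rw [norm_mul]
    refine (mul_le_mul (hyn.trans (by linarith : _ ≤ C ^ 2 * r / 2)) htn (norm_nonneg _)
      (by positivity)).trans (le_of_eq (by ring))
  have k2 : ‖t * t‖ ≤ C ^ 4 * r ^ 2 / 16 := by
    rw [norm_mul]
    exact (mul_le_mul htn htn (norm_nonneg _) (by positivity)).trans (le_of_eq (by ring))
  have k3 : ‖(P - (1 + t)) * (1 - y - t)‖ ≤ C ^ 2 * r ^ 2 * 2 := by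
    rw [norm_mul]; exact mul_le_mul hEp hP3 (norm_nonneg _) (by positivity)
  have k4 : ‖(q m - (1 - y - t)) * P‖ ≤ 13 * (C ^ 4 * r ^ 2) * 2 := by
    rw [norm_mul]; exact mul_le_mul hEq hP2 (norm_nonneg _) (by positivity)
  refine (norm_add_le _ _).trans ((add_le_add ((norm_add_le _ _).trans
    (add_le_add ((norm_sub_le _ _).trans (add_le_add (le_of_eq (norm_neg _)) le_rfl)) k3))
    k4).trans ?_)
  have : 0 ≤ C ^ 4 * r ^ 2 := by positivity
  linarith

/-- The normalized solution of the three-term recurrence of a one-sided chain. -/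
noncomputable def threeTerm (σ τ δ : ℂ) (D : ℕ → ℂ) : ℕ → ℂ
  | 0 => 1
  | 1 => 1 - δ / D 0
  | k + 2 => threeTerm σ τ δ D (k + 1) -
      link σ τ k ^ 2 / (D (k + 1) * D k) * threeTerm σ τ δ D k

/-- The equations at the sites below `m` determine the eigenfunction from its value at `0`. Taking
out the unperturbed factors `D j` leaves a recurrence that starts at `1` and in which `δ` enters
only through the first step. -/
theorem mul_prod_link_eq {ε : ℂ} {hε : ε = 1 ∨ ε = -1} {σ τ δ z : ℂ} {m : ℕ} {w D : ℕ → ℂ}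
    (hw : ∀ k, (halfChain ε hε σ τ δ).act w k = z * w k)
    (hD : ∀ k < m, z - ε * alt k * (2 * k + 1) = D k) (hD0 : ∀ k < m, D k ≠ 0) :
    ∀ k ≤ m, w k * ∏ j ∈ Finset.range k, link σ τ j =
      w 0 * (∏ j ∈ Finset.range k, D j) * threeTerm σ τ δ D k := by
  intro k
  induction k using Nat.twoStepInduction with
  | zero => simp [threeTerm]
  | one =>
    intro hk
    have h1 := hw 0
    rw [halfChain_act] at h1
    simp only [if_true] at h1
    have h2 := hD 0 hk
    have h3 := hD0 0 hk
    rw [Finset.prod_range_one, Finset.prod_range_one, threeTerm]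
    field_simp
    push_cast at *
    linear_combination h1 + w 0 * h2
  | more k ih1 ih2 =>
    intro hk
    have h1 := hw (k + 1)
    rw [halfChain_act, if_neg k.succ_ne_zero, if_neg k.succ_ne_zero] at h1
    have h2 := hD (k + 1) (by omega)
    have h3 := hD0 (k + 1) (by omega)
    have h4 := hD0 k (by omega)
    have e1 := ih1 (by omega)
    have e2 := ih2 (by omega)
    simp only [Nat.cast_add, Nat.cast_one, add_sub_cancel_right, add_tsub_cancel_right] at h1 h2
    have h5 : w (k + 2) * link σ τ (k + 1) = D (k + 1) * w (k + 1) - link σ τ k * w k := by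
      linear_combination h1 + w (k + 1) * h2
    rw [Finset.prod_range_succ, Finset.prod_range_succ D (k + 1)]
    have h6 : threeTerm σ τ δ D (k + 2) = threeTerm σ τ δ D (k + 1) -
      link σ τ k ^ 2 / (D (k + 1) * D k) * threeTerm σ τ δ D k := rfl
    have h7 : w 0 * (∏ j ∈ Finset.range (k + 1), D j) * D (k + 1) *
        (link σ τ k ^ 2 / (D (k + 1) * D k) * threeTerm σ τ δ D k) =
        link σ τ k ^ 2 * (w 0 * (∏ j ∈ Finset.range k, D j) * threeTerm σ τ δ D k) := by
      rw [Finset.prod_range_succ]; field_simp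
    rw [h6, ← mul_assoc (w 0), mul_sub, h7, ← e1]
    rw [Finset.prod_range_succ] at e2 ⊢
    push_cast at *
    linear_combination (∏ j ∈ Finset.range k, link σ τ j) * link σ τ k * h5 + D (k + 1) * e2

/-- Since `w m = 1`, the recurrence up to site `m` can be solved for `w 0`. The product of the
distances gives `4 ^ m * m!`, and `f` collects the factors close to `1`. -/
theorem halfChain_first_component {ε : ℂ} {hε : ε = 1 ∨ ε = -1} {σ τ δ z : ℂ} {m : ℕ} {w : ℕ → ℂ}
    {b C : ℝ} (hb : b = (halfChain ε hε σ τ δ).bound)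
    (hC : C = 9 * (2 * (120 * b ^ 2) ^ 2) ^ 6 + 8 * b ^ 2) (hm : 160 * b ^ 2 ≤ m)
    (hw : (halfChain ε hε σ τ δ).IsEigen m z w)
    (hz : ‖z - ε * alt m * (2 * m + 1)‖ ≤ 8 * b ^ 2 / m)
    (hr : 8 * C ^ 2 * (Real.log m / m) ≤ 1) :
    ∃ f : ℂ, ‖f - (1 - δ * (ε * alt m) / gap m 0)‖ ≤ 30 * C ^ 4 * (Real.log m / m) ^ 2 ∧
      ∏ j ∈ Finset.range m, link σ τ j = w 0 * ((ε * alt m) ^ m * (4 ^ m * m.factorial)) * f := by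
  have hb1 : 1 ≤ b := by rw [hb]; exact Chain.one_le_bound _
  have hbd : b = ‖σ‖ + ‖τ‖ + ‖δ‖ + 3 := hb
  have hσ0 := norm_nonneg σ
  have hτ0 := norm_nonneg τ
  have hδ0 := norm_nonneg δ
  have hm160 : (160 : ℝ) ≤ m := by nlinarith
  have hm0 : (0 : ℝ) < m := by linarith
  have hm3 : 3 ≤ m := by
    have : (3 : ℝ) ≤ m := by linarith
    exact_mod_cast this
  have hbC : 8 * b ^ 2 ≤ C := by
    rw [hC]; linarith [show 0 ≤ 9 * (2 * (120 * b ^ 2) ^ 2) ^ 6 by positivity]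
  have hbb : b ≤ b ^ 2 := by nlinarith
  have hη : (ε * alt m) * (ε * alt m) = 1 := by
    have h1 := alt_sq m
    have h2 : ε * ε = 1 := by rcases hε with rfl | rfl <;> norm_num
    linear_combination ε * ε * h1 + h2
  have hηn : ‖ε * alt m‖ = 1 := by rw [norm_mul, norm_sign hε, norm_alt, one_mul]
  have hz1 : ‖z - ε * alt m * (2 * m + 1)‖ ≤ 1 / 2 := by
    refine hz.trans ?_
    rw [div_le_iff₀ hm0]; linarith
  have hasy := halfChain_eigenvalue_asymptotics hb hm hw hz1
  rw [norm_center hε] at hasy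
  obtain ⟨K, hK⟩ : ∃ K, K = 9 * (2 * (120 * b ^ 2) ^ 2) ^ 6 := ⟨_, rfl⟩
  rw [← hK] at hasy hC
  have hK0 : 0 ≤ K := by rw [hK]; positivity
  obtain ⟨η, hηd⟩ : ∃ η, η = ε * alt m := ⟨_, rfl⟩
  obtain ⟨μ, hμd⟩ : ∃ μ, μ = z - η * (2 * m + 1) := ⟨_, rfl⟩
  rw [← hηd] at hη hηn hz hz1 hasy ⊢
  rw [← hμd] at hz hz1
  have hη0 : η ≠ 0 := by rw [← norm_pos_iff, hηn]; exact one_pos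
  have hmc : (m : ℂ) ≠ 0 := by exact_mod_cast hm0.ne'
  have hmc1 : (2 * m + 1 : ℂ) ≠ 0 := by
    have : (2 * m + 1 : ℝ) ≠ 0 := by positivity
    exact_mod_cast this
  have hs : ‖σ ^ 2 + τ ^ 2‖ ≤ 2 * b ^ 2 := by
    refine (norm_add_le _ _).trans ?_
    rw [norm_pow, norm_pow]
    have h2 := pow_le_pow_left₀ hσ0 (by linarith : ‖σ‖ ≤ b) 2
    have h3 := pow_le_pow_left₀ hτ0 (by linarith : ‖τ‖ ≤ b) 2
    linarith
  have hd : ‖ε * (τ ^ 2 - σ ^ 2)‖ ≤ 2 * b ^ 2 := by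
    rw [norm_mul, norm_sign hε, one_mul]
    refine (norm_sub_le _ _).trans ?_
    rw [norm_pow, norm_pow]
    have h2 := pow_le_pow_left₀ hσ0 (by linarith : ‖σ‖ ≤ b) 2
    have h3 := pow_le_pow_left₀ hτ0 (by linarith : ‖τ‖ ≤ b) 2
    linarith
  -- The leading term of the eigenvalue shift has denominator `2(2m + 1)`. Passing to `4m`, and
  -- dropping the next term, costs `O(m⁻²)`.
  have hμ' : ‖μ * η - (σ ^ 2 + τ ^ 2) / (4 * m)‖ ≤ C / m ^ 2 := by
    have h1 : μ * η - (σ ^ 2 + τ ^ 2) / (4 * m) =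
        (z - (η * (2 * m + 1) + (σ ^ 2 + τ ^ 2) / (2 * (η * (2 * m + 1))) +
          ε * (τ ^ 2 - σ ^ 2) / (2 * (η * (2 * m + 1)) ^ 2))) * η +
        ε * (τ ^ 2 - σ ^ 2) * η / (2 * (2 * m + 1) ^ 2) -
        (σ ^ 2 + τ ^ 2) / (4 * m * (2 * m + 1)) := by
      have h2 : (σ ^ 2 + τ ^ 2) / (2 * (η * (2 * m + 1))) =
          η * ((σ ^ 2 + τ ^ 2) / (2 * (2 * m + 1))) := by
        field_simp; linear_combination -(σ ^ 2 + τ ^ 2) * hη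
      have h3 : ε * (τ ^ 2 - σ ^ 2) / (2 * (η * (2 * m + 1)) ^ 2) =
          ε * (τ ^ 2 - σ ^ 2) / (2 * (2 * m + 1) ^ 2) := by
        rw [mul_pow, sq η, hη, one_mul]
      have h4 : (σ ^ 2 + τ ^ 2) / (4 * m) = (σ ^ 2 + τ ^ 2) / (2 * (2 * m + 1)) +
          (σ ^ 2 + τ ^ 2) / (4 * m * (2 * m + 1)) := by
        have h5 : (4 * m : ℂ) ≠ 0 := mul_ne_zero (by norm_num) hmc
        have h6 : (2 * (2 * m + 1) : ℂ) ≠ 0 := mul_ne_zero (by norm_num) hmc1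
        have h7 := mul_ne_zero h5 hmc1
        rw [div_add_div _ _ h6 h7, div_eq_div_iff h5 (mul_ne_zero h6 h7)]
        ring
      rw [h2, h3, h4, hμd]
      linear_combination ((σ ^ 2 + τ ^ 2) / (2 * (2 * m + 1))) * hη
    rw [h1]
    have hden : (m : ℝ) ^ 2 ≤ (2 * m + 1) ^ 3 := by nlinarith [pow_pos hm0 2, pow_pos hm0 3]
    have e1 : ‖(z - (η * (2 * m + 1) + (σ ^ 2 + τ ^ 2) / (2 * (η * (2 * m + 1))) +
          ε * (τ ^ 2 - σ ^ 2) / (2 * (η * (2 * m + 1)) ^ 2))) * η‖ ≤ K / m ^ 2 := by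
      rw [norm_mul, hηn, mul_one]
      exact hasy.trans (by gcongr)
    have n1 : ‖(2 * m + 1 : ℂ)‖ = 2 * m + 1 := by
      have : (2 * m + 1 : ℂ) = ((2 * m + 1 : ℕ) : ℂ) := by push_cast; rfl
      rw [this, Complex.norm_natCast]; push_cast; rfl
    have e2 : ‖ε * (τ ^ 2 - σ ^ 2) * η / (2 * (2 * m + 1) ^ 2)‖ ≤ b ^ 2 / m ^ 2 := by
      rw [norm_div, norm_mul, hηn, mul_one, norm_mul (2 : ℂ), norm_pow, n1, RCLike.norm_ofNat]
      rw [div_le_div_iff₀ (by positivity) (by positivity)]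
      have := mul_le_mul_of_nonneg_right hd (sq_nonneg (m : ℝ))
      nlinarith [show 0 ≤ b ^ 2 * (m : ℝ) by positivity,
        show 0 ≤ b ^ 2 * (m : ℝ) ^ 2 by positivity, sq_nonneg b]
    have e3 : ‖(σ ^ 2 + τ ^ 2) / (4 * m * (2 * m + 1))‖ ≤ b ^ 2 / m ^ 2 := by
      rw [norm_div, norm_mul, norm_mul, n1, RCLike.norm_ofNat, Complex.norm_natCast]
      rw [div_le_div_iff₀ (by positivity) (by positivity)]
      have := mul_le_mul_of_nonneg_right hs (sq_nonneg (m : ℝ))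
      nlinarith [show 0 ≤ b ^ 2 * (m : ℝ) by positivity, show 0 ≤ b ^ 2 * (m : ℝ) ^ 2 by positivity]
    refine (norm_sub_le _ _).trans ((add_le_add ((norm_add_le _ _).trans (add_le_add e1 e2))
      e3).trans ?_)
    rw [← add_div, ← add_div, hC]
    exact div_le_div_of_nonneg_right (by nlinarith [sq_nonneg b]) (by positivity)
  obtain ⟨D, hD⟩ : ∃ D : ℕ → ℂ, ∀ k, D k = η * gap m k + μ := ⟨_, fun _ => rfl⟩
  have hDz : ∀ k < m, z - ε * alt k * (2 * k + 1) = D k := by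
    intro k hk
    have := diag_sub_eq_gap ε hk.le
    rw [← hηd] at this
    rw [hD, hμd]; linear_combination this
  have hD0 : ∀ k < m, D k ≠ 0 := by
    intro k hk h0
    have h1 : η * gap m k = -μ := by rw [hD] at h0; linear_combination h0
    have h2 := congrArg norm h1
    rw [norm_mul, hηn, one_mul, Complex.norm_natCast, norm_neg] at h2
    have h3 : (2 : ℝ) ≤ gap m k := by exact_mod_cast two_le_gap hk
    linarith
  refine ⟨threeTerm σ τ δ D m * ∏ j ∈ Finset.range m, (1 + μ * η * (gap m j : ℂ)⁻¹), ?_, ?_⟩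
  · exact first_component_expansion hm3 (by linarith) hη (by linarith) (by linarith)
      (by linarith) (hz.trans (by gcongr)) hμ' hr hD rfl rfl (fun k _ => rfl)
  · have h1 := mul_prod_link_eq hw.eq hDz hD0 m le_rfl
    rw [hw.one, one_mul] at h1
    have h2 : ∏ j ∈ Finset.range m, D j = η ^ m * (4 ^ m * m.factorial) *
        ∏ j ∈ Finset.range m, (1 + μ * η * (gap m j : ℂ)⁻¹) := by
      have h3 : ∀ j ∈ Finset.range m,
          D j = η * gap m j * (1 + μ * η * (gap m j : ℂ)⁻¹) := by
        intro j hj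
        have h4 : (gap m j : ℂ) ≠ 0 :=
          Nat.cast_ne_zero.2 (by have := two_le_gap (Finset.mem_range.1 hj); omega)
        rw [hD]; field_simp
        linear_combination -μ * hη
      rw [Finset.prod_congr rfl h3, Finset.prod_mul_distrib, Finset.prod_mul_distrib,
        Finset.prod_const, Finset.card_range, prod_gap_eq]
    rw [h1, h2]; ring

/-- The first-order terms of the two factors have opposite signs, so `(1 - y)(1 + y) = 1 - y²`
contributes only at second order. -/
theorem exists_inverse_perturbation {f f' y θ : ℂ} {R S : ℝ} (hf : ‖f - (1 - y)‖ ≤ R)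
    (hf' : ‖f' - (1 + y)‖ ≤ R) (hy1 : ‖y‖ ≤ 1) (hy2 : ‖y * y‖ ≤ R) (hθ : ‖θ‖ ≤ S)
    (hRS : 12 * R + S ≤ 1 / 2) :
    ∃ e : ℂ, ‖e‖ ≤ 2 * (12 * R + S) ∧ (1 + e) * ((1 + θ) * (f * f')) = 1 := by
  have hR0 : 0 ≤ R := (norm_nonneg _).trans hf
  have hS0 : 0 ≤ S := (norm_nonneg _).trans hθ
  have hff : ‖f * f' - 1‖ ≤ 6 * R := by
    have h1 : f * f' - 1 = -(y * y) + (f - (1 - y)) * (1 + y) + (f' - (1 + y)) * (1 - y) +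
        (f - (1 - y)) * (f' - (1 + y)) := by ring
    have h2 : ‖1 + y‖ ≤ 2 := (norm_add_le _ _).trans (by rw [norm_one]; linarith)
    have h3 : ‖1 - y‖ ≤ 2 := (norm_sub_le _ _).trans (by rw [norm_one]; linarith)
    have k1 := mul_le_mul hf h2 (norm_nonneg _) hR0
    have k2 := mul_le_mul hf' h3 (norm_nonneg _) hR0
    have k3 := mul_le_mul hf hf' (norm_nonneg _) hR0
    rw [← norm_mul] at k1 k2 k3
    rw [← norm_neg] at hy2
    have k4 : R * R ≤ R := by nlinarith
    rw [h1]
    refine (norm_add_le _ _).trans ((add_le_add ((norm_add_le _ _).trans (add_le_add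
      ((norm_add_le _ _).trans (add_le_add hy2 k1)) k2)) k3).trans ?_)
    linarith
  obtain ⟨φ, hφ⟩ : ∃ φ, φ = (1 + θ) * (f * f') - 1 := ⟨_, rfl⟩
  have hφn : ‖φ‖ ≤ 12 * R + S := by
    have h1 : φ = (f * f' - 1) * (1 + θ) + θ := by rw [hφ]; ring
    have h2 : ‖1 + θ‖ ≤ 2 := (norm_add_le _ _).trans (by rw [norm_one]; linarith)
    have h3 := mul_le_mul hff h2 (norm_nonneg _) (by linarith)
    rw [← norm_mul] at h3
    rw [h1]
    exact (norm_add_le _ _).trans (by linarith)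
  have hφ1 : 1 / 2 ≤ ‖1 + φ‖ := by
    have := norm_sub_norm_le 1 (-φ)
    rw [sub_neg_eq_add, norm_neg, norm_one] at this
    linarith
  have hφ0 : 1 + φ ≠ 0 := by rw [← norm_pos_iff]; linarith
  refine ⟨-φ / (1 + φ), ?_, ?_⟩
  · rw [norm_div, norm_neg, div_le_iff₀ (by linarith)]
    have := mul_le_mul_of_nonneg_left hφ1 (show 0 ≤ 2 * (12 * R + S) by linarith)
    linarith
  · have h1 : (1 + θ) * (f * f') = 1 + φ := by rw [hφ]; ring
    rw [h1]; field_simp; ring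

/-- The splitting of the eigenvalues near a resonant site of two one-sided chains. -/
theorem halfChain_gap_asymptotics {ε : ℂ} (hε : ε = 1 ∨ ε = -1) (σ τ δ : ℂ) :
    ∃ (K : ℝ) (N : ℕ), 0 ≤ K ∧ ∀ m : ℕ, N ≤ m → ∀ b : ℝ, b = (halfChain ε hε σ τ δ).bound →
      ∀ z z' w w',
      (halfChain ε hε σ τ δ).IsEigen m z w → (halfChain ε hε σ τ (-δ)).IsEigen m z' w' →
      ‖z - ε * alt m * (2 * m + 1)‖ ≤ 8 * b ^ 2 / m →
      ‖z' - ε * alt m * (2 * m + 1)‖ ≤ 8 * b ^ 2 / m →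
      ∃ e : ℂ, ‖e‖ ≤ K * (Real.log m ^ 2 / m ^ 2) ∧
        z - z' = 2 * (δ * (∏ j ∈ Finset.range m, link σ τ j) ^ 2) /
          (4 ^ (2 * m) * (m.factorial : ℂ) ^ 2) * (1 + e) := by
  obtain ⟨b, hb⟩ : ∃ b, b = (halfChain ε hε σ τ δ).bound := ⟨_, rfl⟩
  have hb1 : 1 ≤ b := by rw [hb]; exact Chain.one_le_bound _
  have hbd : b = ‖σ‖ + ‖τ‖ + ‖δ‖ + 3 := hb
  have hb' : b = (halfChain ε hε σ τ (-δ)).bound := by rw [hb]; simp [halfChain]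
  obtain ⟨C, hC⟩ : ∃ C, C = 9 * (2 * (120 * b ^ 2) ^ 2) ^ 6 + 8 * b ^ 2 := ⟨_, rfl⟩
  obtain ⟨T, hT⟩ : ∃ T, T = 4 * (80 * b ^ 3) ^ 2 := ⟨_, rfl⟩
  have hT0 : 0 ≤ T := by rw [hT]; positivity
  have hbC : 8 * b ^ 2 ≤ C := by
    rw [hC]; linarith [show 0 ≤ 9 * (2 * (120 * b ^ 2) ^ 2) ^ 6 by positivity]
  have hC1 : 1 ≤ C := by nlinarith
  have hδC : ‖δ‖ ≤ C := by nlinarith [norm_nonneg σ, norm_nonneg τ]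
  obtain ⟨Q, hQ⟩ : ∃ Q, Q = 360 * C ^ 4 + T := ⟨_, rfl⟩
  have hC0 : 0 < C := by linarith
  have hQ0 : 0 < Q := by rw [hQ]; positivity
  have hCC : C ≤ C ^ 2 := by rw [sq]; exact le_mul_of_one_le_left hC0.le hC1
  have hC4 : 1 ≤ C ^ 4 := one_le_pow₀ hC1
  have hC2 : 0 ≤ C ^ 2 := by positivity
  -- The threshold makes `log m / m` small against both the constant of the expansion and the
  -- constant of the final error.
  have hlim := Real.tendsto_pow_log_div_mul_add_atTop 1 0 1 one_ne_zero
  have hev := (hlim.comp tendsto_natCast_atTop_atTop).eventually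
    (ge_mem_nhds (show 0 < 1 / (2 * Q + 8 * C ^ 2) by positivity))
  obtain ⟨N, hN⟩ := Filter.eventually_atTop.1 hev
  obtain ⟨N', hN'⟩ := exists_nat_ge (160 * b ^ 2)
  refine ⟨2 * Q, max N N', by positivity, fun m hm b' hbb' z z' w w' hw hw' hz hz' => ?_⟩
  rw [hbb', ← hb] at hz hz'
  have hmN : 160 * b ^ 2 ≤ m := hN'.trans (by exact_mod_cast (le_max_right _ _).trans hm)
  have hm160 : (160 : ℝ) ≤ m := by nlinarith
  have hm0 : (0 : ℝ) < m := by linarith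
  have hr := hN m ((le_max_left _ _).trans hm)
  simp only [Function.comp, pow_one, one_mul, add_zero] at hr
  rw [le_div_iff₀ (by positivity)] at hr
  have hlog : 1 ≤ Real.log m := by
    rw [Real.le_log_iff_exp_le hm0]
    linarith [Real.exp_one_lt_d9]
  have hmr : 1 / (m : ℝ) ≤ Real.log m / m := by gcongr
  have hr0 : 0 < Real.log m / m := lt_of_lt_of_le (by positivity) hmr
  have hQr : 0 ≤ Q * (Real.log m / m) := by positivity
  have hCr : 0 ≤ C ^ 2 * (Real.log m / m) := by positivity
  have hr8 : 8 * C ^ 2 * (Real.log m / m) ≤ 1 := by linarith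
  obtain ⟨f, hf, hL⟩ := halfChain_first_component hb hC hmN hw hz hr8
  obtain ⟨f', hf', hL'⟩ := halfChain_first_component hb' hC hmN hw' hz' hr8
  have hhalf : ∀ u : ℂ, ‖u - ε * alt m * (2 * m + 1)‖ ≤ 8 * b ^ 2 / m →
      ‖u - ε * alt m * (2 * m + 1)‖ ≤ 1 / 2 := fun u hu => by
    refine hu.trans ?_
    rw [div_le_iff₀ hm0]; linarith
  obtain ⟨θ, hθ, hsplit⟩ := halfChain_splitting hb hmN hw hw' (hhalf z hz) (hhalf z' hz')
  rw [← div_pow]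
  obtain ⟨r, hrd⟩ : ∃ r, r = Real.log m / m := ⟨_, rfl⟩
  rw [← hrd] at hr hmr hr0 hQr hCr hf hf' ⊢
  rw [← hT] at hθ
  clear hC hT hbd hz hz' hb' hhalf hN hN' hlim hev
  obtain ⟨y, hy⟩ : ∃ y, y = δ * (ε * alt m) / gap m 0 := ⟨_, rfl⟩
  rw [neg_mul, neg_div, ← hy, sub_neg_eq_add] at hf'
  rw [← hy] at hf
  have hηn : ‖ε * alt m‖ = 1 := by rw [norm_mul, norm_sign hε, norm_alt, one_mul]
  have hyn : ‖y‖ ≤ C * r := by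
    have h1 : (m : ℝ) ≤ gap m 0 := by
      have := two_mul_le_gap_zero m
      exact_mod_cast (by omega : m ≤ gap m 0)
    rw [hy, norm_div, norm_mul, hηn, mul_one, Complex.norm_natCast]
    refine (div_le_div₀ (by linarith) hδC hm0 h1).trans ?_
    rw [div_eq_mul_one_div]; exact mul_le_mul_of_nonneg_left hmr (by linarith)
  have hr1 : r ≤ 1 := by
    have := mul_le_mul_of_nonneg_right (hC1.trans hCC) hr0.le
    linarith
  have hrr : r ^ 2 ≤ r := by rw [sq]; exact mul_le_of_le_one_left hr0.le hr1
  have hQr2 : Q * r ^ 2 ≤ 1 / 2 := by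
    have := mul_le_mul_of_nonneg_left hrr (show 0 ≤ Q by positivity)
    linarith
  obtain ⟨R, hR⟩ : ∃ R, R = 30 * C ^ 4 * r ^ 2 := ⟨_, rfl⟩
  have hR0 : 0 ≤ R := by rw [hR]; positivity
  have hTr : 0 ≤ T * r ^ 2 := by positivity
  have hQR : Q * r ^ 2 = 12 * R + T * r ^ 2 := by rw [hQ, hR]; ring
  rw [← hR] at hf hf'
  have hy2 : ‖y * y‖ ≤ R := by
    rw [norm_mul]
    refine (mul_le_mul hyn hyn (norm_nonneg _) (by positivity)).trans ?_
    have : C ^ 2 * r ^ 2 ≤ C ^ 4 * r ^ 2 :=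
      mul_le_mul_of_nonneg_right (pow_le_pow_right₀ hC1 (by norm_num)) (by positivity)
    have h4 : 0 ≤ C ^ 4 * r ^ 2 := by positivity
    rw [hR]; linarith
  have hy1 : ‖y‖ ≤ 1 := by
    have : C * r ≤ C ^ 2 * r := mul_le_mul_of_nonneg_right hCC hr0.le
    linarith
  have hθr : ‖θ‖ ≤ T * r ^ 2 := by
    refine hθ.trans ?_
    rw [div_eq_mul_one_div, ← one_div_pow]
    exact mul_le_mul_of_nonneg_left (pow_le_pow_left₀ (by positivity) hmr 2) hT0
  obtain ⟨e, he, he1⟩ := exists_inverse_perturbation hf hf' hy1 hy2 hθr (by linarith)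
  refine ⟨e, by linarith, ?_⟩
  have hfac : (m.factorial : ℂ) ≠ 0 := Nat.cast_ne_zero.2 m.factorial_ne_zero
  have hη2 : ((ε * alt m) ^ m) * ((ε * alt m) ^ m) = 1 := by
    have h1 := alt_sq m
    have h2 : ε * ε = 1 := by rcases hε with rfl | rfl <;> norm_num
    rw [← mul_pow, show ε * alt m * (ε * alt m) = ε * ε * (alt m * alt m) by ring, h1, h2,
      mul_one, one_pow]
  -- Multiplying the formulas for the two first components brings in `w 0 * w' 0`, the quantity of
  -- the Green identity; the signs `η ^ m` square to `1`.
  have hLL : (∏ j ∈ Finset.range m, link σ τ j) ^ 2 =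
      w 0 * w' 0 * (4 ^ (2 * m) * (m.factorial : ℂ) ^ 2) * (f * f') := by
    rw [sq]; nth_rewrite 1 [hL]; rw [hL', mul_comm 2 m, pow_mul]
    linear_combination (w 0 * w' 0 * ((4 ^ m) ^ 2 * (m.factorial : ℂ) ^ 2) * (f * f')) * hη2
  rw [hLL, div_mul_eq_mul_div, eq_div_iff
    (mul_ne_zero (pow_ne_zero _ (by norm_num)) (pow_ne_zero _ hfac))]
  linear_combination (4 ^ (2 * m) * (m.factorial : ℂ) ^ 2) * (1 + e) * (f * f') * hsplit -
    (z - z') * (4 ^ (2 * m) * (m.factorial : ℂ) ^ 2) * he1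

/-! ### Eigenvalues of the Dirac operator -/

/-- Among the first `m` links `σ` occurs `⌈m/2⌉` times and `τ` occurs `⌊m/2⌋` times. Hence the
numerator of the splitting is a square root of a monomial in `Ab` and `aB`. -/
theorem sq_mul_prod_link (σ τ : ℂ) (m : ℕ) :
    (τ * (∏ j ∈ Finset.range m, link σ τ j) ^ 2) ^ 2 =
      if Even m then (σ ^ 2) ^ m * (τ ^ 2) ^ (m + 1) else (σ ^ 2) ^ (m + 1) * (τ ^ 2) ^ m := by
  induction m with
  | zero => simp
  | succ m ih =>
    have hstep : ∀ P x : ℂ, (τ * (P * x) ^ 2) ^ 2 = (τ * P ^ 2) ^ 2 * x ^ 4 := fun P x => by ring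
    rw [Finset.prod_range_succ, hstep, ih]
    by_cases h : Even m
    · have h1 : link σ τ m = σ := if_pos ((Int.even_coe_nat m).2 h)
      rw [if_pos h, if_neg (by rw [Nat.even_add_one, not_not]; exact h), h1]
      ring
    · have h1 : link σ τ m = τ := if_neg (by rwa [Int.even_coe_nat])
      rw [if_neg h, if_pos (Nat.even_add_one.2 h), h1]
      ring

/-- The symmetric and the antisymmetric part contribute one eigenvalue each, with `δ = τ` and `δ =
-τ`. They may coincide, so multiplicities are added. -/
theorem exists_pair_symChain_one {ε : ℂ} (hε : ε = 1 ∨ ε = -1) (σ τ : ℂ) :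
    ∃ (K : ℝ) (N : ℕ), 0 ≤ K ∧ ∀ m : ℕ, N ≤ m → ∀ n : ℂ, n = ε * alt m * (2 * m + 1) → ∃ l l' : ℂ,
      ‖l - n‖ < 1 / 2 ∧ ‖l' - n‖ < 1 / 2 ∧
      (∀ z : ℂ, ‖z - n‖ ≤ 1 / 2 → Module.rank ℂ ((symChain ε hε 1 σ τ).op.maxGenEigenspace z) =
        (if z = l then 1 else 0) + if z = l' then 1 else 0) ∧
      ‖l - (n + (σ ^ 2 + τ ^ 2) / (2 * n) + ε * (τ ^ 2 - σ ^ 2) / (2 * n ^ 2))‖ ≤ K / ‖n‖ ^ 3 ∧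
      ‖l' - (n + (σ ^ 2 + τ ^ 2) / (2 * n) + ε * (τ ^ 2 - σ ^ 2) / (2 * n ^ 2))‖ ≤ K / ‖n‖ ^ 3 ∧
      ∃ e : ℂ, ‖e‖ ≤ K * (Real.log m ^ 2 / m ^ 2) ∧
        l - l' = 2 * (τ * (∏ j ∈ Finset.range m, link σ τ j) ^ 2) /
          (4 ^ (2 * m) * (m.factorial : ℂ) ^ 2) * (1 + e) := by
  obtain ⟨b, hb⟩ : ∃ b, b = (halfChain ε hε σ τ τ).bound := ⟨_, rfl⟩
  have hb' : b = (halfChain ε hε σ τ (-τ)).bound := by rw [hb]; simp [halfChain]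
  obtain ⟨K, N, hK, hgap⟩ := halfChain_gap_asymptotics hε σ τ τ
  obtain ⟨N', hN'⟩ := exists_nat_ge (160 * b ^ 2)
  refine ⟨max K (9 * (2 * (120 * b ^ 2) ^ 2) ^ 6), max N N', le_max_of_le_left hK, ?_⟩
  rintro m hm n rfl
  have hmb : 160 * b ^ 2 ≤ m := hN'.trans (by exact_mod_cast (le_max_right _ _).trans hm)
  obtain ⟨l, w, hw, hl, hl2, hrank⟩ := exists_halfChain_eigen hε σ τ τ m hb hmb
  obtain ⟨l', w', hw', hl', hl2', hrank'⟩ := exists_halfChain_eigen hε σ τ (-τ) m hb' hmb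
  refine ⟨l, l', hl2, hl2', fun z hz => ?_, ?_, ?_, ?_⟩
  · rw [rank_symChain_one, hrank z hz, hrank' z hz]
  · exact (halfChain_eigenvalue_asymptotics hb hmb hw hl2.le).trans
      (div_le_div_of_nonneg_right (le_max_right _ _) (by positivity))
  · exact (halfChain_eigenvalue_asymptotics hb' hmb hw' hl2'.le).trans
      (div_le_div_of_nonneg_right (le_max_right _ _) (by positivity))
  · obtain ⟨e, he, heq⟩ := hgap m ((le_max_left _ _).trans hm) b hb l l' w w' hw hw' hl hl'
    exact ⟨e, he.trans (mul_le_mul_of_nonneg_right (le_max_left _ _) (by positivity)), heq⟩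

/-- This excludes contributions, near an odd `n`, of the chain that has `-n` instead of `n` on its
diagonal. -/
theorem rank_symChain_one_eq_zero {ε : ℂ} (hε : ε = 1 ∨ ε = -1) (σ τ : ℂ) :
    ∃ N : ℕ, ∀ m : ℕ, N ≤ m → ∀ z, ‖z - -(ε * alt m * (2 * m + 1))‖ ≤ 1 / 2 →
      Module.rank ℂ ((symChain ε hε 1 σ τ).op.maxGenEigenspace z) = 0 := by
  obtain ⟨b, hb⟩ : ∃ b, b = (halfChain ε hε σ τ τ).bound := ⟨_, rfl⟩
  have hb' : b = (halfChain ε hε σ τ (-τ)).bound := by rw [hb]; simp [halfChain]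
  have hb1 : 1 ≤ b := by rw [hb]; exact Chain.one_le_bound _
  have hbd : b = ‖σ‖ + ‖τ‖ + ‖τ‖ + 3 := hb
  obtain ⟨N, hN⟩ := exists_nat_ge (40 * b ^ 2)
  refine ⟨N, fun m hm z hz => ?_⟩
  have hmb : 40 * b ^ 2 ≤ m := hN.trans (by exact_mod_cast hm)
  have hm1 : ‖τ‖ + 1 ≤ m := by nlinarith [norm_nonneg σ, norm_nonneg τ]
  rw [rank_symChain_one, (isolated_halfChain_neg hε σ τ τ m hm1).rank_of_empty (by rwa [← hb]) hz,
    (isolated_halfChain_neg hε σ τ (-τ) m (by rwa [norm_neg])).rank_of_empty (by rwa [← hb']) hz,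
    add_zero]

/-- The eigenvalues of the antiperiodic Dirac operator near a large odd number `n`. -/
theorem exists_pair_odd {a A b B σ τ : ℂ} (ha : a ≠ 0) (hA : A ≠ 0) (hb : b ≠ 0) (hB : B ≠ 0)
    (hσ : σ ^ 2 = A * b) (hτ : τ ^ 2 = a * B) :
    ∃ (K : ℝ) (N : ℕ), 0 ≤ K ∧ ∀ m : ℕ, N ≤ m → ∀ n η : ℂ, (η = 1 ∨ η = -1) →
      n = η * (2 * m + 1) → ∃ l l' : ℂ, ‖l - n‖ < 1 / 2 ∧ ‖l' - n‖ < 1 / 2 ∧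
      (∀ z : ℂ, ‖z - n‖ ≤ 1 / 2 → Module.rank ℂ ((diracChain a A b B 1).op.maxGenEigenspace z) =
        (if z = l then 1 else 0) + if z = l' then 1 else 0) ∧
      ‖l - (n + (A * b + a * B) / (2 * n) + (a * B - A * b) / (2 * n ^ 2))‖ ≤ K / ‖n‖ ^ 3 ∧
      ‖l' - (n + (A * b + a * B) / (2 * n) + (a * B - A * b) / (2 * n ^ 2))‖ ≤ K / ‖n‖ ^ 3 ∧
      ∃ s e : ℂ, s ^ 2 = (if η = 1 then (A * b) ^ m * (a * B) ^ (m + 1)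
          else (A * b) ^ (m + 1) * (a * B) ^ m) ∧
        ‖e‖ ≤ K * (Real.log m ^ 2 / m ^ 2) ∧
        l - l' = 2 * s / (4 ^ (2 * m) * (m.factorial : ℂ) ^ 2) * (1 + e) := by
  obtain ⟨K₁, N₁, hK₁, h₁⟩ := exists_pair_symChain_one (Or.inl rfl) σ τ
  obtain ⟨K₂, N₂, hK₂, h₂⟩ := exists_pair_symChain_one (Or.inr rfl) τ σ
  obtain ⟨N₃, h₃⟩ := rank_symChain_one_eq_zero (Or.inl rfl) σ τ
  obtain ⟨N₄, h₄⟩ := rank_symChain_one_eq_zero (Or.inr rfl) τ σ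
  have hne : (-1 : ℂ) ≠ 1 := by norm_num
  refine ⟨max K₁ K₂, max (max N₁ N₂) (max N₃ N₄), le_max_of_le_left hK₁, ?_⟩
  intro m hm n η hη hn
  simp only [max_le_iff] at hm
  obtain ⟨⟨hm₁, hm₂⟩, hm₃, hm₄⟩ := hm
  have hrank := rank_diracChain ha hA hb hB hσ hτ 1
  have hηm : alt m = η ∨ alt m = -η := by
    unfold alt; rcases hη with rfl | rfl <;> split_ifs <;> simp
  have heven : alt m = 1 ↔ Even m := by
    unfold alt
    by_cases h : Even m
    · simp [h]
    · simp [h, hne]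
  -- Exactly one chain is resonant at `n`: the one with `ε = 1` if `alt m = η`, otherwise the one
  -- with `ε = -1`.
  rcases hηm with h | h
  · obtain ⟨l, l', hl, hl', hr, q, q', e, he, heq⟩ :=
      h₁ m hm₁ n (by rw [hn, h]; ring)
    rw [hσ, hτ, one_mul] at q q'
    refine ⟨l, l', hl, hl', fun z hz => ?_,
      q.trans (div_le_div_of_nonneg_right (le_max_left _ _) (by positivity)),
      q'.trans (div_le_div_of_nonneg_right (le_max_left _ _) (by positivity)), _, e, ?_,
      he.trans (mul_le_mul_of_nonneg_right (le_max_left _ _) (by positivity)), heq⟩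
    · rw [hrank, hr z hz, h₄ m hm₄ z (by
        convert hz using 3; rw [hn, h]; ring), add_zero]
    · rw [sq_mul_prod_link, hσ, hτ]
      simp only [← heven, h]
  · obtain ⟨l, l', hl, hl', hr, q, q', e, he, heq⟩ :=
      h₂ m hm₂ n (by rw [hn, h]; ring)
    rw [hσ, hτ, show -1 * (A * b - a * B) = a * B - A * b by ring, add_comm (a * B)] at q q'
    refine ⟨l, l', hl, hl', fun z hz => ?_,
      q.trans (div_le_div_of_nonneg_right (le_max_right _ _) (by positivity)),
      q'.trans (div_le_div_of_nonneg_right (le_max_right _ _) (by positivity)), _, e, ?_,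
      he.trans (mul_le_mul_of_nonneg_right (le_max_right _ _) (by positivity)), heq⟩
    · rw [hrank, hr z hz, h₃ m hm₃ z (by
        convert hz using 3; rw [hn, h]; ring), zero_add]
    · rw [sq_mul_prod_link, hσ, hτ]
      simp only [← heven, h]
      -- In the second chain `σ` and `τ` are interchanged, but the parity of `m` is also the
      -- opposite one for the given sign of `n`, so the exponents agree with those of the first
      -- case.
      rcases hη with rfl | rfl
      · rw [if_neg hne, if_pos rfl, mul_comm]
      · rw [neg_neg, if_pos rfl, if_neg hne, mul_comm]

/-- The double eigenvalue of the periodic Dirac operator near a large even number `n`. -/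
theorem exists_eigenvalue_even {a A b B σ τ : ℂ} (ha : a ≠ 0) (hA : A ≠ 0) (hb : b ≠ 0)
    (hB : B ≠ 0) (hσ : σ ^ 2 = A * b) (hτ : τ ^ 2 = a * B) :
    ∃ (K : ℝ) (N : ℕ), ∀ n : ℤ, Even n → (N : ℤ) < |n| → ∃ l : ℂ, ‖l - n‖ < 1 / 2 ∧
      (∀ z : ℂ, ‖z - n‖ ≤ 1 / 2 → Module.rank ℂ ((diracChain a A b B 0).op.maxGenEigenspace z) =
        (if z = l then 1 else 0) + if z = l then 1 else 0) ∧
      ‖l - (n + (A * b + a * B) / (2 * n) + (a * B - A * b) / (2 * (n : ℂ) ^ 2))‖ ≤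
        K / |(n : ℝ)| ^ 3 := by
  obtain ⟨K, N, h⟩ := exists_eigenvalue_symChain_zero σ τ
  refine ⟨K, 2 * N, fun n hn hN => ?_⟩
  -- Every even `n` is a diagonal entry: with `n = 2k`, the site is `k` or `-k` according to the
  -- parity of `k`.
  obtain ⟨m, hm, hmn⟩ : ∃ m : ℤ, (N : ℤ) ≤ |m| ∧ alt m * (2 * m) = n := by
    obtain ⟨k, rfl⟩ := hn
    have hk : (N : ℤ) ≤ |k| := by
      rw [← two_mul, abs_mul, abs_two] at hN
      push_cast at hN
      linarith
    by_cases he : Even k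
    · exact ⟨k, hk, by unfold alt; rw [if_pos he]; push_cast; ring⟩
    · exact ⟨-k, by rwa [abs_neg], by rw [alt_neg]; unfold alt; rw [if_neg he]; push_cast; ring⟩
  obtain ⟨l, hl, hr, hq⟩ := h m hm
  rw [hmn] at hl hr hq
  rw [hσ, hτ, Complex.norm_intCast] at hq
  refine ⟨l, hl, fun z hz => ?_, hq⟩
  rw [rank_diracChain ha hA hb hB hσ hτ, rank_symChain_reflect, hr z hz]

/-! ### Ordering the eigenvalues and assembling the theorem -/

theorem isEigenvaluePair_of_rank {a A b B : ℂ} {n p : ℤ} {l l' : ℂ}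
    (hp : boundarySign n * mode p Real.pi = 1) (hl : ‖l - n‖ < 1 / 2) (hl' : ‖l' - n‖ < 1 / 2)
    (hr : ∀ z : ℂ, ‖z - n‖ ≤ 1 / 2 → Module.rank ℂ ((diracChain a A b B p).op.maxGenEigenspace z) =
        (if z = l then 1 else 0) + if z = l' then 1 else 0)
    (hll : l.re < l'.re ∨ l.re = l'.re ∧ l.im ≤ l'.im) :
    IsEigenvaluePair (trigPotential a A) (trigPotential b B) n l l' := by
  refine ⟨by rwa [Metric.mem_ball, dist_eq_norm], by rwa [Metric.mem_ball, dist_eq_norm],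
    fun z hz => ?_, hll⟩
  rw [Metric.mem_ball, dist_eq_norm] at hz
  rw [algebraicMultiplicity_diracOperator a A b B p hp, hr z hz.le, Multiset.insert_eq_cons,
    Multiset.count_cons, Multiset.count_singleton]
  push_cast
  rw [add_comm]

theorem boundarySign_mul_mode_of_even {n : ℤ} (hn : Even n) :
    boundarySign n * mode 0 Real.pi = 1 := by
  simp [boundarySign, hn, mode]

theorem boundarySign_mul_mode_of_odd {n : ℤ} (hn : ¬Even n) :
    boundarySign n * mode 1 Real.pi = 1 := by
  rw [boundarySign, if_neg hn, mode, Int.cast_one, mul_one, mul_comm Complex.I,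
    Complex.exp_pi_mul_I]
  norm_num

/-- The conclusions about the eigenvalues near an odd number, with the eigenvalues in order. -/
theorem exists_ordered_pair_odd {a A b B σ τ : ℂ} (ha : a ≠ 0) (hA : A ≠ 0) (hb : b ≠ 0)
    (hB : B ≠ 0) (hσ : σ ^ 2 = A * b) (hτ : τ ^ 2 = a * B) :
    ∃ (K : ℝ) (N : ℕ), 0 ≤ K ∧ ∀ m : ℕ, N ≤ m → ∀ (n : ℤ) (η : ℂ), (η = 1 ∨ η = -1) →
      (n : ℂ) = η * (2 * m + 1) → ¬Even n → ∃ l l' : ℂ,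
      IsEigenvaluePair (trigPotential a A) (trigPotential b B) n l l' ∧
      ‖l - (n + (A * b + a * B) / (2 * n) + (a * B - A * b) / (2 * (n : ℂ) ^ 2))‖ ≤
        K / |(n : ℝ)| ^ 3 ∧
      ‖l' - (n + (A * b + a * B) / (2 * n) + (a * B - A * b) / (2 * (n : ℂ) ^ 2))‖ ≤
        K / |(n : ℝ)| ^ 3 ∧
      ∃ s e : ℂ, s ^ 2 = (if η = 1 then (A * b) ^ m * (a * B) ^ (m + 1)
          else (A * b) ^ (m + 1) * (a * B) ^ m) ∧
        ‖e‖ ≤ K * (Real.log m ^ 2 / m ^ 2) ∧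
        l' - l = 2 * s / (4 ^ (2 * m) * (m.factorial : ℂ) ^ 2) * (1 + e) := by
  obtain ⟨K, N, hK, h⟩ := exists_pair_odd ha hA hb hB hσ hτ
  refine ⟨K, N, hK, fun m hm n η hη hn hodd => ?_⟩
  obtain ⟨l, l', hl, hl', hr, q, q', s, e, hs, he, heq⟩ := h m hm n η hη hn
  rw [Complex.norm_intCast] at q q'
  have hp := boundarySign_mul_mode_of_odd hodd
  -- The order of the two eigenvalues depends on `n` without a rule. Exchanging them changes the
  -- sign of the difference, which is absorbed in the choice of the square root.
  by_cases hll : l.re < l'.re ∨ l.re = l'.re ∧ l.im ≤ l'.im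
  · refine ⟨l, l', isEigenvaluePair_of_rank hp hl hl' hr hll, q, q', -s, e,
      by rwa [neg_sq], he, ?_⟩
    rw [← neg_sub, heq]; ring
  · refine ⟨l', l, isEigenvaluePair_of_rank hp hl' hl (fun z hz => by rw [hr z hz, add_comm]) ?_,
      q', q, s, e, hs, he, heq⟩
    push Not at hll
    rcases hll.1.lt_or_eq with h1 | h1
    · exact Or.inl h1
    · exact Or.inr ⟨h1, (hll.2 h1.symm).le⟩

theorem mainTheorem1 (a A b B : ℂ) (ha : a ≠ 0) (hA : A ≠ 0) (hb : b ≠ 0) (hB : B ≠ 0) :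
    ∃ (lamMinus lamPlus : ℤ → ℂ) (K : ℝ) (N : ℕ),
      (∀ n : ℤ, (N : ℤ) < |n| →
        IsEigenvaluePair (trigPotential a A) (trigPotential b B) n (lamMinus n) (lamPlus n) ∧
        ‖lamMinus n - (n + (A * b + a * B) / (2 * n) + (a * B - A * b) / (2 * (n : ℂ) ^ 2))‖
          ≤ K / |(n : ℝ)| ^ 3 ∧
        ‖lamPlus n - (n + (A * b + a * B) / (2 * n) + (a * B - A * b) / (2 * (n : ℂ) ^ 2))‖
          ≤ K / |(n : ℝ)| ^ 3 ∧
        (Even n → lamPlus n - lamMinus n = 0)) ∧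
      (∀ m : ℕ, N < m →
        (∃ s ε : ℂ, s ^ 2 = (A * b) ^ m * (a * B) ^ (m + 1) ∧
          ‖ε‖ ≤ K * (Real.log m ^ 2 / (m : ℝ) ^ 2) ∧
          lamPlus (2 * m + 1) - lamMinus (2 * m + 1) =
            2 * s / (4 ^ (2 * m) * (m.factorial : ℂ) ^ 2) * (1 + ε)) ∧
        (∃ s ε : ℂ, s ^ 2 = (A * b) ^ (m + 1) * (a * B) ^ m ∧
          ‖ε‖ ≤ K * (Real.log m ^ 2 / (m : ℝ) ^ 2) ∧
          lamPlus (-(2 * m + 1)) - lamMinus (-(2 * m + 1)) =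
            2 * s / (4 ^ (2 * m) * (m.factorial : ℂ) ^ 2) * (1 + ε))) := by
  -- Any square roots will do: the choice affects at most which root `s` appears in the splitting.
  obtain ⟨σ, hσ⟩ := IsAlgClosed.exists_pow_nat_eq (A * b) two_pos
  obtain ⟨τ, hτ⟩ := IsAlgClosed.exists_pow_nat_eq (a * B) two_pos
  obtain ⟨K₁, N₁, h₁⟩ := exists_eigenvalue_even ha hA hb hB hσ hτ
  obtain ⟨K₂, N₂, hK₂, h₂⟩ := exists_ordered_pair_odd ha hA hb hB hσ hτ
  -- Collecting all assertions for a single `n` first lets one choice of the eigenvalues serve every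
  -- conclusion. For odd `n` the bound `2 * N₂ + 1 < |n| = 2m + 1` ensures `m > N₂`.
  have key : ∀ n : ℤ, ((max N₁ (2 * N₂ + 1) : ℕ) : ℤ) < |n| → ∃ l l' : ℂ,
      IsEigenvaluePair (trigPotential a A) (trigPotential b B) n l l' ∧
      ‖l - (n + (A * b + a * B) / (2 * n) + (a * B - A * b) / (2 * (n : ℂ) ^ 2))‖ ≤
        max K₁ K₂ / |(n : ℝ)| ^ 3 ∧
      ‖l' - (n + (A * b + a * B) / (2 * n) + (a * B - A * b) / (2 * (n : ℂ) ^ 2))‖ ≤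
        max K₁ K₂ / |(n : ℝ)| ^ 3 ∧
      (Even n → l' - l = 0) ∧
      (¬Even n → ∀ m : ℕ, m = (n.natAbs - 1) / 2 → ∃ s e : ℂ,
        s ^ 2 = (if 0 < n then (A * b) ^ m * (a * B) ^ (m + 1)
          else (A * b) ^ (m + 1) * (a * B) ^ m) ∧
        ‖e‖ ≤ max K₁ K₂ * (Real.log m ^ 2 / (m : ℝ) ^ 2) ∧
        l' - l = 2 * s / (4 ^ (2 * m) * (m.factorial : ℂ) ^ 2) * (1 + e)) := by
    intro n hn
    by_cases he : Even n
    · obtain ⟨l, hl, hr, hq⟩ := h₁ n he (by push_cast at hn; omega)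
      have hq' := hq.trans (div_le_div_of_nonneg_right (le_max_left K₁ K₂) (by positivity))
      exact ⟨l, l, isEigenvaluePair_of_rank (boundarySign_mul_mode_of_even he) hl hl hr
        (Or.inr ⟨rfl, le_rfl⟩), hq', hq', fun _ => sub_self l, fun h => absurd he h⟩
    · have hne : (-1 : ℂ) ≠ 1 := by norm_num
      have hodd := Int.not_even_iff_odd.1 he
      rw [Int.odd_iff] at hodd
      obtain ⟨m, hm⟩ : ∃ m : ℕ, m = (n.natAbs - 1) / 2 := ⟨_, rfl⟩
      obtain ⟨η, hη, hηn, hn'⟩ : ∃ η : ℂ, (η = 1 ∨ η = -1) ∧ (η = 1 ↔ 0 < n) ∧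
          (n : ℂ) = η * (2 * m + 1) := by
        by_cases hpos : 0 < n
        · refine ⟨1, Or.inl rfl, iff_of_true rfl hpos, ?_⟩
          have : n = 2 * m + 1 := by omega
          rw [this]; push_cast; ring
        · refine ⟨-1, Or.inr rfl, iff_of_false hne hpos, ?_⟩
          have : n = -(2 * m + 1) := by omega
          rw [this]; push_cast; ring
      obtain ⟨l, l', hp, q, q', s, e, hs, he', heq⟩ :=
        h₂ m (by push_cast at hn; rw [Int.abs_eq_natAbs] at hn; omega) n η hη hn' he
      have hmax := div_le_div_of_nonneg_right (le_max_right K₁ K₂)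
        (show 0 ≤ |(n : ℝ)| ^ 3 by positivity)
      refine ⟨l, l', hp, q.trans hmax, q'.trans hmax, fun h => absurd h he, ?_⟩
      rintro - m' hm'
      obtain rfl : m' = m := hm'.trans hm.symm
      simp only [hηn] at hs
      exact ⟨s, e, hs, he'.trans (mul_le_mul_of_nonneg_right (le_max_right _ _) (by positivity)),
        heq⟩
  choose! l l' hp q q' heven hgap using key
  refine ⟨l, l', max K₁ K₂, max N₁ (2 * N₂ + 1),
    fun n hn => ⟨hp n hn, q n hn, q' n hn, heven n hn⟩, fun m hm => ⟨?_, ?_⟩⟩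
  · have h := hgap (2 * m + 1) (by rw [Int.abs_eq_natAbs]; omega)
      (by rw [Int.not_even_iff_odd]; exact ⟨m, rfl⟩) m (by omega)
    rwa [if_pos (by positivity)] at h
  · have h := hgap (-(2 * m + 1)) (by rw [Int.abs_eq_natAbs]; omega)
      (by rw [Int.not_even_iff_odd]; exact ⟨-m - 1, by ring⟩) m (by omega)
    rwa [if_neg (by omega)] at h
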